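/- **Conventions.** A finite-dimensional $C^*$-Hopf algebra is a finite-dimensional unital $C^*$-algebra $H^0$ with a Hopf algebra structure $(\Delta^0,\epsilon^0,S^0)$ over $\mathbb C$ whose comultiplication $\Delta^0$ is a $*$-homomorphism. Its dual Hopf $*$-algebra is $H=\mathrm{Hom}(H^0,\mathbb C)$ with product $(fg)(x)=f(x_{(1)})g(x_{(2)})$, involution $f^*(x)=\overline{f(S^0(x)^*)}$ and comultiplication $\Delta$ given by $f_{(1)}(x)f_{(2)}(y)=f(xy)$. A coaction of $H^0$ on a unital $C^*$-algebra $A$ is a unital $*$-homomorphism $\rho:A\to A\otimes H^0$ with $(\mathrm{id}\otimes\epsilon^0)\circ\rho=\mathrm{id}$ and $(\rho\otimes\mathrm{id})\circ\rho=(\mathrm{id}\otimes\Delta^0)\circ\rho$. It induces an action of $H$ on $A$, $h\cdot a=(\mathrm{id}\otimes h)(\rho(a))$, and the crossed product $A\rtimes_\rho H$, i.e. the vector space $A\otimes H$ with elements written $a\rtimes h$ and $$(a\rtimes h)(b\rtimes l)=a(h_{(1)}\cdot b)\rtimes h_{(2)}l,\qquad (a\rtimes h)^*=(h_{(1)}^*\cdot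 a^*)\rtimes h_{(2)}^* .$$ The dual coaction is $\widehat\rho: A\rtimes_\rho H\to (A\rtimes_\rho H)\otimes H$, $\widehat\rho(a\rtimes h)=(a\rtimes h_{(1)})\otimes h_{(2)}$. Let $A^\infty=\ell^\infty(\mathbb N,A)/c_0(A)$, with $A\subset A^\infty$ as the classes of constant sequences. A coaction $\rho$ of $H^0$ on $A$ induces a coaction $\rho^\infty$ of $H^0$ on $A^\infty$ by $\rho^\infty((a_n))=(\rho(a_n))$. The algebra $A^\infty\rtimes_{\rho^\infty}H$ is identified with $(A\rtimes_\rho H)^\infty$ by $(a_n)\rtimes h\mapsto(a_n\rtimes h)$; it contains $A\rtimes_\rho H$, and the coaction of $H$ induced on it by $\widehat\rho$ is $\widehat\rho^{\infty}=\widehat{\rho^\infty}$. The coaction $\rho$ has the *Rohlin property* if its dual coaction is approximately representable, i.e. if there is a unitary $w\in(A^\infty\rtimes_{\rho^\infty}H)\otimes H$ such that 1. $\widehat\rho(x)=w(x\otimes1)w^*$ for all $x\in A\rtimes_\rho H$, 2. $(w\otimes1)(\rho_H\otimes\mathrm{id})(w)(\mathrm{id}\otimes\Delta)(w^*)=1$,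 where $\rho_H(y)=y\otimes1$ for $y\in A^\infty\rtimes_{\rho^\infty}H$, 3. $(\widehat\rho^{\infty}\otimes\mathrm{id})(w)(w\otimes1)(\mathrm{id}\otimes\Delta)(w^*)=1$. Coactions $\rho,\sigma$ of $H^0$ on $A$ are *approximately unitarily equivalent* if there is a unitary $v\in A^\infty\otimes H^0$ with $\sigma(a)=v\rho(a)v^*$ in $A^\infty\otimes H^0$ for all $a\in A$. An automorphism $\theta$ of $A$ is *approximately inner* if for every finite set $F\subset A$ and every $\varepsilon>0$ there is a unitary $u\in A$ with $\|\theta(a)-uau^*\|<\varepsilon$ for all $a\in F$. **Theorem.** Let $A$ be a separable unital $C^*$-algebra, and let $\rho$ and $\sigma$ be coactions of a finite-dimensional $C^*$-Hopf algebra $H^0$ on $A$, both with the Rohlin property. If $\rho$ and $\sigma$ are approximately unitarily equivalent, then there is an approximately inner automorphism $\theta$ of $A$ such that $$\sigma=(\theta\otimes\mathrm{id})\circ\rho\circ\theta^{-1}.$$ -/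

import Mathlib

open scoped TensorProduct

noncomputable section

/-- A finite-dimensional C*-Hopf algebra: a finite-dimensional unital C*-algebra which is a Hopf
algebra over `ℂ` whose comultiplication is a `*`-homomorphism. -/
class FinDimCStarHopfAlgebra (K : Type*) extends CStarAlgebra K, HopfAlgebra ℂ K where
  finiteDimensional : FiniteDimensional ℂ K
  comul_star : ∀ x : K, comul (Star.star x) = Star.star (comul x)

attribute [instance] FinDimCStarHopfAlgebra.finiteDimensional

namespace CStarHopf

open Coalgebra HopfAlgebra WithConv

variable {K : Type*} [FinDimCStarHopfAlgebra K]

lemma star_comul_eq (x : K) :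
    comul (R := ℂ) (star x) = star (comul (R := ℂ) x) := FinDimCStarHopfAlgebra.comul_star x

/-- The Sweedler representation of `star x` obtained from one of `x`. -/
def reprStar {ι : Type*} {x : K} (r : Coalgebra.Repr ℂ x ι) : Coalgebra.Repr ℂ (star x) ι where
  left i := star (r.left i)
  right i := star (r.right i)
  index := r.index
  eq := by rw [star_comul_eq, ← r.eq, star_sum]; simp

lemma sum_counit_right_smul {ι : Type*} {x : K} (s : Coalgebra.Repr ℂ x ι) :
    ∑ i ∈ s.index, counit (R := ℂ) (s.right i) • s.left i = x := by
  have h := congr(TensorProduct.rid ℂ K $(sum_tmul_counit_eq s))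
  simp only [map_sum, TensorProduct.rid_tmul, one_smul] at h
  exact h

lemma counit_star (x : K) :
    counit (R := ℂ) (star x) = star (counit (R := ℂ) x) := by
  let r := Coalgebra.Repr.arbitrary ℂ x
  have h1 := sum_counit_smul (reprStar r)
  have h2 := sum_counit_right_smul r
  have h3 := congr(star (counit (R := ℂ) (star $h1)))
  have h4 := congr(counit (R := ℂ) (star $h2))
  simp only [map_sum, star_sum, map_smul, smul_eq_mul, star_mul', reprStar, star_smul,
    star_star] at h3 h4
  rw [← h3, ← h4]
  exact Finset.sum_congr rfl fun i _ => mul_comm _ _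

lemma antipode_comul_aux (x r : K) (s : Coalgebra.Repr ℂ x (K × K)) :
    ∑ i ∈ s.index, comul (R := ℂ) (s.left i) * (antipode ℂ r ⊗ₜ[ℂ] antipode ℂ (s.right i)) =
      (x * antipode ℂ r) ⊗ₜ[ℂ] 1 := by
  let L : K ⊗[ℂ] (K ⊗[ℂ] K) →ₗ[ℂ] K ⊗[ℂ] K :=
    TensorProduct.map (LinearMap.mulRight ℂ (antipode ℂ r))
      (LinearMap.mul' ℂ K ∘ₗ (antipode ℂ).lTensor K)
  have h := congr(L $(sum_tmul_tmul_eq s (fun i => Coalgebra.Repr.arbitrary ℂ (s.left i))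
    (fun i => Coalgebra.Repr.arbitrary ℂ (s.right i))))
  simp only [map_sum, L, TensorProduct.map_tmul, LinearMap.mulRight_apply, LinearMap.comp_apply,
    LinearMap.lTensor_tmul, LinearMap.mul'_apply, ← TensorProduct.tmul_sum,
    sum_mul_antipode_eq_smul] at h
  have e : ∀ i, comul (R := ℂ) (s.left i) * (antipode ℂ r ⊗ₜ[ℂ] antipode ℂ (s.right i)) =
      ∑ j ∈ (Coalgebra.Repr.arbitrary ℂ (s.left i)).index,
        ((Coalgebra.Repr.arbitrary ℂ (s.left i)).left j * antipode ℂ r) ⊗ₜ[ℂ]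
        ((Coalgebra.Repr.arbitrary ℂ (s.left i)).right j * antipode ℂ (s.right i)) := by
    intro i
    conv_lhs => rw [← (Coalgebra.Repr.arbitrary ℂ (s.left i)).eq, Finset.sum_mul]
    simp
  rw [Finset.sum_congr rfl (fun i _ => e i), h]
  have h5 := sum_counit_right_smul s
  conv_rhs => rw [← h5, Finset.sum_mul, TensorProduct.sum_tmul]
  simp [TensorProduct.tmul_smul, TensorProduct.smul_tmul']

lemma comul_antipode (x : K) : comul (R := ℂ) (antipode ℂ x) =
    TensorProduct.comm ℂ K K (TensorProduct.map (antipode ℂ) (antipode ℂ) (comul (R := ℂ) x)) := by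
  let G : K →ₗ[ℂ] K ⊗[ℂ] K := (TensorProduct.comm ℂ K K).toLinearMap ∘ₗ
    TensorProduct.map (antipode ℂ) (antipode ℂ) ∘ₗ comul (R := ℂ)
  have h1 : toConv (comul (R := ℂ) (A := K) ∘ₗ antipode ℂ) * toConv (comul (R := ℂ) (A := K)) = 1 := by
    ext c
    rw [(Coalgebra.Repr.arbitrary ℂ c).convMul_apply]
    simp only [LinearMap.comp_apply, ← Bialgebra.comul_mul, ← map_sum,
      sum_antipode_mul_eq_smul, LinearMap.convOne_apply]
    simp [Algebra.algebraMap_eq_smul_one]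
  have h2 : toConv (comul (R := ℂ) (A := K)) * toConv G = 1 := by
    ext c
    let s := Coalgebra.Repr.arbitrary ℂ c
    rw [s.convMul_apply]
    let M : K ⊗[ℂ] (K ⊗[ℂ] K) →ₗ[ℂ] K ⊗[ℂ] K := LinearMap.mul' ℂ (K ⊗[ℂ] K) ∘ₗ
      TensorProduct.map (comul (R := ℂ)) ((TensorProduct.comm ℂ K K).toLinearMap ∘ₗ
        TensorProduct.map (antipode ℂ) (antipode ℂ))
    have h := congr(M $(sum_tmul_tmul_eq s (fun i => Coalgebra.Repr.arbitrary ℂ (s.left i))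
      (fun i => Coalgebra.Repr.arbitrary ℂ (s.right i))))
    simp only [map_sum, M, TensorProduct.map_tmul, LinearMap.comp_apply,
      LinearMap.mul'_apply, LinearEquiv.coe_coe, TensorProduct.comm_tmul,
      antipode_comul_aux] at h
    have e : ∀ i, comul (R := ℂ) (s.left i) * G (s.right i) =
      ∑ j ∈ (Coalgebra.Repr.arbitrary ℂ (s.right i)).index, comul (R := ℂ) (s.left i) *
        (antipode ℂ ((Coalgebra.Repr.arbitrary ℂ (s.right i)).right j) ⊗ₜ[ℂ]
         antipode ℂ ((Coalgebra.Repr.arbitrary ℂ (s.right i)).left j)) := by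
      intro i
      simp only [G, LinearMap.comp_apply]
      conv_lhs => rw [← (Coalgebra.Repr.arbitrary ℂ (s.right i)).eq]
      simp [Finset.mul_sum]
    simp only
    rw [Finset.sum_congr rfl (fun i _ => e i), ← h, ← TensorProduct.sum_tmul,
      sum_mul_antipode_eq_smul, LinearMap.convOne_apply]
    simp [Algebra.algebraMap_eq_smul_one, TensorProduct.smul_tmul', Algebra.TensorProduct.one_def]
  have := left_inv_eq_right_inv h1 h2
  exact congr($this x)

lemma antipode_star_antipode (x : K) : antipode ℂ (star (antipode ℂ x)) = star x := by
  let T : K →ₗ[ℂ] K :=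
    { toFun x := star (antipode ℂ (star x))
      map_add' := by simp
      map_smul' := by simp }
  have hT : ∀ x, T x = star (antipode ℂ (star x)) := fun _ => rfl
  have h1 : toConv (antipode ℂ ∘ₗ T) * toConv (antipode ℂ (A := K)) = 1 := by
    ext c
    let s := Coalgebra.Repr.arbitrary ℂ c
    rw [s.convMul_apply]
    simp only [LinearMap.comp_apply, ← antipode_mul_antidistrib]
    have := congr(star $(sum_antipode_mul_eq_smul (reprStar s)))
    simp only [reprStar, star_sum, star_mul, star_star, star_smul, star_one, counit_star] at this
    simp only [hT, ← map_sum, this, LinearMap.convOne_apply]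
    simp [Algebra.algebraMap_eq_smul_one]
  have h2 := left_inv_eq_right_inv h1 LinearMap.antipode_mul_id
  have h3 : antipode ℂ (T (star x)) = star x := congr($h2 (star x))
  rwa [hT, star_star] at h3

end CStarHopf

/-- The dual `*`-Hopf algebra of `K`: linear functionals with the convolution product
`(f * g)(x) = f(x₍₁₎) g(x₍₂₎)` and unit the counit of `K`. -/
def DualHopf (K : Type*) [FinDimCStarHopfAlgebra K] : Type _ := WithConv (K →ₗ[ℂ] ℂ)

namespace DualHopf

open Coalgebra HopfAlgebra WithConv CStarHopf

variable {K : Type*} [FinDimCStarHopfAlgebra K]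

instance : Ring (DualHopf K) := inferInstanceAs (Ring (WithConv (K →ₗ[ℂ] ℂ)))

instance : Algebra ℂ (DualHopf K) := inferInstanceAs (Algebra ℂ (WithConv (K →ₗ[ℂ] ℂ)))

/-- The underlying linear identification of the dual Hopf algebra with the dual space. -/
def toDual : DualHopf K ≃ₗ[ℂ] Module.Dual ℂ K := WithConv.linearEquiv ℂ (K →ₗ[ℂ] ℂ)

instance : FiniteDimensional ℂ (DualHopf K) := toDual.symm.finiteDimensional

instance : FunLike (DualHopf K) K ℂ where
  coe f := toDual f
  coe_injective _ _ h := toDual.injective (DFunLike.coe_injective h)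

instance : LinearMapClass (DualHopf K) ℂ K ℂ where
  map_add f := map_add (toDual f)
  map_smulₛₗ f := map_smul (toDual f)

@[ext] lemma ext {f g : DualHopf K} (h : ∀ x, f x = g x) : f = g := DFunLike.ext _ _ h

@[simp] lemma toDual_apply (f : DualHopf K) (x : K) : toDual f x = f x := rfl
@[simp] lemma toDual_symm_apply (f : Module.Dual ℂ K) (x : K) : toDual.symm f x = f x := rfl
@[simp] lemma add_apply (f g : DualHopf K) (x : K) : (f + g) x = f x + g x := rfl
@[simp] lemma smul_apply (c : ℂ) (f : DualHopf K) (x : K) : (c • f) x = c * f x := rfl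
@[simp] lemma one_apply (x : K) : (1 : DualHopf K) x = counit (R := ℂ) x := rfl

lemma mul_apply' (f g : DualHopf K) (x : K) :
    (f * g) x = LinearMap.mul' ℂ ℂ (TensorProduct.map (toDual f) (toDual g) (comul (R := ℂ) x)) :=
  rfl

lemma mul_apply (f g : DualHopf K) {ι : Type*} {x : K} (r : Coalgebra.Repr ℂ x ι) :
    (f * g) x = ∑ i ∈ r.index, f (r.left i) * g (r.right i) := by
  rw [mul_apply', ← r.eq]; simp

/-- The involution of the dual: `f⋆(x) = conj (f (S(x)⋆))`. -/
instance : Star (DualHopf K) where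
  star f := toDual.symm
    { toFun x := star (f (star (antipode ℂ x)))
      map_add' := by simp
      map_smul' := by simp }

@[simp] lemma star_apply (f : DualHopf K) (x : K) :
    (star f) x = star (f (star (antipode ℂ x))) := rfl

instance : StarRing (DualHopf K) where
  star_involutive f := by
    ext x
    simp [antipode_star_antipode]
  star_add f g := by ext x; simp
  star_mul f g := by
    ext x
    let r := Coalgebra.Repr.arbitrary ℂ x
    let s : Coalgebra.Repr ℂ (star (antipode ℂ x)) (K × K) :=
      { left i := star (antipode ℂ (r.right i))
        right i := star (antipode ℂ (r.left i))
        index := r.index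
        eq := by
          rw [star_comul_eq, comul_antipode, ← r.eq]
          simp [star_sum] }
    rw [mul_apply _ _ r, star_apply, mul_apply _ _ s, star_sum]
    refine Finset.sum_congr rfl fun i _ => ?_
    simp [s, mul_comm]

instance : StarModule ℂ (DualHopf K) where
  star_smul c f := by ext x; simp

/-- The comultiplication of the dual, the transpose of the multiplication of `K`. -/
def comul : DualHopf K →ₗ[ℂ] DualHopf K ⊗[ℂ] DualHopf K :=
  (TensorProduct.congr toDual.symm toDual.symm).toLinearMap ∘ₗ
    (TensorProduct.dualDistribEquiv ℂ K K).symm.toLinearMap ∘ₗ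
    (LinearMap.mul' ℂ K).dualMap ∘ₗ toDual.toLinearMap

/-- Evaluation of an element of `H ⊗ H` on a pair of elements of `K`. -/
def eval₂ (x y : K) : DualHopf K ⊗[ℂ] DualHopf K →ₗ[ℂ] ℂ :=
  LinearMap.mul' ℂ ℂ ∘ₗ TensorProduct.map (LinearMap.applyₗ x ∘ₗ toDual.toLinearMap)
    (LinearMap.applyₗ y ∘ₗ toDual.toLinearMap)

@[simp] lemma eval₂_tmul (x y : K) (f g : DualHopf K) : eval₂ x y (f ⊗ₜ g) = f x * g y := rfl

lemma eval₂_eq (x y : K) (z : DualHopf K ⊗[ℂ] DualHopf K) :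
    eval₂ x y z = TensorProduct.dualDistribEquiv ℂ K K
      (TensorProduct.congr toDual toDual z) (x ⊗ₜ y) := by
  induction z with
  | zero => simp
  | add a b ha hb => simp [ha, hb]
  | tmul f g => simp [TensorProduct.dualDistribEquiv, TensorProduct.dualDistribEquivOfBasis]

/-- `Δ(f)` is characterised by `f₍₁₎(x) f₍₂₎(y) = f(x y)`. -/
@[simp] lemma eval₂_comul (f : DualHopf K) (x y : K) : eval₂ x y (comul f) = f (x * y) := by
  have h : TensorProduct.congr toDual toDual (comul f) =
      (TensorProduct.dualDistribEquiv ℂ K K).symm ((LinearMap.mul' ℂ K).dualMap (toDual f)) :=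
    (TensorProduct.congr toDual toDual).apply_symm_apply _
  rw [eval₂_eq, h, LinearEquiv.apply_symm_apply]
  rfl

/-- The right regular action `(f ↼ x)(y) = f(x y)` of `K` on its dual. -/
def rightAct (f : DualHopf K) : K →ₗ[ℂ] DualHopf K :=
  toDual.symm.toLinearMap ∘ₗ (LinearMap.compRight ℂ (toDual f)) ∘ₗ LinearMap.mul ℂ K

@[simp] lemma rightAct_apply (f : DualHopf K) (x y : K) : rightAct f x y = f (x * y) := rfl

end DualHopf

/-- A coaction of `K` on a unital `*`-algebra `A`: a unital `*`-homomorphism `ρ : A → A ⊗ K` with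
`(id ⊗ ε) ∘ ρ = id` and `(ρ ⊗ id) ∘ ρ = (id ⊗ Δ) ∘ ρ`. -/
structure Coaction (K : Type*) [FinDimCStarHopfAlgebra K]
    (A : Type*) [Ring A] [StarRing A] [Algebra ℂ A] [StarModule ℂ A]
    extends A →⋆ₐ[ℂ] A ⊗[ℂ] K where
  counit_comp (a : A) :
    TensorProduct.rid ℂ A ((Coalgebra.counit (R := ℂ) (A := K)).lTensor A (toFun a)) = a
  coassoc (a : A) :
    TensorProduct.assoc ℂ A K K (toStarAlgHom.toAlgHom.toLinearMap.rTensor K (toFun a)) =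
      (Coalgebra.comul (R := ℂ) (A := K)).lTensor A (toFun a)

namespace Coaction

open DualHopf CStarHopf HopfAlgebra

variable {K : Type*} [FinDimCStarHopfAlgebra K]
variable {A : Type*} [Ring A] [StarRing A] [Algebra ℂ A] [StarModule ℂ A]

instance : CoeFun (Coaction K A) (fun _ => A → A ⊗[ℂ] K) where
  coe ρ := ρ.toStarAlgHom

/-- A coaction as a linear map. -/
def lin (ρ : Coaction K A) : A →ₗ[ℂ] A ⊗[ℂ] K := ρ.toStarAlgHom.toAlgHom.toLinearMap

@[simp] lemma lin_apply (ρ : Coaction K A) (a : A) : ρ.lin a = ρ a := rfl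

/-- The slice map `id ⊗ f : A ⊗ K → A` of a functional `f` on `K`. -/
def slice (A : Type*) [AddCommGroup A] [Module ℂ A] (f : Module.Dual ℂ K) : A ⊗[ℂ] K →ₗ[ℂ] A :=
  (TensorProduct.rid ℂ A).toLinearMap ∘ₗ f.lTensor A

@[simp] lemma slice_tmul {A : Type*} [AddCommGroup A] [Module ℂ A] (f : Module.Dual ℂ K)
    (a : A) (x : K) : slice A f (a ⊗ₜ x) = f x • a := by
  simp [slice]

/-- The action `h · a = (id ⊗ h)(ρ(a))` of the dual Hopf algebra induced by the coaction,
as a linear map in `h`. -/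
def act (ρ : Coaction K A) (a : A) : DualHopf K →ₗ[ℂ] A where
  toFun h := slice A (toDual h) (ρ a)
  map_add' h k := by
    induction ρ a with
    | zero => simp
    | add x y hx hy => rw [LinearMap.map_add, LinearMap.map_add, LinearMap.map_add, hx, hy]; abel
    | tmul x y => simp [add_smul]
  map_smul' c h := by
    induction ρ a with
    | zero => simp
    | add x y hx hy => simp only [map_add, hx, hy, smul_add]
    | tmul x y => simp [mul_smul]

lemma act_apply (ρ : Coaction K A) (a : A) (h : DualHopf K) :
    ρ.act a h = slice A (toDual h) (ρ a) := rfl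

/-- The linear map `h ↦ (h₍₁₎ · a) ⊗ h₍₂₎`. -/
def twist (ρ : Coaction K A) (a : A) : DualHopf K →ₗ[ℂ] A ⊗[ℂ] DualHopf K :=
  (ρ.act a).rTensor (DualHopf K) ∘ₗ DualHopf.comul

/-- The map `b ⊗ x ↦ b ⊗ (h ↼ x)`. -/
def rmap (A : Type*) [AddCommGroup A] [Module ℂ A] (h : DualHopf K) :
    A ⊗[ℂ] K →ₗ[ℂ] A ⊗[ℂ] DualHopf K := (rightAct h).lTensor A

@[simp] lemma rmap_tmul {A : Type*} [AddCommGroup A] [Module ℂ A] (h : DualHopf K) (a : A) (x : K) :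
    rmap A h (a ⊗ₜ x) = a ⊗ₜ rightAct h x := rfl

/-- Elements of `A ⊗ H` are determined by their evaluations at elements of `K`. -/
lemma ext_eval {A : Type*} [AddCommGroup A] [Module ℂ A] {z w : A ⊗[ℂ] DualHopf K}
    (h : ∀ y : K, (TensorProduct.rid ℂ A) ((LinearMap.applyₗ y ∘ₗ toDual.toLinearMap).lTensor A z) =
      (TensorProduct.rid ℂ A) ((LinearMap.applyₗ y ∘ₗ toDual.toLinearMap).lTensor A w)) : z = w := by
  let b := Module.finBasis ℂ K
  let d : Module.Basis _ ℂ (DualHopf K) := b.dualBasis.map toDual.symm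
  have key : ∀ z : A ⊗[ℂ] DualHopf K, ∑ i, (TensorProduct.rid ℂ A)
      ((LinearMap.applyₗ (b i) ∘ₗ toDual.toLinearMap).lTensor A z) ⊗ₜ[ℂ] d i = z := by
    intro z
    induction z with
    | zero => simp
    | add x y hx hy => simp only [map_add, TensorProduct.add_tmul, Finset.sum_add_distrib, hx, hy]
    | tmul a f =>
      simp only [LinearMap.lTensor_tmul, TensorProduct.rid_tmul, TensorProduct.smul_tmul,
        ← TensorProduct.tmul_sum]
      congr 1
      apply toDual.injective
      apply b.ext
      intro j
      simp [d, Finsupp.single_apply]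
  rw [← key z, ← key w]
  simp only [h]

lemma twist_eq (ρ : Coaction K A) (a : A) (h : DualHopf K) : ρ.twist a h = rmap A h (ρ a) := by
  apply ext_eval
  intro y
  have h1 : ∀ z : DualHopf K ⊗[ℂ] DualHopf K, (TensorProduct.rid ℂ A)
      ((LinearMap.applyₗ y ∘ₗ toDual.toLinearMap).lTensor A ((ρ.act a).rTensor (DualHopf K) z)) =
      ρ.act a (TensorProduct.rid ℂ (DualHopf K)
        ((LinearMap.applyₗ y ∘ₗ toDual.toLinearMap).lTensor (DualHopf K) z)) := by
    intro z
    induction z with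
    | zero => simp
    | add x y hx hy => simp only [map_add, hx, hy]
    | tmul a f => simp
  have h2 : ∀ x, (TensorProduct.rid ℂ (DualHopf K)
        ((LinearMap.applyₗ y ∘ₗ toDual.toLinearMap).lTensor (DualHopf K) (DualHopf.comul h))) x =
        h (x * y) := by
    intro x
    rw [← eval₂_comul]
    induction DualHopf.comul h with
    | zero => simp; rfl
    | add x y hx hy => simp only [map_add, DualHopf.add_apply, hx, hy]
    | tmul a f => simp [mul_comm]
  rw [twist, LinearMap.comp_apply, h1, act_apply]
  induction ρ a with
  | zero => simp
  | add x y hx hy => simp only [map_add, hx, hy]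
  | tmul b x => simp [h2]

end Coaction

/-- The crossed product `A ⋊_ρ H` of `A` by the dual Hopf algebra `H` of `K` for a coaction `ρ` of
`K` on `A`. As a vector space it is `A ⊗ H`; the elementary tensor `a ⊗ h` is written `a ⋊ h`. -/
def Crossed {K : Type*} [FinDimCStarHopfAlgebra K] {A : Type*} [Ring A] [StarRing A] [Algebra ℂ A]
    [StarModule ℂ A] (_ρ : Coaction K A) : Type _ := A ⊗[ℂ] DualHopf K

namespace Crossed

open DualHopf CStarHopf HopfAlgebra Coaction

variable {K : Type*} [FinDimCStarHopfAlgebra K]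
variable {A : Type*} [Ring A] [StarRing A] [Algebra ℂ A] [StarModule ℂ A]

instance (ρ : Coaction K A) : AddCommGroup (Crossed ρ) :=
  inferInstanceAs (AddCommGroup (A ⊗[ℂ] DualHopf K))

instance (ρ : Coaction K A) : Module ℂ (Crossed ρ) :=
  inferInstanceAs (Module ℂ (A ⊗[ℂ] DualHopf K))

/-- The linear identification of the crossed product with `A ⊗ H`. -/
def toTensor (ρ : Coaction K A) : Crossed ρ ≃ₗ[ℂ] A ⊗[ℂ] DualHopf K :=
  LinearEquiv.refl ℂ (A ⊗[ℂ] DualHopf K)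

/-- The element `a ⋊ h`. -/
def mk (ρ : Coaction K A) (a : A) (h : DualHopf K) : Crossed ρ := (toTensor ρ).symm (a ⊗ₜ h)

/-- The map `b ↦ (a ⋊ h)(b ⋊ l)` as a bilinear map in `(a, h)`, `(b, l)`. -/
def mulAux (ρ : Coaction K A) : A ⊗[ℂ] DualHopf K →ₗ[ℂ] A ⊗[ℂ] DualHopf K →ₗ[ℂ] A ⊗[ℂ] DualHopf K :=
  TensorProduct.lift <| LinearMap.mk₂ ℂ
    (fun a h => TensorProduct.lift <| LinearMap.mk₂ ℂ
      (fun b l => (a ⊗ₜ[ℂ] 1) * ρ.twist b h * (1 ⊗ₜ[ℂ] l))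
      (fun b b' l => by simp [twist_eq, mul_add, add_mul])
      (fun c b l => by simp [twist_eq])
      (fun b l l' => by simp [TensorProduct.tmul_add, mul_add])
      (fun c b l => by simp))
    (fun a a' h => by ext; simp [TensorProduct.add_tmul, add_mul])
    (fun c a h => by ext; simp [← TensorProduct.smul_tmul'])
    (fun a h h' => by ext; simp [mul_add, add_mul])
    (fun c a h => by ext; simp)

/-- The product `(a ⋊ h)(b ⋊ l) = a (h₍₁₎ · b) ⋊ h₍₂₎ l`. -/
instance (ρ : Coaction K A) : Mul (Crossed ρ) where
  mul x y := (toTensor ρ).symm (mulAux ρ (toTensor ρ x) (toTensor ρ y))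

instance (ρ : Coaction K A) : One (Crossed ρ) where
  one := mk ρ 1 1

/-- The involution `(a ⋊ h)⋆ = (h₍₁₎⋆ · a⋆) ⋊ h₍₂₎⋆`. -/
instance (ρ : Coaction K A) : Star (Crossed ρ) where
  star x := (toTensor ρ).symm (TensorProduct.lift
    (LinearMap.mk₂ ℂ (fun a h => ρ.twist a h)
      (fun a a' h => by simp [twist_eq])
      (fun c a h => by simp [twist_eq])
      (fun a h h' => by simp)
      (fun c a h => by simp)) (star (toTensor ρ x)))

variable (ρ : Coaction K A)

lemma mk_mul_mk (a b : A) (h l : DualHopf K) : mk ρ a h * mk ρ b l =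
    (toTensor ρ).symm ((a ⊗ₜ[ℂ] 1) * ρ.twist b h * (1 ⊗ₜ[ℂ] l)) := rfl

lemma one_def : (1 : Crossed ρ) = mk ρ 1 1 := rfl

lemma star_mk (a : A) (h : DualHopf K) : star (mk ρ a h) =
    (toTensor ρ).symm (ρ.twist (star a) (star h)) := rfl

@[elab_as_elim]
lemma induction {P : Crossed ρ → Prop} (x : Crossed ρ) (h0 : P 0)
    (hm : ∀ a h, P (mk ρ a h)) (ha : ∀ x y, P x → P y → P (x + y)) : P x :=
  TensorProduct.induction_on (motive := P) x h0 hm ha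

lemma add_mul' (x y z : Crossed ρ) : (x + y) * z = x * z + y * z := by
  change (toTensor ρ).symm (mulAux ρ (toTensor ρ (x + y)) (toTensor ρ z)) =
    (toTensor ρ).symm (mulAux ρ (toTensor ρ x) (toTensor ρ z)) +
    (toTensor ρ).symm (mulAux ρ (toTensor ρ y) (toTensor ρ z))
  simp

lemma mul_add' (x y z : Crossed ρ) : x * (y + z) = x * y + x * z := by
  change (toTensor ρ).symm (mulAux ρ (toTensor ρ x) (toTensor ρ (y + z))) =
    (toTensor ρ).symm (mulAux ρ (toTensor ρ x) (toTensor ρ y)) +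
    (toTensor ρ).symm (mulAux ρ (toTensor ρ x) (toTensor ρ z))
  simp

lemma zero_mul' (x : Crossed ρ) : 0 * x = 0 := by
  change (toTensor ρ).symm (mulAux ρ (toTensor ρ 0) (toTensor ρ x)) = 0
  simp

lemma mul_zero' (x : Crossed ρ) : x * 0 = 0 := by
  change (toTensor ρ).symm (mulAux ρ (toTensor ρ x) (toTensor ρ 0)) = 0
  simp

lemma smul_mul' (c : ℂ) (x y : Crossed ρ) : (c • x) * y = c • (x * y) := by
  change (toTensor ρ).symm (mulAux ρ (toTensor ρ (c • x)) (toTensor ρ y)) =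
    c • (toTensor ρ).symm (mulAux ρ (toTensor ρ x) (toTensor ρ y))
  simp

lemma mul_smul' (c : ℂ) (x y : Crossed ρ) : x * (c • y) = c • (x * y) := by
  change (toTensor ρ).symm (mulAux ρ (toTensor ρ x) (toTensor ρ (c • y))) =
    c • (toTensor ρ).symm (mulAux ρ (toTensor ρ x) (toTensor ρ y))
  simp

lemma star_add' (x y : Crossed ρ) : star (x + y) = star x + star y := by
  change (toTensor ρ).symm (TensorProduct.lift _ (star (toTensor ρ (x + y)))) = _
  rw [map_add, star_add, map_add, map_add]
  rfl

lemma star_smul' (c : ℂ) (x : Crossed ρ) : star (c • x) = star c • star x := by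
  change (toTensor ρ).symm (TensorProduct.lift _ (star (toTensor ρ (c • x)))) = _
  rw [map_smul, star_smul, map_smul, map_smul]
  rfl

@[simp] lemma rightAct_one (h : DualHopf K) : rightAct h 1 = h := by
  ext y; simp

lemma one_rightAct (x : K) : rightAct (1 : DualHopf K) x = Coalgebra.counit (R := ℂ) x • 1 := by
  ext y; simp [Bialgebra.counit_mul]

lemma rightAct_rightAct (h : DualHopf K) (x y : K) :
    rightAct (rightAct h x) y = rightAct h (x * y) := by
  ext z; simp [mul_assoc]

lemma mul_rightAct (h l : DualHopf K) {ι : Type*} {x : K} (r : Coalgebra.Repr ℂ x ι) :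
    rightAct (h * l) x = ∑ i ∈ r.index, rightAct h (r.left i) * rightAct l (r.right i) := by
  ext y
  let s := Coalgebra.Repr.arbitrary ℂ y
  have hs : ∀ u : ι → DualHopf K, (∑ i ∈ r.index, u i) y = ∑ i ∈ r.index, u i y := fun u => by
    simp only [← toDual_apply, map_sum, LinearMap.sum_apply]
  rw [rightAct_apply, mul_apply h l (r.mul s), hs]
  simp only [mul_apply _ _ s, rightAct_apply]
  exact Finset.sum_product _ _ _

lemma star_rightAct (h : DualHopf K) (x : K) :
    star (rightAct h x) = rightAct (star h) (star (antipode ℂ x)) := by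
  ext y
  simp only [star_apply, rightAct_apply, antipode_mul_antidistrib, star_mul]
  rw [antipode_star_antipode, star_star]

/-- The map `a ⊗ (x ⊗ y) ↦ a ⊗ (h ↼ x)(l ↼ y)`. -/
def rmap₂ (A : Type*) [AddCommGroup A] [Module ℂ A] (h l : DualHopf K) :
    A ⊗[ℂ] (K ⊗[ℂ] K) →ₗ[ℂ] A ⊗[ℂ] DualHopf K :=
  (LinearMap.mul' ℂ (DualHopf K) ∘ₗ TensorProduct.map (rightAct h) (rightAct l)).lTensor A

lemma mulAux_tmul (a b : A) (h l : DualHopf K) : mulAux ρ (a ⊗ₜ h) (b ⊗ₜ l) =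
    (a ⊗ₜ[ℂ] 1) * rmap A h (ρ b) * (1 ⊗ₜ[ℂ] l) := by
  rw [← twist_eq]; rfl

lemma mulAux_left (a : A) (Z W : A ⊗[ℂ] DualHopf K) :
    mulAux ρ ((a ⊗ₜ[ℂ] 1) * Z) W = (a ⊗ₜ[ℂ] 1) * mulAux ρ Z W := by
  induction Z with
  | zero => simp
  | add x y hx hy => simp only [mul_add, map_add, LinearMap.add_apply, hx, hy]
  | tmul b h =>
    induction W with
    | zero => simp
    | add x y hx hy => simp only [mul_add, map_add, hx, hy]
    | tmul c l =>
      simp only [Algebra.TensorProduct.tmul_mul_tmul, mulAux_tmul, one_mul, ← mul_assoc]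

lemma mulAux_right (m : DualHopf K) (Z W : A ⊗[ℂ] DualHopf K) :
    mulAux ρ Z (W * (1 ⊗ₜ[ℂ] m)) = mulAux ρ Z W * (1 ⊗ₜ[ℂ] m) := by
  induction W with
  | zero => simp
  | add x y hx hy => simp only [add_mul, map_add, hx, hy]
  | tmul b h =>
    induction Z with
    | zero => simp
    | add x y hx hy => simp only [map_add, LinearMap.add_apply, add_mul, hx, hy]
    | tmul c l =>
      simp only [Algebra.TensorProduct.tmul_mul_tmul, mulAux_tmul, mul_one, mul_assoc]

lemma rmap₂_aux (b : A) (x : K) (h l : DualHopf K) (X : A ⊗[ℂ] K) :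
    (b ⊗ₜ[ℂ] 1) * rmap A (rightAct h x * l) X = rmap₂ A h l
      ((b ⊗ₜ[ℂ] (x ⊗ₜ[ℂ] 1)) * (Coalgebra.comul (R := ℂ) (A := K)).lTensor A X) := by
  induction X with
  | zero => simp
  | add x y hx hy => simp only [mul_add, map_add, hx, hy]
  | tmul c y =>
    let s := Coalgebra.Repr.arbitrary ℂ y
    rw [rmap_tmul, mul_rightAct _ _ s, LinearMap.lTensor_tmul, ← s.eq]
    simp [rmap₂, TensorProduct.tmul_sum, Finset.mul_sum, rightAct_rightAct]

lemma mulAux_key (b c : A) (h l : DualHopf K) :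
    mulAux ρ (rmap A h (ρ b) * (1 ⊗ₜ[ℂ] l)) (c ⊗ₜ[ℂ] 1) =
      mulAux ρ (1 ⊗ₜ[ℂ] h) ((b ⊗ₜ[ℂ] 1) * rmap A l (ρ c)) := by
  have h1 : ∀ Y : A ⊗[ℂ] K, mulAux ρ (rmap A h Y * (1 ⊗ₜ[ℂ] l)) (c ⊗ₜ[ℂ] 1) =
      rmap₂ A h l (TensorProduct.assoc ℂ A K K (Y ⊗ₜ[ℂ] 1) *
        (Coalgebra.comul (R := ℂ) (A := K)).lTensor A (ρ c)) := by
    intro Y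
    induction Y with
    | zero => simp
    | add x y hx hy =>
      simp only [add_mul, map_add, hx, hy, LinearMap.add_apply, TensorProduct.add_tmul]
    | tmul b0 b1 =>
      rw [TensorProduct.assoc_tmul, ← rmap₂_aux, rmap_tmul, Algebra.TensorProduct.tmul_mul_tmul,
        mulAux_tmul, mul_one, ← Algebra.TensorProduct.one_def, mul_one]
  have h2 : ∀ Y : A ⊗[ℂ] K, mulAux ρ (1 ⊗ₜ[ℂ] h) ((b ⊗ₜ[ℂ] 1) * rmap A l Y) =
      rmap₂ A h l (TensorProduct.assoc ℂ A K K (((ρ b) ⊗ₜ[ℂ] 1) * ρ.lin.rTensor K Y)) := by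
    intro Y
    induction Y with
    | zero => simp
    | add x y hx hy => simp only [mul_add, map_add, hx, hy]
    | tmul c0 c1 =>
      rw [rmap_tmul, Algebra.TensorProduct.tmul_mul_tmul, mulAux_tmul, map_mul, one_mul,
        ← Algebra.TensorProduct.one_def, one_mul, LinearMap.rTensor_tmul,
        Algebra.TensorProduct.tmul_mul_tmul, one_mul, lin_apply]
      induction (ρ b * ρ c0) with
      | zero => simp
      | add x y hx hy => simp only [map_add, add_mul, TensorProduct.add_tmul, hx, hy]
      | tmul d z => simp [rmap₂]
  rw [h1, h2]
  have h3 := map_mul (Algebra.TensorProduct.assoc ℂ ℂ ℂ A K K) ((ρ b) ⊗ₜ[ℂ] 1)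
    (ρ.lin.rTensor K (ρ c))
  have h4 := ρ.coassoc c
  change _ = (Coalgebra.comul (R := ℂ) (A := K)).lTensor A (ρ c) at h4
  rw [← h4]
  exact congr(rmap₂ A h l $h3.symm)

lemma mul_assoc' (x y z : Crossed ρ) : x * y * z = x * (y * z) := by
  induction x using Crossed.induction with
  | h0 => simp only [zero_mul']
  | ha x x' hx hx' => simp only [add_mul', hx, hx']
  | hm a h =>
  induction y using Crossed.induction with
  | h0 => simp only [zero_mul', mul_zero']
  | ha x x' hx hx' => simp only [add_mul', mul_add', hx, hx']
  | hm b l =>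
  induction z using Crossed.induction with
  | h0 => simp only [mul_zero']
  | ha x x' hx hx' => simp only [mul_add', hx, hx']
  | hm c m =>
    have hc : c ⊗ₜ[ℂ] m = (c ⊗ₜ[ℂ] (1 : DualHopf K)) * (1 ⊗ₜ[ℂ] m) := by simp
    have ha : a ⊗ₜ[ℂ] h = (a ⊗ₜ[ℂ] (1 : DualHopf K)) * (1 ⊗ₜ[ℂ] h) := by simp
    change mulAux ρ ((a ⊗ₜ[ℂ] 1) * ρ.twist b h * (1 ⊗ₜ[ℂ] l)) (c ⊗ₜ[ℂ] m) =
      mulAux ρ (a ⊗ₜ[ℂ] h) ((b ⊗ₜ[ℂ] 1) * ρ.twist c l * (1 ⊗ₜ[ℂ] m))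
    rw [twist_eq, twist_eq, hc, ha, mulAux_right, mulAux_right, mulAux_left, mul_assoc (a ⊗ₜ[ℂ] 1),
      mulAux_left, mulAux_key]

lemma mk_mul_mk' (a b : A) (h l : DualHopf K) : mk ρ a h * mk ρ b l =
    (toTensor ρ).symm ((a ⊗ₜ[ℂ] 1) * rmap A h (ρ b) * (1 ⊗ₜ[ℂ] l)) := by
  rw [mk_mul_mk, twist_eq]

lemma rmap_one (X : A ⊗[ℂ] K) : rmap A 1 X =
    (TensorProduct.rid ℂ A ((Coalgebra.counit (R := ℂ) (A := K)).lTensor A X)) ⊗ₜ 1 := by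
  induction X with
  | zero => simp
  | add x y hx hy => simp only [map_add, hx, hy, TensorProduct.add_tmul]
  | tmul a x => simp [one_rightAct, TensorProduct.smul_tmul]

lemma mk_one_mul (a b : A) (l : DualHopf K) : mk ρ a 1 * mk ρ b l = mk ρ (a * b) l := by
  rw [mk_mul_mk', rmap_one]
  have := ρ.counit_comp b
  change TensorProduct.rid ℂ A ((Coalgebra.counit (R := ℂ) (A := K)).lTensor A (ρ b)) = b at this
  rw [this]
  simp [mk]

lemma mul_mk_one (a : A) (h l : DualHopf K) : mk ρ a h * mk ρ 1 l = mk ρ a (h * l) := by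
  rw [mk_mul_mk', map_one, Algebra.TensorProduct.one_def, rmap_tmul]
  simp [mk]

instance : Ring (Crossed ρ) :=
  { (inferInstance : AddCommGroup (Crossed ρ)), (inferInstance : Mul (Crossed ρ)),
    (inferInstance : One (Crossed ρ)) with
    left_distrib := mul_add' ρ
    right_distrib := add_mul' ρ
    zero_mul := zero_mul' ρ
    mul_zero := mul_zero' ρ
    mul_assoc := mul_assoc' ρ
    one_mul x := by
      induction x using Crossed.induction with
      | h0 => exact mul_zero' ρ _
      | ha x x' hx hx' => rw [mul_add', hx, hx']
      | hm a h => rw [one_def, mk_one_mul, one_mul]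
    mul_one x := by
      induction x using Crossed.induction with
      | h0 => exact zero_mul' ρ _
      | ha x x' hx hx' => rw [add_mul', hx, hx']
      | hm a h => rw [one_def, mul_mk_one, mul_one] }

instance : Algebra ℂ (Crossed ρ) := Algebra.ofModule (smul_mul' ρ) (mul_smul' ρ)

lemma star_mk' (a : A) (h : DualHopf K) :
    star (mk ρ a h) = mk ρ 1 (star h) * mk ρ (star a) 1 := by
  rw [star_mk, mk_mul_mk, ← Algebra.TensorProduct.one_def, one_mul, mul_one]

/-- The map `(a ⊗ x) ⊗ y ↦ a ⊗ x S(y)`. -/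
def mulAntipode (A : Type*) [AddCommGroup A] [Module ℂ A] :
    A ⊗[ℂ] (K ⊗[ℂ] K) →ₗ[ℂ] A ⊗[ℂ] K :=
  (LinearMap.mul' ℂ K ∘ₗ (antipode ℂ).lTensor K).lTensor A

lemma star_mk_mul_mk (b : A) (h : DualHopf K) :
    star (mk ρ 1 h * mk ρ b 1) = mk ρ (star b) (star h) := by
  rw [mk_mul_mk', ← Algebra.TensorProduct.one_def, one_mul, mul_one]
  have h1 : ∀ X : A ⊗[ℂ] K, star ((toTensor ρ).symm (rmap A h X)) = (toTensor ρ).symm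
      (rmap A (star h) (star (mulAntipode A (TensorProduct.assoc ℂ A K K
        (ρ.lin.rTensor K X))))) := by
    intro X
    induction X with
    | zero =>
      simp only [map_zero, star_zero]
      have := star_smul' ρ 0 0
      simpa using this
    | add x y hx hy => simp only [map_add, star_add', star_add, hx, hy]
    | tmul c x =>
      change star (mk ρ c (rightAct h x)) = _
      rw [star_mk, twist_eq, star_rightAct, map_star ρ.toStarAlgHom, LinearMap.rTensor_tmul, lin_apply]
      refine congrArg (toTensor ρ).symm ?_
      induction ρ c with
      | zero => simp
      | add x y hx hy => simp only [map_add, star_add, TensorProduct.add_tmul, hx, hy]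
      | tmul c0 c1 => simp [mulAntipode, rightAct_rightAct]
  have h2 : ∀ X : A ⊗[ℂ] K, mulAntipode A ((Coalgebra.comul (R := ℂ) (A := K)).lTensor A X) =
      (TensorProduct.rid ℂ A ((Coalgebra.counit (R := ℂ) (A := K)).lTensor A X)) ⊗ₜ 1 := by
    intro X
    induction X with
    | zero => simp
    | add x y hx hy => simp only [map_add, TensorProduct.add_tmul, hx, hy]
    | tmul c x =>
      simp [mulAntipode, Algebra.algebraMap_eq_smul_one, TensorProduct.smul_tmul]
  have h4 := ρ.coassoc b
  change TensorProduct.assoc ℂ A K K (ρ.lin.rTensor K (ρ b)) =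
    (Coalgebra.comul (R := ℂ) (A := K)).lTensor A (ρ b) at h4
  have h5 := ρ.counit_comp b
  change TensorProduct.rid ℂ A ((Coalgebra.counit (R := ℂ) (A := K)).lTensor A (ρ b)) = b at h5
  rw [h1, h4, h2, h5]
  simp [mk]

instance : StarRing (Crossed ρ) where
  star_involutive x := by
    induction x using Crossed.induction with
    | h0 =>
      have := star_smul' ρ 0 0
      simp only [smul_zero, star_zero, zero_smul] at this
      rw [this, this]
    | ha x x' hx hx' => rw [star_add', star_add', hx, hx']
    | hm a h => rw [star_mk', star_mk_mul_mk, star_star, star_star]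
  star_add := star_add' ρ
  star_mul x y := by
    have s0 : star (0 : Crossed ρ) = 0 := by
      have := star_smul' ρ 0 0
      simpa only [smul_zero, star_zero, zero_smul] using this
    induction x using Crossed.induction with
    | h0 => simp only [zero_mul, s0, mul_zero]
    | ha x x' hx hx' => simp only [add_mul, star_add', mul_add, hx, hx']
    | hm a h =>
    induction y using Crossed.induction with
    | h0 => simp only [mul_zero, s0, zero_mul]
    | ha x x' hx hx' => simp only [add_mul, star_add', mul_add, hx, hx']
    | hm b l =>
      have key : ∀ z : Crossed ρ, star (mk ρ a 1 * z * mk ρ 1 l) =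
          mk ρ 1 (star l) * (star z * mk ρ (star a) 1) := by
        intro z
        induction z using Crossed.induction with
        | h0 => simp only [mul_zero, s0, zero_mul]
        | ha x x' hx hx' => simp only [add_mul, star_add', mul_add, hx, hx']
        | hm b' h' =>
          rw [mk_one_mul, mul_mk_one, star_mk', star_mk', mul_assoc, mk_one_mul, ← mul_assoc,
            mul_mk_one, star_mul, star_mul]
      have e1 : mk ρ a h * mk ρ b l = mk ρ a 1 * (mk ρ 1 h * mk ρ b 1) * mk ρ 1 l := by
        rw [← mul_assoc, mk_one_mul, mul_one, mul_assoc, mul_mk_one, one_mul]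
      rw [e1, key, star_mk_mul_mk, star_mk', star_mk', mul_assoc, ← mul_assoc (mk ρ (star b) 1),
        mk_one_mul, mul_one]

instance : StarModule ℂ (Crossed ρ) where
  star_smul := star_smul' ρ

end Crossed

/-! ### Boundedness of the components of a coaction -/

namespace FDim

open Module
open scoped ComplexOrder MatrixOrder

lemma root_nonneg {K : Type*} [CStarAlgebra K] (x : K) {μ : ℂ}
    (hμ : μ ∈ spectrum ℂ (LinearMap.mul ℂ K (star x * x))) : 0 ≤ μ := by
  have h1 : μ ∈ spectrum ℂ (star x * x) :=
    AlgHom.spectrum_apply_subset (Algebra.lmul ℂ K) (star x * x) hμ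
  have hs : IsSelfAdjoint (star x * x) := IsSelfAdjoint.star_mul_self x
  have h2 := hs.mem_spectrum_eq_re h1
  have h3 : μ.re ∈ spectrum ℝ (star x * x) := by
    rw [← spectrum.preimage_algebraMap ℂ]
    simpa [← h2] using h1
  have h4 := spectrum_star_mul_self_nonneg _ h3
  rw [h2]
  exact_mod_cast h4

variable (K : Type*) [CStarAlgebra K] [FiniteDimensional ℂ K]

/-- The trace of the left multiplication. -/
def tr : K →ₗ[ℂ] ℂ := LinearMap.trace ℂ K ∘ₗ LinearMap.mul ℂ K

variable {K}

lemma tr_eq (x : K) : tr K (star x * x) =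
    (LinearMap.charpoly (LinearMap.mul ℂ K (star x * x))).roots.sum :=
  Module.End.trace_eq_sum_roots_charpoly_of_splits (IsAlgClosed.splits _)

lemma roots_nonneg (x : K) {μ : ℂ}
    (hμ : μ ∈ (LinearMap.charpoly (LinearMap.mul ℂ K (star x * x))).roots) : 0 ≤ μ := by
  apply root_nonneg x
  rw [Module.End.mem_spectrum_iff_isRoot_charpoly]
  exact Polynomial.isRoot_of_mem_roots hμ

lemma tr_nonneg (x : K) : 0 ≤ tr K (star x * x) := by
  rw [tr_eq]
  exact Multiset.sum_nonneg fun μ hμ => roots_nonneg x hμ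

lemma eq_zero_of_tr (x : K) (h : tr K (star x * x) = 0) : x = 0 := by
  rw [tr_eq] at h
  have h0 := (Multiset.all_zero_of_le_zero_le_of_sum_eq_zero
    (fun {μ} hμ => roots_nonneg x hμ) h)
  set L := LinearMap.mul ℂ K (star x * x) with hL
  have hs : spectrum ℂ (star x * x) ⊆ {0} := by
    intro μ hμ
    have : μ ∈ spectrum ℂ L := by
      rw [spectrum.mem_iff] at hμ ⊢
      intro hu
      apply hμ
      set T : Module.End ℂ K := algebraMap ℂ (Module.End ℂ K) μ - L with hT
      have hTa : ∀ y, T y = (algebraMap ℂ K μ - star x * x) * y := fun y => by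
        simp [hT, hL, sub_mul, Algebra.smul_def]
      obtain ⟨y, hy⟩ := ((Module.End.isUnit_iff _).1 hu).2 1
      rw [hTa] at hy
      have hinj := ((Module.End.isUnit_iff _).1 hu).1
      refine ⟨⟨_, y, hy, ?_⟩, rfl⟩
      apply hinj
      rw [hTa, hTa, ← mul_assoc, hy, one_mul, mul_one]
    rw [Module.End.mem_spectrum_iff_isRoot_charpoly] at this
    apply h0
    rw [Polynomial.mem_roots (LinearMap.charpoly_monic _).ne_zero]
    exact this
  have hr : spectralRadius ℂ (star x * x) = 0 := by
    rw [spectralRadius]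
    simp only [ENNReal.iSup_eq_zero]
    intro μ hμ
    have : μ = 0 := hs hμ
    simp [this]
  have h1 := (IsSelfAdjoint.star_mul_self x).spectralRadius_eq_nnnorm
  rw [hr] at h1
  have h2 : star x * x = 0 := by simpa using h1.symm
  exact CStarRing.star_mul_self_eq_zero_iff x |>.1 h2

open Matrix in
lemma exists_rep (K : Type*) [CStarAlgebra K] [FiniteDimensional ℂ K] :
    ∃ (n : ℕ) (π : K →ₗ[ℂ] Matrix (Fin n) (Fin n) ℂ),
      π 1 = 1 ∧ (∀ x y, π (x * y) = π x * π y) ∧ (∀ x, π (star x) = (π x)ᴴ) ∧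
      ∀ f : Module.Dual ℂ K, ∃ c : Fin n → Fin n → ℂ, ∀ x, f x = ∑ i, ∑ j, c i j * π x i j := by
  let b := Module.finBasis ℂ K
  let n := Module.finrank ℂ K
  let G : Matrix (Fin n) (Fin n) ℂ := fun i j => tr K (star (b i) * b j)
  have hG : ∀ v w : Fin n → ℂ, star v ⬝ᵥ G *ᵥ w =
      tr K (star (∑ i, v i • b i) * ∑ i, w i • b i) := by
    intro v w
    rw [star_sum, Finset.sum_mul_sum]
    simp only [star_smul, smul_mul_smul_comm, map_sum, map_smul,
      dotProduct, mulVec, Finset.mul_sum, Pi.star_apply, smul_eq_mul, G]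
    refine Finset.sum_congr rfl fun i _ => Finset.sum_congr rfl fun j _ => by ring
  have tr_star : ∀ x y : K, star (tr K (star x * y)) = tr K (star y * x) := by
    intro x y
    have h : ∀ z : K, (tr K (star z * z)).im = 0 := fun z =>
      (Complex.nonneg_iff.1 (tr_nonneg z)).2.symm
    have h0 := h x
    have h1 := h y
    have h2 := h (x + y)
    have h3 := h (x + Complex.I • y)
    simp only [star_add, star_smul, mul_add, add_mul, map_add, smul_mul_assoc, mul_smul_comm,
      map_smul, smul_eq_mul, Complex.add_im, Complex.mul_im, Complex.mul_re, Complex.I_re,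
      Complex.I_im, RCLike.star_def, Complex.conj_I,
      Complex.neg_re, Complex.neg_im] at h2 h3
    apply Complex.ext
    · simp only [RCLike.star_def, Complex.conj_re]
      linarith
    · simp only [RCLike.star_def, Complex.conj_im]
      linarith
  have hpd : G.PosDef := by
    refine Matrix.PosDef.of_dotProduct_mulVec_pos ?_ ?_
    · ext i j
      exact tr_star _ _
    · intro v hv
      rw [hG]
      refine lt_of_le_of_ne (tr_nonneg _) fun h => hv ?_
      have := eq_zero_of_tr _ h.symm
      have := Fintype.linearIndependent_iff.1 b.linearIndependent v this
      funext i; exact this i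
  obtain ⟨B, hB⟩ := CStarAlgebra.nonneg_iff_eq_star_mul_self.mp hpd.posSemidef.nonneg
  rw [star_eq_conjTranspose] at hB
  have hBu : IsUnit B := by
    have h1 := hpd.isUnit
    rw [hB] at h1
    rw [Matrix.isUnit_iff_isUnit_det] at h1 ⊢
    rw [det_mul] at h1
    exact isUnit_of_mul_isUnit_right h1
  rw [Matrix.isUnit_iff_isUnit_det] at hBu
  let L : K →ₐ[ℂ] Matrix (Fin n) (Fin n) ℂ := Algebra.leftMulMatrix b
  have e1 : B * B⁻¹ = 1 := Matrix.mul_nonsing_inv _ hBu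
  have e2 : B⁻¹ * B = 1 := Matrix.nonsing_inv_mul _ hBu
  have hrep : ∀ x (v : Fin n → ℂ), ∑ i, (L x *ᵥ v) i • b i = x * ∑ i, v i • b i := by
    intro x v
    have h1 := Algebra.leftMulMatrix_mulVec_repr b x (∑ i, v i • b i)
    have h2 : ⇑(b.repr (∑ i, v i • b i)) = v := by
      ext i; rw [b.repr_sum_self]
    rw [h2] at h1
    change L x *ᵥ v = _ at h1
    rw [h1, b.sum_repr]
  have hLstar : ∀ x, G * L (star x) = (L x)ᴴ * G := by
    intro x
    have h1 : ∀ v w : Fin n → ℂ, star v ⬝ᵥ (G * L (star x)) *ᵥ w =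
        star v ⬝ᵥ ((L x)ᴴ * G) *ᵥ w := by
      intro v w
      rw [← mulVec_mulVec, ← mulVec_mulVec, hG, hrep, dotProduct_mulVec, ← star_mulVec, hG, hrep,
        star_mul, mul_assoc]
    ext i j
    have h2 := h1 (Pi.single i 1) (Pi.single j 1)
    simpa [Pi.star_single] using h2
  refine ⟨n, ((LinearMap.mulLeft ℂ B) ∘ₗ (LinearMap.mulRight ℂ B⁻¹)) ∘ₗ L.toLinearMap, ?_, ?_, ?_, ?_⟩
  · simp [e1]
  · intro x y
    have : ∀ X Y : Matrix (Fin n) (Fin n) ℂ, B * ((X * Y) * B⁻¹) = B * (X * B⁻¹) * (B * (Y * B⁻¹)) := by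
      intro X Y
      calc B * ((X * Y) * B⁻¹) = B * (X * 1 * Y * B⁻¹) := by simp
        _ = _ := by rw [← e2]; simp only [mul_assoc]
    simpa using this (L x) (L y)
  · intro x
    have h1 := hLstar x
    rw [hB] at h1
    have h2 : B * (L (star x) * B⁻¹) = (B⁻¹)ᴴ * (Bᴴ * B * L (star x)) * B⁻¹ := by
      have : (B⁻¹)ᴴ * Bᴴ = 1 := by rw [← conjTranspose_mul, e1, conjTranspose_one]
      rw [mul_assoc Bᴴ, ← mul_assoc _ Bᴴ, this, one_mul, mul_assoc]
    have h3 : (B * (L x * B⁻¹))ᴴ = (B⁻¹)ᴴ * ((L x)ᴴ * (Bᴴ * B)) * B⁻¹ := by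
      rw [conjTranspose_mul, conjTranspose_mul, mul_assoc _ _ B⁻¹, mul_assoc _ _ B⁻¹,
        mul_assoc _ _ B⁻¹, e1, mul_one, mul_assoc]
    simp only [LinearMap.comp_apply, LinearMap.mulLeft_apply, LinearMap.mulRight_apply,
      AlgHom.toLinearMap_apply]
    rw [h2, h3, h1]
  · intro f
    let φ : Matrix (Fin n) (Fin n) ℂ →ₗ[ℂ] ℂ :=
      { toFun := fun M => ∑ i, ((B⁻¹ * M * B) *ᵥ (b.repr 1)) i * f (b i)
        map_add' := fun M N => by
          simp [mul_add, add_mul, add_mulVec, Finset.sum_add_distrib]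
        map_smul' := fun c M => by
          simp [smul_mulVec, Finset.mul_sum, mul_assoc] }
    refine ⟨fun i j => φ (Matrix.single i j 1), fun x => ?_⟩
    have h1 : f x = φ (B * (L x * B⁻¹)) := by
      have : B⁻¹ * (B * (L x * B⁻¹)) * B = L x := by
        rw [← mul_assoc, e2, one_mul, mul_assoc, e2, mul_one]
      change _ = ∑ i, ((B⁻¹ * (B * (L x * B⁻¹)) * B) *ᵥ (b.repr 1)) i * f (b i)
      rw [this]
      have h5 := hrep x (b.repr 1)
      rw [b.sum_repr, mul_one] at h5
      conv_lhs => rw [← h5]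
      simp
    rw [h1]
    simp only [LinearMap.comp_apply, LinearMap.mulLeft_apply, LinearMap.mulRight_apply,
      AlgHom.toLinearMap_apply]
    conv_lhs => rw [Matrix.matrix_eq_sum_single (B * (L x * B⁻¹))]
    simp only [map_sum]
    refine Finset.sum_congr rfl fun i _ => Finset.sum_congr rfl fun j _ => ?_
    have : Matrix.single i j ((B * (L x * B⁻¹)) i j) = ((B * (L x * B⁻¹)) i j) • Matrix.single i j 1 := by
      simp
    rw [this, map_smul, smul_eq_mul, mul_comm]

end FDim

namespace Coaction

variable {K : Type*} [FinDimCStarHopfAlgebra K] {A : Type*} [CStarAlgebra A]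

open scoped Matrix in
lemma exists_bound (ρ : A →⋆ₐ[ℂ] A ⊗[ℂ] K) (f : Module.Dual ℂ K) :
    ∃ C : ℝ, ∀ a, ‖slice A f (ρ a)‖ ≤ C * ‖a‖ := by
  obtain ⟨n, π, h1, hmul, hstar, hf⟩ := FDim.exists_rep K
  let p : Fin n → Fin n → Module.Dual ℂ K := fun i j =>
    LinearMap.proj j ∘ₗ LinearMap.proj i ∘ₗ (π : K →ₗ[ℂ] Fin n → Fin n → ℂ)
  have hp : ∀ i j x, p i j x = π x i j := fun i j x => rfl
  let P : A ⊗[ℂ] K →ₗ[ℂ] Fin n → Fin n → A :=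
    LinearMap.pi fun i => LinearMap.pi fun j => slice A (p i j)
  have hP : ∀ X i j, P X i j = slice A (p i j) X := fun X i j => rfl
  have Pmul : ∀ X Y i j, P (X * Y) i j = ∑ k, P X i k * P Y k j := by
    intro X Y i j
    induction X with
    | zero => simp
    | add x y hx hy =>
      simp only [add_mul, map_add, Pi.add_apply, Finset.sum_add_distrib, hx, hy]
    | tmul a x =>
      induction Y with
      | zero => simp
      | add x y hx hy =>
        simp only [mul_add, map_add, Pi.add_apply, Finset.sum_add_distrib, hx, hy]
      | tmul b y =>
        simp only [hP, Algebra.TensorProduct.tmul_mul_tmul, slice_tmul, hp, hmul,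
          Matrix.mul_apply, Finset.sum_smul, smul_mul_smul_comm]
  have Pstar : ∀ X i j, P (star X) i j = star (P X j i) := by
    intro X i j
    induction X with
    | zero => simp
    | add x y hx hy => simp only [star_add, map_add, Pi.add_apply, hx, hy]
    | tmul a x =>
      simp [hP, hp, hstar, Matrix.conjTranspose_apply]
  let Q : A →⋆ₙₐ[ℂ] CStarMatrix (Fin n) (Fin n) A :=
    { toFun := fun a => CStarMatrix.ofMatrix (P (ρ a))
      map_smul' := fun c a => by simp; rfl
      map_zero' := by simp; rfl
      map_add' := fun a b => by simp; rfl
      map_mul' := fun a b => by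
        ext i j
        rw [map_mul]
        exact Pmul _ _ i j
      map_star' := fun a => by
        ext i j
        rw [map_star]
        exact Pstar _ i j }
  let _ := CStarAlgebra.spectralOrder A
  let _ := CStarAlgebra.spectralOrderedRing A
  have hQ : ∀ a i j, ‖slice A (p i j) (ρ a)‖ ≤ ‖a‖ := fun a i j =>
    (CStarMatrix.norm_entry_le_norm (M := Q a) (i := i) (j := j)).trans
      (NonUnitalStarAlgHom.norm_apply_le Q a)
  obtain ⟨c, hc⟩ := hf f
  have hsl : ∀ X, slice A f X = ∑ i, ∑ j, c i j • slice A (p i j) X := by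
    intro X
    induction X with
    | zero => simp
    | add x y hx hy => simp only [map_add, smul_add, Finset.sum_add_distrib, hx, hy]
    | tmul a x => simp only [slice_tmul, hc, hp, Finset.sum_smul, smul_smul]
  refine ⟨∑ i, ∑ j, ‖c i j‖, fun a => ?_⟩
  rw [hsl, Finset.sum_mul]
  refine (norm_sum_le _ _).trans (Finset.sum_le_sum fun i _ => ?_)
  rw [Finset.sum_mul]
  refine (norm_sum_le _ _).trans (Finset.sum_le_sum fun j _ => ?_)
  rw [norm_smul]
  exact mul_le_mul_of_nonneg_left (hQ a i j) (norm_nonneg _)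

end Coaction

/-! ### The sequence algebra -/

section SequenceAlgebra

open scoped BoundedContinuousFunction
open Filter Topology

/-- The closed two-sided ideal `c₀(A)` of `ℓ^∞(ℕ, A)`. -/
def nullSeq (A : Type*) [CStarAlgebra A] : Ideal (ℕ →ᵇ A) where
  carrier := {f | Tendsto (fun n => f n) atTop (𝓝 0)}
  add_mem' {f g} hf hg := by simpa using Tendsto.add hf hg
  zero_mem' := by simp
  smul_mem' f g hg := by
    change Tendsto (fun n => g n) atTop (𝓝 0) at hg
    change Tendsto (fun n => f n * g n) atTop (𝓝 0)
    rw [tendsto_zero_iff_norm_tendsto_zero] at *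
    refine squeeze_zero (fun n => norm_nonneg _) (fun n => ?_) (by simpa using hg.const_mul ‖f‖)
    exact (norm_mul_le _ _).trans
      (mul_le_mul_of_nonneg_right (f.norm_coe_le_norm n) (norm_nonneg _))

variable {A : Type*} [CStarAlgebra A]

lemma mem_nullSeq {f : ℕ →ᵇ A} : f ∈ nullSeq A ↔ Tendsto (fun n => f n) atTop (𝓝 0) := Iff.rfl

instance : (nullSeq A).IsTwoSided where
  mul_mem_of_left {f} g hf := by
    rw [mem_nullSeq, tendsto_zero_iff_norm_tendsto_zero] at *
    refine squeeze_zero (fun n => norm_nonneg _) (fun n => ?_) (by simpa using hf.mul_const ‖g‖)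
    exact (norm_mul_le _ _).trans
      (mul_le_mul_of_nonneg_left (g.norm_coe_le_norm n) (norm_nonneg _))

lemma star_mem_nullSeq {f : ℕ →ᵇ A} (hf : f ∈ nullSeq A) : star f ∈ nullSeq A := by
  rw [mem_nullSeq] at *
  have h := (continuous_star.tendsto (0 : A)).comp hf
  rw [star_zero] at h
  exact h

/-- The sequence algebra `A^∞ = ℓ^∞(ℕ, A) / c₀(A)`. -/
def SeqAlg (A : Type*) [CStarAlgebra A] : Type _ := (ℕ →ᵇ A) ⧸ nullSeq A

namespace SeqAlg

instance : Ring (SeqAlg A) := inferInstanceAs (Ring ((ℕ →ᵇ A) ⧸ nullSeq A))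

instance : Algebra ℂ (SeqAlg A) := inferInstanceAs (Algebra ℂ ((ℕ →ᵇ A) ⧸ nullSeq A))

/-- The quotient map `ℓ^∞(ℕ, A) → A^∞`. -/
def mkₐ (A : Type*) [CStarAlgebra A] : (ℕ →ᵇ A) →ₐ[ℂ] SeqAlg A := Ideal.Quotient.mkₐ ℂ (nullSeq A)

lemma mkₐ_surjective : Function.Surjective (mkₐ A) := Ideal.Quotient.mkₐ_surjective ℂ (nullSeq A)

lemma mkₐ_eq_iff {f g : ℕ →ᵇ A} : mkₐ A f = mkₐ A g ↔ f - g ∈ nullSeq A := Ideal.Quotient.eq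

lemma mkₐ_eq_zero {f : ℕ →ᵇ A} (hf : f ∈ nullSeq A) : mkₐ A f = 0 :=
  Ideal.Quotient.eq_zero_iff_mem.2 hf

instance : Star (SeqAlg A) where
  star := Quotient.lift (fun f : ℕ →ᵇ A => mkₐ A (star f)) fun f g h => by
    have h1 : mkₐ A f = mkₐ A g := Quotient.sound h
    rw [mkₐ_eq_iff] at h1 ⊢
    rw [← star_sub]
    exact star_mem_nullSeq h1

lemma star_mkₐ (f : ℕ →ᵇ A) : star (mkₐ A f) = mkₐ A (star f) := rfl

instance : StarRing (SeqAlg A) where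
  star_involutive x := by
    obtain ⟨f, rfl⟩ := mkₐ_surjective x
    simp [star_mkₐ]
  star_mul x y := by
    obtain ⟨f, rfl⟩ := mkₐ_surjective x
    obtain ⟨g, rfl⟩ := mkₐ_surjective y
    rw [← map_mul, star_mkₐ, star_mul, map_mul, star_mkₐ, star_mkₐ]
  star_add x y := by
    obtain ⟨f, rfl⟩ := mkₐ_surjective x
    obtain ⟨g, rfl⟩ := mkₐ_surjective y
    rw [← map_add, star_mkₐ, star_add, map_add, star_mkₐ, star_mkₐ]

instance : StarModule ℂ (SeqAlg A) where
  star_smul c x := by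
    obtain ⟨f, rfl⟩ := mkₐ_surjective x
    rw [← map_smul, star_mkₐ, star_smul, map_smul, star_mkₐ]

/-- The quotient map `ℓ^∞(ℕ, A) → A^∞` as a `*`-homomorphism. -/
def mk (A : Type*) [CStarAlgebra A] : (ℕ →ᵇ A) →⋆ₐ[ℂ] SeqAlg A :=
  { mkₐ A with map_star' := fun _ => rfl }

/-- The embedding of `A` into `A^∞` by constant sequences. -/
def const (A : Type*) [CStarAlgebra A] : A →⋆ₐ[ℂ] SeqAlg A where
  toFun a := mkₐ A (BoundedContinuousFunction.const ℕ a)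
  map_one' := map_one (mkₐ A)
  map_mul' a b := map_mul (mkₐ A) (BoundedContinuousFunction.const ℕ a) (.const ℕ b)
  map_zero' := map_zero (mkₐ A)
  map_add' a b := map_add (mkₐ A) (BoundedContinuousFunction.const ℕ a) (.const ℕ b)
  commutes' c := (mkₐ A).commutes c
  map_star' _ := rfl

end SeqAlg

/-- Evaluation of bounded sequences at `n`. -/
def evₐ (A : Type*) [CStarAlgebra A] (n : ℕ) : (ℕ →ᵇ A) →⋆ₐ[ℂ] A where
  toFun f := f n
  map_one' := rfl
  map_mul' _ _ := rfl
  map_zero' := rfl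
  map_add' _ _ := rfl
  commutes' _ := rfl
  map_star' _ := rfl

/-- The map `φ ⊗ id : B ⊗ V → C ⊗ V` induced by a `*`-homomorphism `φ : B → C`. -/
def mapLeft {B C : Type*} [Ring B] [StarRing B] [Algebra ℂ B] [StarModule ℂ B]
    [Ring C] [StarRing C] [Algebra ℂ C] [StarModule ℂ C] (φ : B →⋆ₐ[ℂ] C)
    (V : Type*) [Ring V] [StarRing V] [Algebra ℂ V] [StarModule ℂ V] :
    B ⊗[ℂ] V →⋆ₐ[ℂ] C ⊗[ℂ] V :=
  { Algebra.TensorProduct.map φ.toAlgHom (AlgHom.id ℂ V) with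
    map_star' := fun x => by
      induction x using TensorProduct.induction_on with
      | zero => simp
      | add x y hx hy =>
        simp only [star_add] at *
        exact (map_add _ _ _).trans
          ((congrArg₂ (· + ·) hx hy).trans
            (by rw [← star_add]; exact congrArg star (map_add _ _ _).symm))
      | tmul a v => exact congrArg (· ⊗ₜ[ℂ] star v) (map_star φ a) }

lemma mapLeft_tmul {B C : Type*} [Ring B] [StarRing B] [Algebra ℂ B] [StarModule ℂ B]
    [Ring C] [StarRing C] [Algebra ℂ C] [StarModule ℂ C] (φ : B →⋆ₐ[ℂ] C)
    (V : Type*) [Ring V] [StarRing V] [Algebra ℂ V] [StarModule ℂ V] (b : B) (v : V) :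
    mapLeft φ V (b ⊗ₜ v) = φ b ⊗ₜ v := rfl

lemma mapLeft_eq {B C : Type*} [Ring B] [StarRing B] [Algebra ℂ B] [StarModule ℂ B]
    [Ring C] [StarRing C] [Algebra ℂ C] [StarModule ℂ C] (φ : B →⋆ₐ[ℂ] C)
    (V : Type*) [Ring V] [StarRing V] [Algebra ℂ V] [StarModule ℂ V] (x : B ⊗[ℂ] V) :
    mapLeft φ V x = φ.toAlgHom.toLinearMap.rTensor V x := rfl

lemma seq_ext {V : Type*} [AddCommGroup V] [Module ℂ V] [FiniteDimensional ℂ V]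
    {X Y : (ℕ →ᵇ A) ⊗[ℂ] V}
    (h : ∀ n, (evₐ A n).toAlgHom.toLinearMap.rTensor V X =
      (evₐ A n).toAlgHom.toLinearMap.rTensor V Y) : X = Y := by
  let b := Module.finBasis ℂ V
  let s : ∀ (B : Type _) [AddCommGroup B] [Module ℂ B], _ → B ⊗[ℂ] V →ₗ[ℂ] B :=
    fun B _ _ i => (TensorProduct.rid ℂ B).toLinearMap ∘ₗ (b.coord i).lTensor B
  have key : ∀ Z : (ℕ →ᵇ A) ⊗[ℂ] V, ∑ i, s _ i Z ⊗ₜ[ℂ] b i = Z := by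
    intro Z
    induction Z with
    | zero => simp
    | add x y hx hy =>
      simp only [map_add, TensorProduct.add_tmul, Finset.sum_add_distrib, hx, hy]
    | tmul f v =>
      simp only [s, LinearMap.comp_apply, LinearMap.lTensor_tmul, LinearEquiv.coe_coe,
        TensorProduct.rid_tmul, TensorProduct.smul_tmul, ← TensorProduct.tmul_sum, b.coord_apply,
        b.sum_repr]
  have key2 : ∀ (Z : (ℕ →ᵇ A) ⊗[ℂ] V) n i, s _ i Z n =
      s _ i ((evₐ A n).toAlgHom.toLinearMap.rTensor V Z) := by
    intro Z n i
    induction Z with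
    | zero => simp
    | add x y hx hy => simp only [map_add, BoundedContinuousFunction.add_apply, hx, hy]
    | tmul f v => simp [s]; rfl
  rw [← key X, ← key Y]
  refine Finset.sum_congr rfl fun i _ => ?_
  congr 1
  ext n
  rw [key2, key2, h]

namespace Coaction

variable {K : Type*} [FinDimCStarHopfAlgebra K]

/-- The bounded sequence `n ↦ (id ⊗ g)(ρ(f n))`. -/
def sliceSeq (ρ : Coaction K A) (g : Module.Dual ℂ K) (f : ℕ →ᵇ A) : ℕ →ᵇ A :=
  BoundedContinuousFunction.ofNormedAddCommGroup (fun n => slice A g (ρ (f n)))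
    continuous_of_discreteTopology (|(exists_bound ρ.toStarAlgHom g).choose| * ‖f‖) fun n =>
      ((exists_bound ρ.toStarAlgHom g).choose_spec (f n)).trans
        (mul_le_mul (le_abs_self _) (f.norm_coe_le_norm n) (norm_nonneg _) (abs_nonneg _))

lemma sliceSeq_apply (ρ : Coaction K A) (g : Module.Dual ℂ K) (f : ℕ →ᵇ A) (n : ℕ) :
    ρ.sliceSeq g f n = slice A g (ρ (f n)) := rfl

lemma sliceSeq_mem (ρ : Coaction K A) (g : Module.Dual ℂ K) {f : ℕ →ᵇ A} (hf : f ∈ nullSeq A) :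
    ρ.sliceSeq g f ∈ nullSeq A := by
  rw [mem_nullSeq, tendsto_zero_iff_norm_tendsto_zero] at *
  obtain ⟨C, hC⟩ := exists_bound ρ.toStarAlgHom g
  exact squeeze_zero (fun n => norm_nonneg _) (fun n => hC (f n)) (by simpa using hf.const_mul C)

/-- The map `ℓ^∞(ℕ, A) → ℓ^∞(ℕ, A) ⊗ K` that applies `ρ` to every term of a sequence, written in
terms of the components of `ρ` in a basis of `K`. -/
def seqFun (ρ : Coaction K A) (f : ℕ →ᵇ A) : (ℕ →ᵇ A) ⊗[ℂ] K :=
  ∑ i, ρ.sliceSeq ((Module.finBasis ℂ K).coord i) f ⊗ₜ[ℂ] Module.finBasis ℂ K i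

lemma ev_seqFun (ρ : Coaction K A) (f : ℕ →ᵇ A) (n : ℕ) :
    (evₐ A n).toAlgHom.toLinearMap.rTensor K (ρ.seqFun f) = ρ (f n) := by
  have key : ∀ Z : A ⊗[ℂ] K, ∑ i, slice A ((Module.finBasis ℂ K).coord i) Z ⊗ₜ[ℂ]
      Module.finBasis ℂ K i = Z := by
    intro Z
    induction Z with
    | zero => simp
    | add x y hx hy =>
      simp only [map_add, TensorProduct.add_tmul, Finset.sum_add_distrib, hx, hy]
    | tmul f v =>
      simp only [slice_tmul, TensorProduct.smul_tmul, ← TensorProduct.tmul_sum,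
        Module.Basis.coord_apply, Module.Basis.sum_repr]
  rw [seqFun, map_sum]
  simp only [LinearMap.rTensor_tmul]
  exact key _

lemma ev_mul (n : ℕ) (X Y : (ℕ →ᵇ A) ⊗[ℂ] K) :
    (evₐ A n).toAlgHom.toLinearMap.rTensor K (X * Y) =
    (evₐ A n).toAlgHom.toLinearMap.rTensor K X * (evₐ A n).toAlgHom.toLinearMap.rTensor K Y :=
  map_mul (mapLeft (evₐ A n) K) X Y

/-- The termwise application of `ρ` as a `*`-homomorphism. -/
def seqHom (ρ : Coaction K A) : (ℕ →ᵇ A) →⋆ₐ[ℂ] (ℕ →ᵇ A) ⊗[ℂ] K where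
  toFun := ρ.seqFun
  map_one' := seq_ext fun n => by
    rw [ev_seqFun, ← mapLeft_eq, map_one]; exact map_one ρ.toStarAlgHom
  map_mul' f g := seq_ext fun n => by
    rw [ev_mul, ev_seqFun, ev_seqFun, ev_seqFun]; exact map_mul ρ.toStarAlgHom _ _
  map_zero' := seq_ext fun n => by
    rw [ev_seqFun, map_zero]; exact map_zero ρ.toStarAlgHom
  map_add' f g := seq_ext fun n => by
    rw [map_add, ev_seqFun, ev_seqFun, ev_seqFun]; exact map_add ρ.toStarAlgHom _ _
  commutes' c := seq_ext fun n => by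
    rw [ev_seqFun, ← mapLeft_eq]
    exact (AlgHomClass.commutes ρ.toStarAlgHom c).trans
      (AlgHomClass.commutes (mapLeft (evₐ A n) K) c).symm
  map_star' f := seq_ext fun n => by
    rw [ev_seqFun, ← mapLeft_eq, map_star, mapLeft_eq, ev_seqFun]
    exact map_star ρ.toStarAlgHom _

lemma ev_seqHom (ρ : Coaction K A) (f : ℕ →ᵇ A) (n : ℕ) :
    (evₐ A n).toAlgHom.toLinearMap.rTensor K (ρ.seqHom f) = ρ (f n) := ev_seqFun ρ f n

lemma rid_naturality {B C : Type*} [AddCommGroup B] [Module ℂ B] [AddCommGroup C] [Module ℂ C]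
    (φ : B →ₗ[ℂ] C) (g : Module.Dual ℂ K) (X : B ⊗[ℂ] K) :
    TensorProduct.rid ℂ C (g.lTensor C (φ.rTensor K X)) =
      φ (TensorProduct.rid ℂ B (g.lTensor B X)) := by
  induction X with
  | zero => simp
  | add x y hx hy => simp only [map_add, hx, hy]
  | tmul b x => simp

lemma comul_naturality {B C : Type*} [AddCommGroup B] [Module ℂ B] [AddCommGroup C] [Module ℂ C]
    (φ : B →ₗ[ℂ] C) (X : B ⊗[ℂ] K) :
    (Coalgebra.comul (R := ℂ) (A := K)).lTensor C (φ.rTensor K X) =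
      φ.rTensor (K ⊗[ℂ] K) ((Coalgebra.comul (R := ℂ) (A := K)).lTensor B X) := by
  induction X with
  | zero => simp
  | add x y hx hy => simp only [map_add, hx, hy]
  | tmul b x => simp

lemma assoc_naturality {B C : Type*} [AddCommGroup B] [Module ℂ B] [AddCommGroup C] [Module ℂ C]
    (φ : B →ₗ[ℂ] C) (r : B →ₗ[ℂ] B ⊗[ℂ] K) (r' : C →ₗ[ℂ] C ⊗[ℂ] K)
    (h : ∀ b, r' (φ b) = φ.rTensor K (r b)) (X : B ⊗[ℂ] K) :
    TensorProduct.assoc ℂ C K K (r'.rTensor K (φ.rTensor K X)) =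
      φ.rTensor (K ⊗[ℂ] K) (TensorProduct.assoc ℂ B K K (r.rTensor K X)) := by
  induction X with
  | zero => simp
  | add x y hx hy => simp only [map_add, hx, hy]
  | tmul b x =>
    simp only [LinearMap.rTensor_tmul, h]
    induction r b with
    | zero => simp
    | add x y hx hy => simp only [map_add, TensorProduct.add_tmul, hx, hy]
    | tmul b x => simp

lemma seqHom_counit (ρ : Coaction K A) (f : ℕ →ᵇ A) :
    TensorProduct.rid ℂ (ℕ →ᵇ A)
      ((Coalgebra.counit (R := ℂ) (A := K)).lTensor (ℕ →ᵇ A) (ρ.seqHom f)) = f := by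
  ext n
  refine (rid_naturality (evₐ A n).toAlgHom.toLinearMap _ (ρ.seqHom f)).symm.trans ?_
  rw [ev_seqHom]
  exact ρ.counit_comp (f n)

lemma seqHom_coassoc (ρ : Coaction K A) (f : ℕ →ᵇ A) :
    TensorProduct.assoc ℂ (ℕ →ᵇ A) K K
      (ρ.seqHom.toAlgHom.toLinearMap.rTensor K (ρ.seqHom f)) =
      (Coalgebra.comul (R := ℂ) (A := K)).lTensor (ℕ →ᵇ A) (ρ.seqHom f) := by
  refine seq_ext fun n => ?_
  rw [← comul_naturality, ev_seqHom,
    ← assoc_naturality _ _ ρ.lin (fun f => (ev_seqHom ρ f n).symm), ev_seqHom]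
  exact ρ.coassoc (f n)

lemma mk_seqFun (ρ : Coaction K A) {f : ℕ →ᵇ A} (hf : f ∈ nullSeq A) :
    mapLeft (SeqAlg.mk A) K (ρ.seqHom f) = 0 := by
  change mapLeft (SeqAlg.mk A) K (ρ.seqFun f) = 0
  rw [seqFun, map_sum]
  refine Finset.sum_eq_zero fun i _ => ?_
  rw [mapLeft_tmul]
  have : SeqAlg.mk A (ρ.sliceSeq ((Module.finBasis ℂ K).coord i) f) = 0 :=
    SeqAlg.mkₐ_eq_zero (sliceSeq_mem ρ _ hf)
  rw [this, TensorProduct.zero_tmul]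

/-- The underlying algebra homomorphism of `ρ^∞`. -/
def inftyHom (ρ : Coaction K A) : SeqAlg A →ₐ[ℂ] SeqAlg A ⊗[ℂ] K :=
  Ideal.Quotient.liftₐ (nullSeq A) ((mapLeft (SeqAlg.mk A) K).toAlgHom.comp ρ.seqHom.toAlgHom)
    fun _ hf => mk_seqFun ρ hf

lemma inftyHom_mk (ρ : Coaction K A) (f : ℕ →ᵇ A) :
    ρ.inftyHom (SeqAlg.mk A f) = mapLeft (SeqAlg.mk A) K (ρ.seqHom f) := rfl

/-- The coaction `ρ^∞` on `A^∞` induced by `ρ`: `ρ^∞((a_n)) = (ρ(a_n))`. -/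
def infty (ρ : Coaction K A) : Coaction K (SeqAlg A) where
  toAlgHom := ρ.inftyHom
  map_star' x := by
    obtain ⟨f, rfl⟩ := SeqAlg.mkₐ_surjective x
    change ρ.inftyHom (SeqAlg.mk A (star f)) = star (ρ.inftyHom (SeqAlg.mk A f))
    rw [inftyHom_mk, inftyHom_mk, map_star, map_star]
  counit_comp x := by
    obtain ⟨f, rfl⟩ := SeqAlg.mkₐ_surjective x
    refine (rid_naturality (SeqAlg.mk A).toAlgHom.toLinearMap _ (ρ.seqHom f)).trans ?_
    rw [seqHom_counit]
    rfl
  coassoc x := by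
    obtain ⟨f, rfl⟩ := SeqAlg.mkₐ_surjective x
    refine (assoc_naturality (SeqAlg.mk A).toAlgHom.toLinearMap
      ρ.seqHom.toAlgHom.toLinearMap _ (fun f => inftyHom_mk ρ f) (ρ.seqHom f)).trans ?_
    rw [seqHom_coassoc, ← comul_naturality]
    rfl

lemma infty_mk (ρ : Coaction K A) (f : ℕ →ᵇ A) :
    ρ.infty (SeqAlg.mk A f) = mapLeft (SeqAlg.mk A) K (ρ.seqHom f) := rfl

end Coaction

end SequenceAlgebra

/-! ### The Rohlin property and approximate unitary equivalence -/

/-- Approximate representability of a coaction `σ` of a Hopf `*`-algebra `H` with comultiplication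
`Δ` on a `*`-algebra `B`. Here `ι : B → B'` is the embedding of `B` into its sequence algebra `B'`
and `σ'` is the coaction on `B'` induced by `σ`. There has to be a unitary `w ∈ B' ⊗ H` with
* `σ(x) = w (x ⊗ 1) w⋆` for all `x ∈ B`,
* `(w ⊗ 1) (ρ_H ⊗ id)(w) (id ⊗ Δ)(w⋆) = 1`, where `ρ_H(y) = y ⊗ 1` is the trivial coaction,
* `(σ' ⊗ id)(w) (w ⊗ 1) (id ⊗ Δ)(w⋆) = 1`. -/
def IsApproxRepresentable {H : Type*} [Ring H] [StarRing H] [Algebra ℂ H] [StarModule ℂ H]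
    (Δ : H →ₗ[ℂ] H ⊗[ℂ] H) {B B' : Type*}
    [Ring B] [Algebra ℂ B] [Ring B'] [StarRing B'] [Algebra ℂ B'] [StarModule ℂ B']
    (ι : B →ₗ[ℂ] B') (σ : B →ₗ[ℂ] B ⊗[ℂ] H) (σ' : B' →ₗ[ℂ] B' ⊗[ℂ] H) : Prop :=
  ∃ w ∈ unitary (B' ⊗[ℂ] H),
    (∀ x : B, ι.rTensor H (σ x) = w * (ι x ⊗ₜ[ℂ] 1) * star w) ∧
    (w ⊗ₜ[ℂ] (1 : H)) *
        (Algebra.TensorProduct.includeLeft : B' →ₐ[ℂ] B' ⊗[ℂ] H).toLinearMap.rTensor H w *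
        (TensorProduct.assoc ℂ B' H H).symm (Δ.lTensor B' (star w)) = 1 ∧
    σ'.rTensor H w * (w ⊗ₜ[ℂ] (1 : H)) *
        (TensorProduct.assoc ℂ B' H H).symm (Δ.lTensor B' (star w)) = 1

namespace Coaction

/-- The dual coaction `ρ̂(a ⋊ h) = (a ⋊ h₍₁₎) ⊗ h₍₂₎` of `H` on the crossed product `A ⋊_ρ H`. -/
def dual {K : Type*} [FinDimCStarHopfAlgebra K] {A : Type*} [Ring A] [StarRing A] [Algebra ℂ A]
    [StarModule ℂ A] (ρ : Coaction K A) : Crossed ρ →ₗ[ℂ] Crossed ρ ⊗[ℂ] DualHopf K :=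
  (Crossed.toTensor ρ).symm.toLinearMap.rTensor (DualHopf K) ∘ₗ
    (TensorProduct.assoc ℂ A (DualHopf K) (DualHopf K)).symm.toLinearMap ∘ₗ
      (DualHopf.comul (K := K)).lTensor A ∘ₗ (Crossed.toTensor ρ).toLinearMap

variable {K : Type*} [FinDimCStarHopfAlgebra K] {A : Type*} [CStarAlgebra A]

/-- The embedding `a ⋊ h ↦ (a, a, …) ⋊ h` of `A ⋊_ρ H` into `A^∞ ⋊_{ρ^∞} H`. -/
def crossedConst (ρ : Coaction K A) : Crossed ρ →ₗ[ℂ] Crossed ρ.infty :=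
  (Crossed.toTensor ρ.infty).symm.toLinearMap ∘ₗ
    (SeqAlg.const A).toAlgHom.toLinearMap.rTensor (DualHopf K) ∘ₗ (Crossed.toTensor ρ).toLinearMap

/-- The Rohlin property of a coaction `ρ` of `K` on a unital C*-algebra `A`: the dual coaction of
`H = DualHopf K` on `A ⋊_ρ H` is approximately representable. The sequence algebra of `A ⋊_ρ H` is
`A^∞ ⋊_{ρ^∞} H` (where `(a_n) ⋊ h` is the class of `(a_n ⋊ h)`), and the coaction that the dual
coaction of `ρ` induces on it is the dual coaction of `ρ^∞`. -/
def IsRohlin (ρ : Coaction K A) : Prop :=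
  IsApproxRepresentable (DualHopf.comul (K := K)) ρ.crossedConst ρ.dual ρ.infty.dual

/-- Approximate unitary equivalence of coactions: there is a unitary `v ∈ A^∞ ⊗ K` with
`σ(a) = v ρ(a) v⋆` for all `a ∈ A`. -/
def ApproxUnitarilyEquivalent (ρ σ : Coaction K A) : Prop :=
  ∃ v ∈ unitary (SeqAlg A ⊗[ℂ] K), ∀ a : A,
    mapLeft (SeqAlg.const A) K (σ a) = v * mapLeft (SeqAlg.const A) K (ρ a) * star v

end Coaction

/-- An automorphism of a unital C*-algebra is approximately inner if it is a limit of inner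
automorphisms `Ad(u)`, `u` unitary, in the topology of pointwise norm convergence. -/
def IsApproxInner {A : Type*} [CStarAlgebra A] (θ : A ≃⋆ₐ[ℂ] A) : Prop :=
  ∀ (F : Finset A) (ε : ℝ), 0 < ε → ∃ u ∈ unitary A, ∀ a ∈ F, ‖θ a - u * a * star u‖ < ε

end

/-! ### Haar projection and Fourier transform on the Hopf algebra `K` -/

noncomputable section

namespace CStarHopf

open Coalgebra HopfAlgebra Coaction Module

variable {K : Type*} [FinDimCStarHopfAlgebra K]

/-! Approximate unitary equivalence is implemented by a unitary v of A^∞ ⊗ K, while an automorphism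
of A must come from unitaries of A. The Rohlin property closes this gap: it gives a *-homomorphism Φ
: A ⊗ K → A^∞ with Φ(ρ(a)) = a, equivariant for id ⊗ Δ on A ⊗ K and ρ^∞ on A^∞
(`IsRohlin.exists_splitting`). Approximate v by elements of A ⊗ K, again called v, and put u =
Φ(v*). Then u is almost unitary and u* a u = Φ(v ρ(a) v*) ≈ Φ(σ(a)). Applying ρ^∞, equivariance and
coassociativity of σ give (Φ ⊗ id)((σ ⊗ id)σ(a)), and conjugating by u ⊗ 1 turns this approximately
into (Φ ⊗ id)((ρ ⊗ id)σ(a)) = σ(a). So Ad(u) carries ρ close to σ. Moreover, where ρ(a) ≈ σ(a)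
already holds, u a u* = Φ(v* ρ(a) v) ≈ Φ(v* σ(a) v) ≈ Φ(ρ(a)) = a, so u almost commutes with a.
Representatives of u in A are perturbed to unitaries (`exists_almost_unitary`,
`exists_unitary_norm_sub_le`, `IsRohlin.hasIntertwiners`).

To construct Φ, slice the unitary w of the Rohlin property by the Haar projection e of K. The
cocycle identities make x ↦ (id ⊗ x)(w) multiplicative and the slice at e fixed under the dual
coaction, so it equals p ⋊ 1 for a projection p in A^∞. Covariance of w shows that p commutes with
A, that (p ⊗ 1)ρ^∞(p) = p ⊗ e, and that a normalised slice of ρ^∞(p) is 1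
(`Crossed.exists_projection`). With f_x = `fourierInv x`, the functional such that e₍₁₎ f_x(e₍₂₎) =
x, set Φ(a ⊗ x) = (id ⊗ f_x)(ρ^∞(a p)); the algebra of e makes this an equivariant unital
*-homomorphism.

Both coactions being Rohlin, a two-sided intertwining (`exists_isApproxInner_intertwining`)
alternately corrects unitaries x_n and y_n, so that Ad(x_n) ∘ ρ ∘ Ad(x_n*) and Ad(y_n) ∘ σ ∘
Ad(y_n*), acting on the A leg, get closer on growing finite sets. Almost commutation makes the
corrections summable. If θ and κ are the limits of Ad(x_n) and Ad(y_n), then κ⁻¹θ carries ρ to σ and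
is a limit of Ad(y_n* x_n). -/

lemma antipode_star_antipode_star (x : K) : antipode ℂ (star (antipode ℂ (star x))) = x := by
  rw [antipode_star_antipode, star_star]

/-- The form tr(xy) is nondegenerate because tr(x x*) = 0 forces x = 0, so in finite dimension every
functional has a density. The density of the counit will be a nonzero multiple of the Haar
projection. -/
lemma exists_counit_eq_tr : ∃ g : K, ∀ y, FDim.tr K (g * y) = counit (R := ℂ) y := by
  let T : K →ₗ[ℂ] Dual ℂ K := (LinearMap.mul ℂ K).compr₂ (FDim.tr K)
  have hT : ∀ x y, T x y = FDim.tr K (x * y) := fun _ _ => rfl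
  have hinj : Function.Injective T := by
    refine (injective_iff_map_eq_zero T).2 fun x hx => ?_
    have h := congr($hx (star x))
    rw [hT, LinearMap.zero_apply] at h
    have h' := FDim.eq_zero_of_tr (star x) (by rwa [star_star])
    simpa using h'
  obtain ⟨g, hg⟩ := (LinearMap.injective_iff_surjective_of_finrank_eq_finrank
    (Subspace.dual_finrank_eq).symm).1 hinj (counit (R := ℂ))
  exact ⟨g, fun y => by rw [← hT, hg]⟩

/-- The Haar projection of a finite-dimensional C*-Hopf algebra. -/
lemma exists_haarProjection : ∃ e : K, (∀ x, x * e = counit (R := ℂ) x • e) ∧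
    (∀ x, e * x = counit (R := ℂ) x • e) ∧ star e = e ∧ counit (R := ℂ) e = 1 := by
  obtain ⟨g, hg⟩ := exists_counit_eq_tr (K := K)
  -- Paired with y under the trace, the difference gives ε(xy) - ε(x)ε(y) = 0.
  have hgx : ∀ x, g * x = counit (R := ℂ) x • g := fun x => by
    have h : ∀ y, FDim.tr K ((g * x - counit (R := ℂ) x • g) * y) = 0 := fun y => by
      rw [sub_mul, mul_assoc, map_sub, hg, smul_mul_assoc, map_smul, hg, Bialgebra.counit_mul,
        smul_eq_mul, sub_self]
    have := FDim.eq_zero_of_tr (star (g * x - counit (R := ℂ) x • g))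
      (by rw [star_star]; exact h _)
    rwa [star_eq_zero, sub_eq_zero] at this
  -- If ε(g) = 0 then tr(g g*) = ε(g*) = 0, so g = 0, which contradicts tr(g) = ε(1) = 1.
  have hg0 : counit (R := ℂ) g ≠ 0 := fun h => by
    have h1 : FDim.tr K (star (star g) * star g) = 0 := by
      rw [star_star, hg, counit_star, h, star_zero]
    have h2 : g = 0 := by simpa using FDim.eq_zero_of_tr _ h1
    have h3 := hg 1
    rw [h2, zero_mul, map_zero, Bialgebra.counit_one] at h3
    exact zero_ne_one h3
  set e := (counit (R := ℂ) g)⁻¹ • g with he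
  have h1 : ∀ x, e * x = counit (R := ℂ) x • e := fun x => by
    rw [he, smul_mul_assoc, hgx, smul_comm]
  have h2 : counit (R := ℂ) e = 1 := by
    rw [he, map_smul, smul_eq_mul, inv_mul_cancel₀ hg0]
  -- The absorption rule gives e e* = ε(e*) e = e, and e e* is self-adjoint. Adjoints then convert
  -- one-sided absorption into two-sided absorption.
  have h3 : star e = e := by
    have h := h1 (star e)
    rw [counit_star, h2, star_one, one_smul] at h
    rw [← h, star_mul, star_star]
  refine ⟨e, fun x => ?_, h1, h3, h2⟩
  have h := congr(star $(h1 (star x)))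
  rwa [star_mul, star_star, h3, star_smul, h3, counit_star, star_star] at h

variable (K) in
/-- The Haar projection of a finite-dimensional C*-Hopf algebra. -/
def haar : K := (exists_haarProjection (K := K)).choose

lemma mul_haar (x : K) : x * haar K = counit (R := ℂ) x • haar K :=
  (exists_haarProjection (K := K)).choose_spec.1 x

lemma haar_mul (x : K) : haar K * x = counit (R := ℂ) x • haar K :=
  (exists_haarProjection (K := K)).choose_spec.2.1 x

@[simp] lemma star_haar : star (haar K) = haar K :=
  (exists_haarProjection (K := K)).choose_spec.2.2.1

@[simp] lemma counit_haar : counit (R := ℂ) (haar K) = 1 :=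
  (exists_haarProjection (K := K)).choose_spec.2.2.2

-- Choose y with S(y) = e, namely y = S(e*)*. Then S(ey) is ε(y)S(e) = S(e) by absorption and
-- S(y)S(e) = e S(e) = e by antimultiplicativity.
@[simp] lemma antipode_haar : antipode ℂ (haar K) = haar K := by
  have h := antipode_mul_antidistrib (R := ℂ) (haar K)
    (star (antipode ℂ (star (haar K))))
  rw [haar_mul, antipode_star_antipode_star, haar_mul, map_smul, counit_star, counit_antipode,
    counit_star, star_star, counit_haar, one_smul, counit_antipode, counit_haar, one_smul] at h
  exact h

lemma sum_comul_mul_antipode (x : K) (s : Coalgebra.Repr ℂ x (K × K)) :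
    ∑ i ∈ s.index, comul (R := ℂ) (s.left i) * (1 ⊗ₜ[ℂ] antipode ℂ (s.right i)) = x ⊗ₜ[ℂ] 1 := by
  simpa using antipode_comul_aux x 1 s

/-- `e₍₁₎ ⊗ e₍₂₎ S(y) = e₍₁₎ y ⊗ e₍₂₎`. -/
lemma comul_haar_mul (y : K) : comul (R := ℂ) (haar K) * (1 ⊗ₜ[ℂ] antipode ℂ y) =
    comul (R := ℂ) (haar K) * (y ⊗ₜ[ℂ] 1) := by
  let s := Coalgebra.Repr.arbitrary ℂ y
  -- Once y ⊗ 1 is expanded as Δ(y₍₁₎)(1 ⊗ S(y₍₂₎)), the factor Δ(e)Δ(y₍₁₎) = ε(y₍₁₎)Δ(e) collapses.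
  rw [← sum_comul_mul_antipode y s, Finset.mul_sum]
  simp only [← mul_assoc, ← Bialgebra.comul_mul, haar_mul, map_smul, smul_mul_assoc]
  conv_lhs => rw [← sum_counit_smul s, map_sum, TensorProduct.tmul_sum, Finset.mul_sum]
  simp

/-- `e₍₁₎ ⊗ z e₍₂₎ = S(z) e₍₁₎ ⊗ e₍₂₎`. -/
lemma mul_comul_haar (z : K) : (1 ⊗ₜ[ℂ] z) * comul (R := ℂ) (haar K) =
    (antipode ℂ z ⊗ₜ[ℂ] 1) * comul (R := ℂ) (haar K) := by
  -- This is the adjoint of the preceding identity at y = S(z)*, for which S(y) = z*.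
  have h := congr(star $(comul_haar_mul (star (antipode ℂ z))))
  rw [antipode_star_antipode] at h
  simpa [← star_comul_eq] using h

lemma slice_mul_tmul {D : Type*} [Ring D] [Algebra ℂ D] (f : Dual ℂ K) (X : D ⊗[ℂ] K) (d : D) (x : K) :
    slice D f (X * (d ⊗ₜ x)) = slice D (f ∘ₗ LinearMap.mulRight ℂ x) X * d := by
  induction X with
  | zero => simp
  | add X Y hX hY => simp only [add_mul, map_add, hX, hY]
  | tmul a y => simp

lemma slice_tmul_mul {D : Type*} [Ring D] [Algebra ℂ D] (f : Dual ℂ K) (X : D ⊗[ℂ] K) (d : D) (x : K) :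
    slice D f ((d ⊗ₜ x) * X) = d * slice D (f ∘ₗ LinearMap.mulLeft ℂ x) X := by
  induction X with
  | zero => simp
  | add X Y hX hY => simp only [mul_add, map_add, hX, hY]
  | tmul a y => simp

@[simp] lemma mulRight_one_comp (f : Dual ℂ K) : f ∘ₗ LinearMap.mulRight ℂ (1 : K) = f := by
  ext; simp

@[simp] lemma mulLeft_one_comp (f : Dual ℂ K) : f ∘ₗ LinearMap.mulLeft ℂ (1 : K) = f := by
  ext; simp

/-- The Fourier transform `f ↦ e₍₁₎ f(e₍₂₎)`. -/
def fourierAux : Dual ℂ K →ₗ[ℂ] K where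
  toFun f := slice K f (comul (R := ℂ) (haar K))
  map_add' f g := by simp [slice]
  map_smul' c f := by simp [slice]

lemma fourierAux_apply (f : Dual ℂ K) :
    fourierAux f = slice K f (comul (R := ℂ) (haar K)) := rfl

/-- If e₍₁₎ h(e₍₂₎) = 0, then e₍₁₎ h(z e₍₂₎) = S(z) e₍₁₎ h(e₍₂₎) = 0 for every z. With Δ(e) = Σ b_i
⊗ c_i for a basis b_i, this says h(z c_i) = 0 for all z and i. Since Σ S(b_i) c_i = ε(e)1 = 1, each
z is Σ z S(b_i) c_i, and h vanishes. -/
lemma fourierAux_injective : Function.Injective (fourierAux (K := K)) := by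
  refine (injective_iff_map_eq_zero _).2 fun h hh => ?_
  rw [fourierAux_apply] at hh
  have h1 : ∀ z, slice K (h ∘ₗ LinearMap.mulLeft ℂ z) (comul (R := ℂ) (haar K)) = 0 := fun z => by
    have := slice_tmul_mul h (comul (R := ℂ) (haar K)) 1 z
    rw [one_mul] at this
    rw [← this, mul_comul_haar, slice_tmul_mul, mulLeft_one_comp, hh, mul_zero]
  let b := finBasis ℂ K
  obtain ⟨c, hc⟩ := TensorProduct.eq_repr_basis_left b (comul (R := ℂ) (haar K))
  have h2 : ∀ z i, h (z * c i) = 0 := fun z i => by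
    have := h1 z
    rw [← hc, Finsupp.sum, map_sum] at this
    simp only [slice_tmul, LinearMap.comp_apply, LinearMap.mulLeft_apply] at this
    by_cases hi : i ∈ c.support
    · exact linearIndependent_iff'.1 b.linearIndependent c.support _ this i hi
    · rw [Finsupp.notMem_support_iff.1 hi, mul_zero, map_zero]
  ext z
  have h3 := mul_antipode_rTensor_comul_apply (R := ℂ) (haar K)
  rw [← hc, Finsupp.sum, map_sum, map_sum, counit_haar, map_one] at h3
  rw [← mul_one z, ← h3, Finset.mul_sum, map_sum]
  simp [← mul_assoc, h2]

/-- The inverse Fourier transform: `fourierInv x` is the functional `f` with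
`e₍₁₎ f(e₍₂₎) = x`. -/
def fourierInv : K ≃ₗ[ℂ] Dual ℂ K :=
  (LinearEquiv.ofInjectiveOfFinrankEq fourierAux fourierAux_injective
    Subspace.dual_finrank_eq).symm

@[simp] lemma slice_fourierInv (x : K) :
    slice K (fourierInv x) (comul (R := ℂ) (haar K)) = x :=
  (LinearEquiv.ofInjectiveOfFinrankEq fourierAux fourierAux_injective
    Subspace.dual_finrank_eq).apply_symm_apply x

lemma eq_fourierInv {f : Dual ℂ K} {x : K}
    (h : slice K f (comul (R := ℂ) (haar K)) = x) : f = fourierInv x :=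
  fourierAux_injective (by rw [fourierAux_apply, fourierAux_apply, h, slice_fourierInv])

/-- By uniqueness of f_{xy}, this is the rule e₍₁₎ ⊗ e₍₂₎S(y) = e₍₁₎y ⊗ e₍₂₎. It is the source of
the multiplicativity of the splitting. -/
lemma fourierInv_comp_mulRight (x y : K) :
    fourierInv x ∘ₗ LinearMap.mulRight ℂ (antipode ℂ y) = fourierInv (x * y) := by
  refine eq_fourierInv ?_
  have h := slice_mul_tmul (fourierInv x) (comul (R := ℂ) (haar K)) 1 (antipode ℂ y)
  rw [mul_one] at h
  rw [← h, comul_haar_mul, slice_mul_tmul, mulRight_one_comp, slice_fourierInv]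

lemma counit_slice (f : Dual ℂ K) (x : K) :
    counit (R := ℂ) (slice K f (comul (R := ℂ) x)) = f x := by
  let s := Coalgebra.Repr.arbitrary ℂ x
  conv_rhs => rw [← sum_counit_smul s]
  rw [← s.eq]
  simp [mul_comm]

lemma fourierInv_haar (x : K) : fourierInv x (haar K) = counit (R := ℂ) x := by
  rw [← counit_slice, slice_fourierInv]

lemma star_slice {D : Type*} [Ring D] [StarRing D] [Algebra ℂ D] [StarModule ℂ D]
    (f g : Dual ℂ K) (h : ∀ x, g x = star (f (star x))) (X : D ⊗[ℂ] K) :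
    star (slice D f X) = slice D g (star X) := by
  induction X with
  | zero => simp
  | add X Y hX hY => simp only [star_add, map_add, hX, hY]
  | tmul a y => simp [h]

/-- Uniqueness of the functional, together with self-adjointness of Δ(e). -/
lemma star_fourierInv_star (x z : K) :
    fourierInv (star x) z = star (fourierInv x (star z)) := by
  let g : Dual ℂ K :=
    { toFun z := star (fourierInv x (star z))
      map_add' := by simp
      map_smul' := by simp }
  have h : g = fourierInv (star x) := by
    refine eq_fourierInv ?_
    have h := star_slice (fourierInv x) g (fun _ => rfl) (comul (R := ℂ) (haar K))
    rw [slice_fourierInv, ← star_comul_eq, star_haar] at h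
    exact h.symm
  exact congr($h z).symm

/-- The convolution operator `z ↦ z₍₁₎ f(z₍₂₎)`. -/
def convRight (f : Dual ℂ K) : K →ₗ[ℂ] K := slice K f ∘ₗ comul (R := ℂ)

lemma convRight_apply (f : Dual ℂ K) (z : K) :
    convRight f z = slice K f (comul (R := ℂ) z) := rfl

lemma sum_slice_tmul {D : Type*} [AddCommGroup D] [Module ℂ D] (X : D ⊗[ℂ] K) :
    ∑ i, slice D ((finBasis ℂ K).coord i) X ⊗ₜ[ℂ] finBasis ℂ K i = X := by
  induction X with
  | zero => simp
  | add X Y hX hY => simp only [map_add, TensorProduct.add_tmul, Finset.sum_add_distrib, hX, hY]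
  | tmul f v =>
    simp only [slice_tmul, TensorProduct.smul_tmul, ← TensorProduct.tmul_sum, Basis.coord_apply,
      Basis.sum_repr]

lemma slice_ext {D : Type*} [AddCommGroup D] [Module ℂ D] {X Y : D ⊗[ℂ] K}
    (h : ∀ f : Dual ℂ K, slice D f X = slice D f Y) : X = Y := by
  rw [← sum_slice_tmul X, ← sum_slice_tmul Y]
  simp only [h]

lemma slice_lTensor {D : Type*} [AddCommGroup D] [Module ℂ D] (f : Dual ℂ K) (T : K →ₗ[ℂ] K)
    (X : D ⊗[ℂ] K) : slice D f (T.lTensor D X) = slice D (f ∘ₗ T) X := by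
  induction X with
  | zero => simp
  | add X Y hX hY => simp only [map_add, hX, hY]
  | tmul a y => simp

/-- In Sweedler notation, δ(a₍₀₎) f(a₍₁₎) = a₍₀₎ ⊗ a₍₁₎ f(a₍₂₎). Only coassociativity at the single
element a is needed, so this serves both coactions and Δ itself. -/
lemma apply_slice_of_coassoc {D : Type*} [AddCommGroup D] [Module ℂ D] (δ : D →ₗ[ℂ] D ⊗[ℂ] K)
    {a : D} (h : TensorProduct.assoc ℂ D K K (δ.rTensor K (δ a)) =
      (comul (R := ℂ) (A := K)).lTensor D (δ a)) (f : Dual ℂ K) :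
    δ (slice D f (δ a)) = (convRight f).lTensor D (δ a) := by
  have h1 : ∀ X : D ⊗[ℂ] K, (slice K f).lTensor D (TensorProduct.assoc ℂ D K K (δ.rTensor K X)) =
      δ (slice D f X) := by
    intro X
    induction X with
    | zero => simp
    | add X Y hX hY => simp only [map_add, hX, hY]
    | tmul b x =>
      rw [LinearMap.rTensor_tmul, slice_tmul, map_smul]
      induction δ b with
      | zero => simp
      | add X Y hX hY => simp only [map_add, TensorProduct.add_tmul, smul_add, hX, hY]
      | tmul c y => simp
  rw [← h1, h, convRight, LinearMap.lTensor_comp]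
  rfl

lemma convRight_comp (f g : Dual ℂ K) (z : K) :
    convRight f (convRight g z) = convRight (f ∘ₗ convRight g) z := by
  rw [convRight_apply g, convRight_apply f,
    apply_slice_of_coassoc (comul (R := ℂ)) (Coalgebra.coassoc_apply z), slice_lTensor]
  rfl

/-- Evaluated on the Haar projection, the left side has Fourier transform `convRight f (convRight
(fourierInv x) e)`, and the inner term is x. This compatibility makes the splitting equivariant. -/
lemma comp_convRight_fourierInv (f : Dual ℂ K) (x : K) :
    f ∘ₗ convRight (fourierInv x) = fourierInv (convRight f x) := by
  refine eq_fourierInv ?_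
  rw [← convRight_apply, ← convRight_comp, convRight_apply (fourierInv x), slice_fourierInv]

end CStarHopf
end

/-! ### Slices of B ⊗ H by elements of `K` -/

noncomputable section

namespace DualHopf

open Coalgebra HopfAlgebra CStarHopf Coaction Module

variable {K : Type*} [FinDimCStarHopfAlgebra K]

/-- The slice map `id ⊗ x : M ⊗ H → M` given by the evaluation at an element `x` of `K`. -/
def evalAt (M : Type*) [AddCommGroup M] [Module ℂ M] (x : K) : M ⊗[ℂ] DualHopf K →ₗ[ℂ] M :=
  (TensorProduct.rid ℂ M).toLinearMap ∘ₗ (LinearMap.applyₗ x ∘ₗ toDual.toLinearMap).lTensor M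

section Module

variable {M N : Type*} [AddCommGroup M] [Module ℂ M] [AddCommGroup N] [Module ℂ N]

@[simp] lemma evalAt_tmul (x : K) (m : M) (h : DualHopf K) :
    evalAt M x (m ⊗ₜ h) = h x • m := by
  simp [evalAt]

lemma evalAt_add (x y : K) (X : M ⊗[ℂ] DualHopf K) :
    evalAt M (x + y) X = evalAt M x X + evalAt M y X := by
  induction X with
  | zero => simp
  | add X Y hX hY => simp only [map_add, hX, hY]; abel
  | tmul m h => simp [add_smul]

lemma evalAt_smul (c : ℂ) (x : K) (X : M ⊗[ℂ] DualHopf K) :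
    evalAt M (c • x) X = c • evalAt M x X := by
  induction X with
  | zero => simp
  | add X Y hX hY => simp only [map_add, smul_add, hX, hY]
  | tmul m h => simp [mul_smul]

/-- `evalAt` as a linear map in the element of `K`. -/
def evalAtₗ (X : M ⊗[ℂ] DualHopf K) : K →ₗ[ℂ] M where
  toFun x := evalAt M x X
  map_add' x y := evalAt_add x y X
  map_smul' c x := evalAt_smul c x X

@[simp] lemma evalAtₗ_apply (X : M ⊗[ℂ] DualHopf K) (x : K) : evalAtₗ X x = evalAt M x X := rfl

lemma evalAt_ext {X Y : M ⊗[ℂ] DualHopf K} (h : ∀ x : K, evalAt M x X = evalAt M x Y) : X = Y :=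
  ext_eval h

lemma evalAt_rTensor (φ : M →ₗ[ℂ] N) (x : K) (X : M ⊗[ℂ] DualHopf K) :
    evalAt N x (φ.rTensor (DualHopf K) X) = φ (evalAt M x X) := by
  induction X with
  | zero => simp
  | add X Y hX hY => simp only [map_add, hX, hY]
  | tmul m h => simp

lemma evalAt_comul (x y : K) (h : DualHopf K) : evalAt (DualHopf K) y (comul h) x = h (x * y) := by
  rw [← eval₂_comul]
  induction comul h with
  | zero => simp; rfl
  | add X Y hX hY => simp only [map_add, add_apply, hX, hY]
  | tmul f g => simp [mul_comm]

lemma evalAt_assoc_symm (y : K) (m : M) (Z : DualHopf K ⊗[ℂ] DualHopf K) :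
    evalAt (M ⊗[ℂ] DualHopf K) y ((TensorProduct.assoc ℂ M (DualHopf K) (DualHopf K)).symm
      (m ⊗ₜ Z)) = m ⊗ₜ evalAt (DualHopf K) y Z := by
  induction Z with
  | zero => simp
  | add X Y hX hY => simp only [map_add, TensorProduct.tmul_add, hX, hY]
  | tmul f g => simp

/-- The comultiplication of H is the transpose of the product of K, so cocycle identities for w
become multiplicativity of x ↦ (id ⊗ x)(w). -/
lemma evalAt_evalAt_comul (x y : K) (X : M ⊗[ℂ] DualHopf K) :
    evalAt M x (evalAt (M ⊗[ℂ] DualHopf K) y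
      ((TensorProduct.assoc ℂ M (DualHopf K) (DualHopf K)).symm (comul.lTensor M X))) =
      evalAt M (x * y) X := by
  induction X with
  | zero => simp
  | add X Y hX hY => simp only [map_add, hX, hY]
  | tmul m h => rw [LinearMap.lTensor_tmul, evalAt_assoc_symm, evalAt_tmul, evalAt_tmul, evalAt_comul]

end Module

section Ring

variable {B : Type*} [Ring B] [Algebra ℂ B]

lemma evalAt_mul (X Y : B ⊗[ℂ] DualHopf K) {ι : Type*} {x : K} (r : Coalgebra.Repr ℂ x ι) :
    evalAt B x (X * Y) = ∑ i ∈ r.index, evalAt B (r.left i) X * evalAt B (r.right i) Y := by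
  induction X with
  | zero => simp
  | add X X' hX hX' => simp only [add_mul, map_add, Finset.sum_add_distrib, hX, hX']
  | tmul a h =>
    induction Y with
    | zero => simp
    | add X X' hX hX' => simp only [mul_add, map_add, Finset.sum_add_distrib, hX, hX']
    | tmul b l =>
      simp only [Algebra.TensorProduct.tmul_mul_tmul, evalAt_tmul, mul_apply _ _ r, Finset.sum_smul,
        smul_mul_smul_comm]

@[simp] lemma evalAt_one (x : K) :
    evalAt B x (1 : B ⊗[ℂ] DualHopf K) = counit (R := ℂ) x • 1 := by
  rw [Algebra.TensorProduct.one_def, evalAt_tmul, one_apply]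

lemma evalAt_mul_tmul_one (x : K) (X : B ⊗[ℂ] DualHopf K) (b : B) :
    evalAt B x (X * (b ⊗ₜ 1)) = evalAt B x X * b := by
  induction X with
  | zero => simp
  | add X X' hX hX' => simp only [add_mul, map_add, hX, hX']
  | tmul a h => simp

lemma evalAt_tmul_one_mul (x : K) (X : B ⊗[ℂ] DualHopf K) (b : B) :
    evalAt B x ((b ⊗ₜ 1) * X) = b * evalAt B x X := by
  induction X with
  | zero => simp
  | add X X' hX hX' => simp only [mul_add, map_add, hX, hX']
  | tmul a h => simp

lemma evalAt_star [StarRing B] [StarModule ℂ B] (x : K) (X : B ⊗[ℂ] DualHopf K) :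
    evalAt B x (star X) = star (evalAt B (star (antipode ℂ x)) X) := by
  induction X with
  | zero => simp
  | add X X' hX hX' => simp only [star_add, map_add, hX, hX']
  | tmul a h => simp

/-- `id ⊗ Δ` is multiplicative. -/
lemma assoc_symm_comul_mul (X Y : B ⊗[ℂ] DualHopf K) :
    (TensorProduct.assoc ℂ B (DualHopf K) (DualHopf K)).symm (comul.lTensor B (X * Y)) =
    (TensorProduct.assoc ℂ B (DualHopf K) (DualHopf K)).symm (comul.lTensor B X) *
    (TensorProduct.assoc ℂ B (DualHopf K) (DualHopf K)).symm (comul.lTensor B Y) := by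
  refine evalAt_ext fun y => evalAt_ext fun x => ?_
  let r := Coalgebra.Repr.arbitrary ℂ x
  let s := Coalgebra.Repr.arbitrary ℂ y
  rw [evalAt_evalAt_comul, evalAt_mul _ _ (r.mul s), evalAt_mul _ _ s, map_sum]
  simp only [evalAt_mul _ _ r, evalAt_evalAt_comul]
  exact Finset.sum_product_right _ _ _

lemma assoc_symm_comul_one :
    (TensorProduct.assoc ℂ B (DualHopf K) (DualHopf K)).symm
      (comul.lTensor B (1 : B ⊗[ℂ] DualHopf K)) = 1 := by
  refine evalAt_ext fun y => evalAt_ext fun x => ?_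
  rw [evalAt_evalAt_comul, evalAt_one, evalAt_one, map_smul, evalAt_one, Bialgebra.counit_mul,
    smul_smul, mul_comm]

end Ring

end DualHopf

/-! ### The expectation on a crossed product and the fixed points of the dual coaction -/

namespace Crossed

open Coalgebra HopfAlgebra CStarHopf Coaction Module DualHopf

variable {K : Type*} [FinDimCStarHopfAlgebra K]
variable {D : Type*} [Ring D] [StarRing D] [Algebra ℂ D] [StarModule ℂ D] (δ : Coaction K D)

/-- The linear map `a ⋊ h ↦ h(1) a`. -/
def expect : Crossed δ →ₗ[ℂ] D := evalAt D (1 : K) ∘ₗ (toTensor δ).toLinearMap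

@[simp] lemma expect_mk (a : D) (h : DualHopf K) : expect δ (mk δ a h) = h 1 • a :=
  evalAt_tmul _ _ _

lemma one_apply_one : (1 : DualHopf K) 1 = 1 := by simp

lemma expect_mul_mk_one (b : Crossed δ) (h : DualHopf K) :
    expect δ (b * mk δ 1 h) = h 1 • expect δ b := by
  induction b using Crossed.induction with
  | h0 => simp
  | ha x y hx hy => simp only [add_mul, map_add, smul_add, hx, hy]
  | hm a l =>
    have : (l * h) 1 = l 1 * h 1 := by
      simp [DualHopf.mul_apply', Algebra.TensorProduct.one_def]
    rw [mul_mk_one, expect_mk, expect_mk, this, mul_comm, mul_smul]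

lemma expect_mk_one_mul (a : D) (b : Crossed δ) :
    expect δ (mk δ a 1 * b) = a * expect δ b := by
  induction b using Crossed.induction with
  | h0 => simp
  | ha x y hx hy => simp only [mul_add, map_add, hx, hy]
  | hm c l => rw [mk_one_mul, expect_mk, expect_mk, mul_smul_comm]

/-- The covariance relation of the crossed product is read off here as the action h · a. Identities
in the crossed product are thereby converted into identities for δ. -/
lemma expect_mk_mul_mk_one (h : DualHopf K) (a : D) :
    expect δ (mk δ 1 h * mk δ a 1) = slice D (toDual h) (δ a) := by
  rw [mk_mul_mk', ← Algebra.TensorProduct.one_def, one_mul, mul_one]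
  change evalAt D (1 : K) (rmap D h (δ a)) = _
  induction δ a with
  | zero => simp
  | add X Y hX hY => simp only [map_add, hX, hY]
  | tmul b x => simp

lemma evalAt_dual (y : K) (a : D) (h : DualHopf K) :
    evalAt (Crossed δ) y (δ.dual (mk δ a h)) = mk δ a (evalAt (DualHopf K) y (DualHopf.comul h)) := by
  change evalAt (Crossed δ) y ((Crossed.toTensor δ).symm.toLinearMap.rTensor (DualHopf K)
    ((TensorProduct.assoc ℂ D (DualHopf K) (DualHopf K)).symm (a ⊗ₜ DualHopf.comul h))) = _
  rw [evalAt_rTensor, evalAt_assoc_symm]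
  rfl

/-- Evaluation at 1 is the counit of H, so (E ⊗ id) applied to the dual coaction of b returns b as a
tensor in D ⊗ H. On a fixed point it returns E(b) ⊗ 1. -/
lemma eq_mk_of_dual_eq {b : Crossed δ} (h : δ.dual b = b ⊗ₜ 1) : b = mk δ (expect δ b) 1 := by
  have key : ∀ b : Crossed δ, (expect δ).rTensor (DualHopf K) (δ.dual b) = toTensor δ b := by
    intro b
    refine evalAt_ext fun y => ?_
    rw [evalAt_rTensor]
    induction b using Crossed.induction with
    | h0 => simp
    | ha x y hx hy => simp only [map_add, hx, hy]
    | hm a l =>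
      rw [evalAt_dual, expect_mk, evalAt_comul, one_mul]
      exact (evalAt_tmul _ _ _).symm
  have h1 := key b
  rw [h, LinearMap.rTensor_tmul] at h1
  exact (toTensor δ).injective h1.symm

end Crossed
end

/-! ### The Rohlin projection -/

noncomputable section

namespace Crossed

open Coalgebra HopfAlgebra CStarHopf Coaction Module DualHopf

variable {K : Type*} [FinDimCStarHopfAlgebra K]
variable {D : Type*} [Ring D] [StarRing D] [Algebra ℂ D] [StarModule ℂ D] (δ : Coaction K D)

/-- A unitary that implements the dual coaction on `1 ⋊ H` and satisfies the two cocycle identities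
of an approximately representable coaction yields a projection of the coefficient algebra that
behaves like the Haar projection. -/
theorem exists_projection {w : Crossed δ ⊗[ℂ] DualHopf K} (hw : w ∈ unitary _)
    (h1 : ∀ h, δ.dual (mk δ 1 h) = w * (mk δ 1 h ⊗ₜ[ℂ] 1) * star w)
    (h2 : (w ⊗ₜ[ℂ] (1 : DualHopf K)) *
        (Algebra.TensorProduct.includeLeft : Crossed δ →ₐ[ℂ]
          Crossed δ ⊗[ℂ] DualHopf K).toLinearMap.rTensor (DualHopf K) w *
        (TensorProduct.assoc ℂ (Crossed δ) (DualHopf K) (DualHopf K)).symm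
          (DualHopf.comul.lTensor (Crossed δ) (star w)) = 1)
    (h3 : δ.dual.rTensor (DualHopf K) w * (w ⊗ₜ[ℂ] (1 : DualHopf K)) *
        (TensorProduct.assoc ℂ (Crossed δ) (DualHopf K) (DualHopf K)).symm
          (DualHopf.comul.lTensor (Crossed δ) (star w)) = 1) :
    ∃ p : D, mk δ p 1 = evalAt (Crossed δ) (haar K) w ∧ star p = p ∧
      (p ⊗ₜ[ℂ] (1 : K)) * δ p = p ⊗ₜ haar K ∧ slice D (fourierInv 1) (δ p) = 1 := by
  have hw1 : star w * w = 1 := Unitary.star_mul_self_of_mem hw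
  have hw2 : w * star w = 1 := Unitary.mul_star_self_of_mem hw
  set W : K → Crossed δ := fun x => evalAt (Crossed δ) x w with hW
  set U : K → Crossed δ := fun x => evalAt (Crossed δ) x (star w) with hU
  have hΔ := assoc_symm_comul_mul (star w) w
  rw [hw1, assoc_symm_comul_one] at hΔ
  have cancel : ∀ {X : (Crossed δ ⊗[ℂ] DualHopf K) ⊗[ℂ] DualHopf K},
      X * (TensorProduct.assoc ℂ (Crossed δ) (DualHopf K) (DualHopf K)).symm
          (DualHopf.comul.lTensor (Crossed δ) (star w)) = 1 →
      X = (TensorProduct.assoc ℂ (Crossed δ) (DualHopf K) (DualHopf K)).symm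
          (DualHopf.comul.lTensor (Crossed δ) w) := fun {X} h => left_inv_eq_right_inv h hΔ.symm
  -- Both identities now express (id ⊗ Δ)(w), one through w and its trivial extension, the other
  -- through w and the dual coaction. Comparing them gives `hdual`.
  replace h2 := cancel h2
  replace h3 := cancel h3
  have e2 : ∀ y, w * (W y ⊗ₜ 1) = evalAt _ y
      ((TensorProduct.assoc ℂ (Crossed δ) (DualHopf K) (DualHopf K)).symm
          (DualHopf.comul.lTensor (Crossed δ) w)) := fun y => by
    rw [← h2, evalAt_tmul_one_mul, evalAt_rTensor]
    rfl
  have hmul : ∀ x y, W x * W y = W (x * y) := fun x y => by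
    have h := congr(evalAt (Crossed δ) x $(e2 y))
    rwa [evalAt_mul_tmul_one, evalAt_evalAt_comul] at h
  have hdual : ∀ y, δ.dual (W y) * w = w * (W y ⊗ₜ 1) := fun y => by
    rw [e2, ← h3, evalAt_mul_tmul_one, evalAt_rTensor]
  have hWsmul : ∀ (c : ℂ) x, W (c • x) = c • W x := fun c x => evalAt_smul c x w
  set q := W (haar K) with hq
  -- Slicing at x gives W(x)W(e) = W(xe) = ε(x)q, by multiplicativity of W and absorption.
  have hwq : w * (q ⊗ₜ 1) = q ⊗ₜ 1 := evalAt_ext fun x => by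
    rw [evalAt_mul_tmul_one, evalAt_tmul, one_apply]
    exact (hmul _ _).trans (by rw [mul_haar, hWsmul])
  have hqw : (q ⊗ₜ 1) * w = q ⊗ₜ 1 := evalAt_ext fun x => by
    rw [evalAt_tmul_one_mul, evalAt_tmul, one_apply]
    exact (hmul _ _).trans (by rw [haar_mul, hWsmul])
  have hqw' : (q ⊗ₜ 1) * star w = q ⊗ₜ 1 := by
    rw [← hqw, mul_assoc, hw2, mul_one, hqw]
  have hqU : ∀ x, q * U x = counit (R := ℂ) x • q := fun x => by
    have h := congr(evalAt (Crossed δ) x $hqw')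
    rwa [evalAt_tmul_one_mul, evalAt_tmul, one_apply] at h
  -- Inserting w w* = 1 gives δ̂(q) = w(q ⊗ 1)w* = (q ⊗ 1)w* = q ⊗ 1.
  have hdq : δ.dual q = q ⊗ₜ 1 := by
    rw [← mul_one (δ.dual q), ← hw2, ← mul_assoc, hdual, hwq, hqw']
  have hUe : U (haar K) = star q := by
    simp only [hU, hq, hW]
    rw [evalAt_star, antipode_haar, star_haar]
  -- Here U(e) = q*, because e is self-adjoint and fixed by the antipode. Absorption then reads q q*
  -- = q.
  have hstar : star q = q := by
    have h := hqU (haar K)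
    rw [hUe, counit_haar, one_smul] at h
    rw [← h, star_mul, star_star]
  obtain ⟨p, hp⟩ : ∃ p, q = mk δ p 1 := ⟨_, eq_mk_of_dual_eq δ hdq⟩
  have hmk : Function.Injective fun a : D => mk δ a 1 := fun a b h => by
    simpa using congr(expect δ $h)
  have hcov : ∀ h x, ∀ r : Coalgebra.Repr ℂ x (K × K), W x * mk δ 1 h =
      ∑ i ∈ r.index, mk δ 1 (evalAt (DualHopf K) (r.left i) (DualHopf.comul h)) *
        W (r.right i) := fun h x r => by
    have h4 : w * (mk δ 1 h ⊗ₜ 1) = δ.dual (mk δ 1 h) * w := by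
      rw [h1, mul_assoc _ (star w), hw1, mul_one]
    have h5 := congr(evalAt (Crossed δ) x $h4)
    rw [evalAt_mul_tmul_one, evalAt_mul _ _ r] at h5
    simpa only [evalAt_dual] using h5
  have hcov' : ∀ h x, ∀ r : Coalgebra.Repr ℂ x (K × K), mk δ 1 h * U x =
      ∑ i ∈ r.index, U (r.left i) *
        mk δ 1 (evalAt (DualHopf K) (r.right i) (DualHopf.comul h)) := fun h x r => by
    have h4 : (mk δ 1 h ⊗ₜ 1) * star w = star w * δ.dual (mk δ 1 h) := by
      rw [h1, mul_assoc w, ← mul_assoc (star w), hw1, one_mul]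
    have h5 := congr(evalAt (Crossed δ) x $h4)
    rw [evalAt_tmul_one_mul, evalAt_mul _ _ r] at h5
    simpa only [evalAt_dual] using h5
  -- Moving 1 ⋊ h to the left through W(e) leaves Σ (1 ⋊ h(· e₍₁₎)) W(e₍₂₎)W(e) = (1 ⋊ h(· e)) q,
  -- and h(· e) = h(e)ε is a multiple of the unit of H.
  have hqhq : ∀ h, q * mk δ 1 h * q = h (haar K) • q := fun h => by
    let r := Coalgebra.Repr.arbitrary ℂ (haar K)
    rw [hq, hcov h _ r, Finset.sum_mul]
    simp only [mul_assoc, hmul, mul_haar, hWsmul]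
    have h6 : evalAt (DualHopf K) (haar K) (DualHopf.comul h) = h (haar K) • 1 := by
      ext x
      rw [evalAt_comul, mul_haar, map_smul, smul_eq_mul, DualHopf.smul_apply, one_apply, mul_comm]
    have h7 : evalAt (DualHopf K) (haar K) (DualHopf.comul h) = ∑ i ∈ r.index,
        counit (R := ℂ) (r.right i) • evalAt (DualHopf K) (r.left i) (DualHopf.comul h) := by
      conv_lhs => rw [← sum_counit_right_smul r]
      simp only [← evalAtₗ_apply, map_sum, map_smul]
    have h8 : ∀ (c : ℂ) (l : DualHopf K), mk δ 1 (c • l) = c • mk δ 1 l := fun c l => by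
      rw [mk, TensorProduct.tmul_smul, map_smul]; rfl
    have h9 : ∀ (l : K × K → DualHopf K), mk δ 1 (∑ i ∈ r.index, l i) =
        ∑ i ∈ r.index, mk δ 1 (l i) := fun l => by
      rw [mk, TensorProduct.tmul_sum, map_sum]; rfl
    have h10 : mk δ 1 (h (haar K) • 1) * q = mk δ 1 (∑ i ∈ r.index, counit (R := ℂ) (r.right i) •
        evalAt (DualHopf K) (r.left i) (DualHopf.comul h)) * q := by rw [← h7, h6]
    rw [h9, h8, ← one_def, smul_mul_assoc, one_mul, Finset.sum_mul] at h10
    simpa only [h8, mul_smul_comm, smul_mul_assoc] using h10.symm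
  refine ⟨p, hp.symm, hmk ?_, ?_, ?_⟩
  · change mk δ (star p) 1 = mk δ p 1
    have h := star_mk' δ p 1
    rw [star_one, ← one_def, one_mul] at h
    rw [← h, ← hp, hstar]
  · refine slice_ext fun f => ?_
    have h := congr(expect δ $(hqhq (toDual.symm f)))
    rw [hp, mul_assoc, expect_mk_one_mul, expect_mk_mul_mk_one, map_smul, expect_mk] at h
    rw [slice_tmul_mul, mulLeft_one_comp, slice_tmul]
    simpa using h
  -- Commuting 1 ⋊ f_1 past U(e) = q and taking the expectation turns the slice of δ(p) into Σ
  -- f_1(e₍₂₎) E(U(e₍₁₎)) = E(U(1)), by the defining property of f_1.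
  · have h := congr(expect δ $(hcov' (toDual.symm (fourierInv 1)) (haar K)
      (Coalgebra.Repr.arbitrary ℂ (haar K))))
    rw [hUe, hstar, hp, expect_mk_mul_mk_one, map_sum] at h
    simp only [expect_mul_mk_one, evalAt_comul, one_mul] at h
    -- W(1) is idempotent and has the right inverse U(1), hence W(1) = 1 and U(1) = 1.
    have hU1 : U 1 = 1 := by
      let r : Coalgebra.Repr ℂ (1 : K) Unit := ⟨{()}, fun _ => 1, fun _ => 1, by
        simp [Algebra.TensorProduct.one_def]⟩
      have h4 := congr(evalAt (Crossed δ) (1 : K) $hw2)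
      rw [evalAt_mul _ _ r, evalAt_one] at h4
      simp only [r, Finset.sum_singleton, Bialgebra.counit_one, one_smul] at h4
      change W 1 * U 1 = 1 at h4
      have h5 := hmul 1 1
      rw [mul_one] at h5
      have h6 : W 1 = 1 := by
        rw [← h4]
        nth_rewrite 2 [← h5]
        rw [mul_assoc, h4, mul_one]
      rwa [h6, one_mul] at h4
    have h11 : ∀ Z : K ⊗[ℂ] K, expect δ (U (slice K (fourierInv 1) Z)) =
        TensorProduct.lift ((LinearMap.lsmul ℂ D).flip.compl₁₂ (expect δ ∘ₗ evalAtₗ (star w))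
          (fourierInv 1)) Z := fun Z => by
      induction Z with
      | zero => simp [hU, ← evalAtₗ_apply]
      | add X Y hX hY =>
        simp only [map_add, ← hX, ← hY]
        simp only [hU, ← evalAtₗ_apply, map_add]
      | tmul x y => simp [hU, evalAt_smul]
    have h12 := h11 (comul (R := ℂ) (haar K))
    rw [slice_fourierInv, hU1, one_def, expect_mk, one_apply_one, one_smul,
      ← (Coalgebra.Repr.arbitrary ℂ (haar K)).eq, map_sum] at h12
    exact h.trans h12.symm

end Crossed
end

/-! ### The equivariant splitting defined by a Rohlin projection -/

noncomputable section

namespace Coaction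

open Coalgebra HopfAlgebra CStarHopf Module DualHopf

variable {K : Type*} [FinDimCStarHopfAlgebra K]

lemma slice_add {M : Type*} [AddCommGroup M] [Module ℂ M] (f g : Dual ℂ K) (X : M ⊗[ℂ] K) :
    slice M (f + g) X = slice M f X + slice M g X := by simp [slice]

lemma slice_smul {M : Type*} [AddCommGroup M] [Module ℂ M] (c : ℂ) (f : Dual ℂ K) (X : M ⊗[ℂ] K) :
    slice M (c • f) X = c • slice M f X := by simp [slice]

lemma slice_rTensor {M N : Type*} [AddCommGroup M] [Module ℂ M] [AddCommGroup N] [Module ℂ N]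
    (φ : M →ₗ[ℂ] N) (f : Dual ℂ K) (X : M ⊗[ℂ] K) :
    slice N f (φ.rTensor K X) = φ (slice M f X) :=
  rid_naturality φ f X

variable {D : Type*} [Ring D] [StarRing D] [Algebra ℂ D] [StarModule ℂ D] (δ : Coaction K D)
variable {A : Type*} [Ring A] [StarRing A] [Algebra ℂ A] [StarModule ℂ A] (ρ : Coaction K A)

lemma slice_counit (a : D) : slice D (counit (R := ℂ)) (δ a) = a := δ.counit_comp a

lemma apply_slice (f : Dual ℂ K) (a : D) :
    δ (slice D f (δ a)) = (convRight f).lTensor D (δ a) :=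
  apply_slice_of_coassoc δ.lin (δ.coassoc a) f

/-- `(a₍₀₎ ⊗ a₍₁₎)(1 ⊗ S(a₍₂₎)) = a ⊗ 1`, with the last two legs given by a tensor. -/
lemma lift_mul_antipode (a : A) : TensorProduct.lift (LinearMap.mk₂ ℂ
      (fun (b : A) (x : K) => ρ b * (1 ⊗ₜ[ℂ] antipode ℂ x))
      (fun b c x => by rw [map_add, add_mul]) (fun c b x => by rw [map_smul, smul_mul_assoc])
      (fun b x y => by rw [map_add, TensorProduct.tmul_add, mul_add])
      (fun c b x => by rw [map_smul, TensorProduct.tmul_smul, mul_smul_comm])) (ρ a) =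
      a ⊗ₜ 1 := by
  let T : A ⊗[ℂ] (K ⊗[ℂ] K) →ₗ[ℂ] A ⊗[ℂ] K :=
    (LinearMap.mul' ℂ K ∘ₗ (antipode ℂ).lTensor K).lTensor A
  have h1 : ∀ X : A ⊗[ℂ] K, TensorProduct.lift (LinearMap.mk₂ ℂ
      (fun (b : A) (x : K) => ρ b * (1 ⊗ₜ[ℂ] antipode ℂ x))
      (fun b c x => by rw [map_add, add_mul]) (fun c b x => by rw [map_smul, smul_mul_assoc])
      (fun b x y => by rw [map_add, TensorProduct.tmul_add, mul_add])
      (fun c b x => by rw [map_smul, TensorProduct.tmul_smul, mul_smul_comm])) X =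
      T (TensorProduct.assoc ℂ A K K (ρ.lin.rTensor K X)) := by
    intro X
    induction X with
    | zero => simp
    | add X Y hX hY => simp only [map_add, hX, hY]
    | tmul b x =>
      rw [TensorProduct.lift.tmul, LinearMap.mk₂_apply, LinearMap.rTensor_tmul, lin_apply]
      induction ρ b with
      | zero => simp
      | add X Y hX hY => simp only [map_add, add_mul, TensorProduct.add_tmul, hX, hY]
      | tmul c y => simp [T]
  have h2 : ∀ X : A ⊗[ℂ] K, T ((comul (R := ℂ) (A := K)).lTensor A X) =
      slice A (counit (R := ℂ)) X ⊗ₜ 1 := by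
    intro X
    induction X with
    | zero => simp
    | add X Y hX hY => simp only [map_add, TensorProduct.add_tmul, hX, hY]
    | tmul b x => simp [T, Algebra.algebraMap_eq_smul_one, TensorProduct.smul_tmul]
  have h3 := ρ.coassoc a
  change TensorProduct.assoc ℂ A K K (ρ.lin.rTensor K (ρ a)) =
    (comul (R := ℂ) (A := K)).lTensor A (ρ a) at h3
  rw [h1, h3, h2, slice_counit]

/-- The linear map `a ⊗ x ↦ (id ⊗ f_x)(δ(ι(a) p))`, where `e₍₁₎ f_x(e₍₂₎) = x`. -/
def splitLin (ι : A →⋆ₐ[ℂ] D) (p : D) : A ⊗[ℂ] K →ₗ[ℂ] D :=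
  TensorProduct.lift <| LinearMap.mk₂ ℂ (fun a x => slice D (fourierInv x) (δ (ι a * p)))
    (fun a b x => by rw [map_add, add_mul, map_add, map_add])
    (fun c a x => by rw [map_smul, smul_mul_assoc, map_smul, map_smul])
    (fun a x y => by rw [map_add, slice_add])
    (fun c a x => by rw [map_smul, slice_smul])

lemma splitLin_tmul (ι : A →⋆ₐ[ℂ] D) (p : D) (a : A) (x : K) :
    splitLin δ ι p (a ⊗ₜ x) = slice D (fourierInv x) (δ (ι a * p)) := rfl

/-- Equivariance, in slices: applying δ convolves the functional f_x with f, and by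
`comp_convRight_fourierInv` this is the same as convolving x. -/
lemma slice_splitLin (ι : A →⋆ₐ[ℂ] D) (p : D) (f : Dual ℂ K) (X : A ⊗[ℂ] K) :
    slice D f (δ (splitLin δ ι p X)) = splitLin δ ι p ((convRight f).lTensor A X) := by
  induction X with
  | zero => simp
  | add X Y hX hY => simp only [map_add, hX, hY]
  | tmul a x =>
    rw [splitLin_tmul, apply_slice, slice_lTensor, comp_convRight_fourierInv,
      LinearMap.lTensor_tmul, splitLin_tmul]

lemma coaction_splitLin_tmul (ι : A →⋆ₐ[ℂ] D) (p : D) (a : A) (x : K) :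
    δ (splitLin δ ι p (a ⊗ₜ x)) = (splitLin δ ι p ∘ₗ TensorProduct.mk ℂ A K a).rTensor K
      (comul (R := ℂ) x) := by
  refine slice_ext fun f => ?_
  rw [slice_splitLin, slice_rTensor]
  rfl

section Projection

variable (ι : A →⋆ₐ[ℂ] D) {p : D}

/-- By equivariance, Φ(a ⊗ x) ⊗ 1 = δ(Φ(a ⊗ x₍₁₎))(1 ⊗ S(x₍₂₎)). This brings Φ(a ⊗ x) under δ, where
it can be multiplied by δ(ι(a') p). -/
lemma splitLin_tmul_one_tmul_one (a : A) (x : K) :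
    splitLin δ ι p (a ⊗ₜ x) ⊗ₜ[ℂ] (1 : K) = ∑ i ∈ (Coalgebra.Repr.arbitrary ℂ x).index,
      δ (splitLin δ ι p (a ⊗ₜ (Coalgebra.Repr.arbitrary ℂ x).left i)) *
        (1 ⊗ₜ antipode ℂ ((Coalgebra.Repr.arbitrary ℂ x).right i)) := by
  have h := congr((splitLin δ ι p ∘ₗ TensorProduct.mk ℂ A K a).rTensor K
    $(sum_comul_mul_antipode x (Coalgebra.Repr.arbitrary ℂ x)))
  rw [LinearMap.rTensor_tmul, map_sum] at h
  refine h.symm.trans (Finset.sum_congr rfl fun i _ => ?_)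
  rw [coaction_splitLin_tmul]
  induction comul (R := ℂ) ((Coalgebra.Repr.arbitrary ℂ x).left i) with
  | zero => simp
  | add X Y hX hY => simp only [map_add, add_mul, hX, hY]
  | tmul b y => simp

/-- Since p commutes with ι(b), the relation (p ⊗ 1)δ(p) = p ⊗ e puts e in the K leg. There f_y(e z)
= ε(z)f_y(e) = ε(z)ε(y), and the slice of δ(ι(b)) by the counit is ι(b). -/
lemma mul_splitLin (hcomm : ∀ a, p * ι a = ι a * p)
    (hp : (p ⊗ₜ[ℂ] (1 : K)) * δ p = p ⊗ₜ haar K) (b : A) (y : K) :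
    p * splitLin δ ι p (b ⊗ₜ y) = counit (R := ℂ) y • (ι b * p) := by
  have h := slice_tmul_mul (fourierInv y) (δ (ι b * p)) p 1
  rw [mulLeft_one_comp] at h
  rw [splitLin_tmul, ← h, ← hcomm, map_mul δ.toStarAlgHom, ← mul_assoc, hp, slice_tmul_mul]
  have h1 : fourierInv y ∘ₗ LinearMap.mulLeft ℂ (haar K) =
      counit (R := ℂ) y • counit (R := ℂ) (A := K) := by
    ext z
    simp [haar_mul, fourierInv_haar, mul_comm]
  rw [h1, slice_smul, slice_counit, mul_smul_comm]

/-- Bring the second factor under δ: it becomes δ(ι(a) p Φ(b ⊗ y₍₁₎))(1 ⊗ S(y₍₂₎)). By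
`mul_splitLin`, p Φ(b ⊗ y₍₁₎) is ε(y₍₁₎) ι(b)p, and the remaining S(y) is absorbed through f_x(·
S(y)) = f_{xy}. -/
lemma splitLin_mul_tmul (hcomm : ∀ a, p * ι a = ι a * p)
    (hp : (p ⊗ₜ[ℂ] (1 : K)) * δ p = p ⊗ₜ haar K) (a b : A) (x y : K) :
    splitLin δ ι p ((a ⊗ₜ x) * (b ⊗ₜ y)) =
      splitLin δ ι p (a ⊗ₜ x) * splitLin δ ι p (b ⊗ₜ y) := by
  have h1 := slice_mul_tmul (fourierInv x) (δ (ι a * p)) (splitLin δ ι p (b ⊗ₜ y)) 1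
  rw [mulRight_one_comp] at h1
  rw [splitLin_tmul δ ι p a, ← h1, splitLin_tmul_one_tmul_one, Finset.mul_sum]
  simp only [← mul_assoc, ← map_mul δ.toStarAlgHom]
  simp only [mul_assoc, mul_splitLin δ ι hcomm hp]
  simp only [mul_smul_comm, map_smul, ← mul_assoc, ← map_mul ι, smul_mul_assoc, map_sum]
  simp only [slice_mul_tmul, mul_one, fourierInv_comp_mulRight]
  rw [Algebra.TensorProduct.tmul_mul_tmul, splitLin_tmul]
  conv_lhs => rw [← sum_counit_smul (Coalgebra.Repr.arbitrary ℂ y), Finset.mul_sum, map_sum]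
  generalize δ (ι (a * b) * p) = Z
  induction Z with
  | zero => simp
  | add X Y hX hY => simp only [map_add, smul_add, Finset.sum_add_distrib, hX, hY]
  | tmul d z => simp [Finset.sum_smul, mul_smul]

lemma splitLin_mul (hcomm : ∀ a, p * ι a = ι a * p)
    (hp : (p ⊗ₜ[ℂ] (1 : K)) * δ p = p ⊗ₜ haar K) (X Y : A ⊗[ℂ] K) :
    splitLin δ ι p (X * Y) = splitLin δ ι p X * splitLin δ ι p Y := by
  induction X with
  | zero => simp
  | add X X' hX hX' => simp only [add_mul, map_add, hX, hX']
  | tmul a x =>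
    induction Y with
    | zero => simp
    | add X X' hX hX' => simp only [mul_add, map_add, hX, hX']
    | tmul b y => exact splitLin_mul_tmul δ ι hcomm hp a b x y

lemma splitLin_star (hcomm : ∀ a, p * ι a = ι a * p) (hstar : star p = p) (X : A ⊗[ℂ] K) :
    splitLin δ ι p (star X) = star (splitLin δ ι p X) := by
  induction X with
  | zero => simp
  | add X Y hX hY => simp only [star_add, map_add, hX, hY]
  | tmul a x =>
    rw [TensorProduct.star_tmul, splitLin_tmul, splitLin_tmul,
      star_slice _ _ (star_fourierInv_star x), ← map_star δ.toStarAlgHom, star_mul, hstar,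
      ← map_star ι, hcomm]

lemma splitLin_one (h1 : slice D (fourierInv 1) (δ p) = 1) : splitLin δ ι p 1 = 1 := by
  rw [Algebra.TensorProduct.one_def, splitLin_tmul, map_one ι, one_mul, h1]

/-- As f_x = f_1(· S(x)), the left side is (id ⊗ f_1)(δ(p) · ρ(a₍₀₎)(1 ⊗ S(a₍₁₎))), with ρ read in D
⊗ K. The second factor is ι(a) ⊗ 1, and the slice of δ(p) is 1. -/
lemma splitLin_coaction (hι : ∀ a, mapLeft ι K (ρ a) = δ (ι a))
    (hcomm : ∀ a, p * ι a = ι a * p) (h1 : slice D (fourierInv 1) (δ p) = 1) (a : A) :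
    splitLin δ ι p (ρ a) = ι a := by
  have h2 := congr(slice D (fourierInv 1) (δ p * mapLeft ι K $(lift_mul_antipode ρ a)))
  rw [mapLeft_tmul, slice_mul_tmul, mulRight_one_comp, h1, one_mul] at h2
  rw [← h2]
  induction ρ a with
  | zero => simp
  | add X Y hX hY => simp only [map_add, mul_add, hX, hY]
  | tmul b x =>
    rw [TensorProduct.lift.tmul, LinearMap.mk₂_apply, map_mul (mapLeft ι K), hι, mapLeft_tmul,
      map_one ι, ← mul_assoc, ← map_mul δ.toStarAlgHom, slice_mul_tmul, mul_one,
      fourierInv_comp_mulRight, one_mul, hcomm, splitLin_tmul]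

/-- The equivariant left inverse `A ⊗ K → D` of a coaction given by a Rohlin projection. -/
def splitHom (hcomm : ∀ a, p * ι a = ι a * p) (hp : (p ⊗ₜ[ℂ] (1 : K)) * δ p = p ⊗ₜ haar K)
    (hstar : star p = p) (h1 : slice D (fourierInv 1) (δ p) = 1) : A ⊗[ℂ] K →⋆ₐ[ℂ] D :=
  { AlgHom.ofLinearMap (splitLin δ ι p) (splitLin_one δ ι h1) (splitLin_mul δ ι hcomm hp) with
    map_star' := splitLin_star δ ι hcomm hstar }

end Projection

end Coaction
end

/-! ### Rohlin coactions and the sequence algebra -/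

noncomputable section

namespace Coaction

open Coalgebra HopfAlgebra CStarHopf Module DualHopf Crossed
open scoped BoundedContinuousFunction
open Filter Topology

variable {K : Type*} [FinDimCStarHopfAlgebra K] {A : Type*} [CStarAlgebra A]

lemma slice_apply_seq (g : Dual ℂ K) (Z : (ℕ →ᵇ A) ⊗[ℂ] K) (n : ℕ) :
    slice (ℕ →ᵇ A) g Z n = slice A g (mapLeft (evₐ A n) K Z) := by
  rw [mapLeft_eq, slice_rTensor]
  rfl

lemma slice_infty_mk (ρ : Coaction K A) (g : Dual ℂ K) (f : ℕ →ᵇ A) :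
    slice (SeqAlg A) g (ρ.infty (SeqAlg.mk A f)) = SeqAlg.mk A (ρ.sliceSeq g f) := by
  rw [infty_mk, mapLeft_eq, slice_rTensor]
  refine congrArg (SeqAlg.mk A) ?_
  ext n
  rw [slice_apply_seq, mapLeft_eq, ev_seqHom, sliceSeq_apply]

lemma mapLeft_const (ρ : Coaction K A) (a : A) :
    mapLeft (SeqAlg.const A) K (ρ a) = ρ.infty (SeqAlg.const A a) := by
  refine slice_ext fun g => ?_
  have h : SeqAlg.const A a = SeqAlg.mk A (BoundedContinuousFunction.const ℕ a) := rfl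
  rw [h, slice_infty_mk, mapLeft_eq, slice_rTensor]
  rfl

lemma crossedConst_mk (ρ : Coaction K A) (a : A) (h : DualHopf K) :
    ρ.crossedConst (Crossed.mk ρ a h) = Crossed.mk ρ.infty (SeqAlg.const A a) h := rfl

/-- Covariance of w on 1 ⋊ H produces the projection. Covariance on A ⋊ 1, whose elements are fixed
by the dual coaction, makes w, and hence its slice at the Haar projection, commute with A. -/
lemma IsRohlin.exists_projection {ρ : Coaction K A} (hρ : ρ.IsRohlin) :
    ∃ p : SeqAlg A, star p = p ∧ (∀ a, p * SeqAlg.const A a = SeqAlg.const A a * p) ∧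
      (p ⊗ₜ[ℂ] (1 : K)) * ρ.infty p = p ⊗ₜ haar K ∧
      slice (SeqAlg A) (fourierInv 1) (ρ.infty p) = 1 := by
  obtain ⟨w, hw, h1, h2, h3⟩ := hρ
  have hdual : ∀ a h, ρ.crossedConst.rTensor (DualHopf K) (ρ.dual (Crossed.mk ρ a h)) =
      ρ.infty.dual (Crossed.mk ρ.infty (SeqAlg.const A a) h) := fun a h => by
    refine evalAt_ext fun x => ?_
    rw [evalAt_rTensor, evalAt_dual, evalAt_dual, crossedConst_mk]
  obtain ⟨p, hp, hstar, hp1, hp2⟩ := Crossed.exists_projection ρ.infty hw (fun h => by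
    have := h1 (Crossed.mk ρ 1 h)
    rwa [hdual, crossedConst_mk, map_one] at this) h2 h3
  refine ⟨p, hstar, fun a => ?_, hp1, hp2⟩
  have h4 := h1 (Crossed.mk ρ a 1)
  rw [crossedConst_mk, hdual] at h4
  have h5 : w * (Crossed.mk ρ.infty (SeqAlg.const A a) 1 ⊗ₜ 1) =
      (Crossed.mk ρ.infty (SeqAlg.const A a) 1 ⊗ₜ 1) * w := by
    have h6 : ρ.infty.dual (Crossed.mk ρ.infty (SeqAlg.const A a) 1) =
        Crossed.mk ρ.infty (SeqAlg.const A a) 1 ⊗ₜ 1 := by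
      refine evalAt_ext fun x => ?_
      have h7 : evalAt (DualHopf K) x (DualHopf.comul (1 : DualHopf K)) =
          counit (R := ℂ) x • 1 := by
        ext y
        rw [evalAt_comul, one_apply, Bialgebra.counit_mul, DualHopf.smul_apply, one_apply, mul_comm]
      rw [evalAt_dual, evalAt_tmul, one_apply, h7, Crossed.mk, TensorProduct.tmul_smul, map_smul]
      rfl
    rw [h6] at h4
    conv_rhs => rw [h4, mul_assoc _ (star w), Unitary.star_mul_self_of_mem hw, mul_one]
  have h8 := congr(evalAt (Crossed ρ.infty) (haar K) $h5)
  rw [evalAt_mul_tmul_one, evalAt_tmul_one_mul, ← hp, mk_one_mul, mk_one_mul] at h8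
  simpa using congr(expect ρ.infty $h8)

/-- A norm on `A ⊗ K`: the sum of the norms of the components in a basis of `K`. -/
def sliceNorm (X : A ⊗[ℂ] K) : ℝ := ∑ i, ‖slice A ((finBasis ℂ K).coord i) X‖

lemma sliceNorm_nonneg (X : A ⊗[ℂ] K) : 0 ≤ sliceNorm X :=
  Finset.sum_nonneg fun _ _ => norm_nonneg _

/-- A coaction with the Rohlin property has an equivariant left inverse with values in the sequence
algebra. -/
theorem IsRohlin.exists_splitting {ρ : Coaction K A} (hρ : ρ.IsRohlin) :
    ∃ (Φ : A ⊗[ℂ] K →⋆ₐ[ℂ] SeqAlg A) (C : ℝ), 0 ≤ C ∧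
      (∀ X, ∃ f : ℕ →ᵇ A, SeqAlg.mk A f = Φ X ∧ ‖f‖ ≤ C * sliceNorm X) ∧
      (∀ a, Φ (ρ a) = SeqAlg.const A a) ∧
      ∀ X g, slice (SeqAlg A) g (ρ.infty (Φ X)) = Φ ((convRight g).lTensor A X) := by
  obtain ⟨p, hstar, hcomm, hp, h1⟩ := hρ.exists_projection
  obtain ⟨P, rfl⟩ := SeqAlg.mkₐ_surjective p
  let C : Fin (finrank ℂ K) → ℝ := fun i =>
    |(exists_bound ρ.toStarAlgHom (fourierInv (finBasis ℂ K i))).choose|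
  have hC : ∀ i a, ‖slice A (fourierInv (finBasis ℂ K i)) (ρ a)‖ ≤ C i * ‖a‖ := fun i a =>
    ((exists_bound ρ.toStarAlgHom (fourierInv (finBasis ℂ K i))).choose_spec a).trans
      (mul_le_mul_of_nonneg_right (le_abs_self _) (norm_nonneg _))
  have hC0 : ∀ i, 0 ≤ C i := fun i => abs_nonneg _
  refine ⟨splitHom ρ.infty (SeqAlg.const A) hcomm hp hstar h1, (∑ i, C i) * ‖P‖,
    mul_nonneg (Finset.sum_nonneg fun i _ => hC0 i) (norm_nonneg _), fun X => ?_,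
    splitLin_coaction ρ.infty ρ (SeqAlg.const A) (mapLeft_const ρ) hcomm h1,
    fun X g => slice_splitLin ρ.infty (SeqAlg.const A) _ g X⟩
  -- For X = Σ a_i ⊗ b_i in the chosen basis, Φ(X) = Σ (id ⊗ f_{b_i})(ρ^∞(a_i p)). Computing this
  -- termwise from a representative P of p lifts it with norm controlled by ‖P‖ and finitely many
  -- slice bounds.
  refine ⟨∑ i, ρ.sliceSeq (fourierInv (finBasis ℂ K i))
    (BoundedContinuousFunction.const ℕ (slice A ((finBasis ℂ K).coord i) X) * P), ?_, ?_⟩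
  · rw [map_sum]
    simp only [← slice_infty_mk, map_mul (SeqAlg.mk A)]
    conv_rhs => rw [← sum_slice_tmul X, map_sum]
    refine Finset.sum_congr rfl fun i _ => ?_
    rfl
  · refine (BoundedContinuousFunction.norm_le ?_).2 fun n => ?_
    · exact mul_nonneg (mul_nonneg (Finset.sum_nonneg fun i _ => hC0 i) (norm_nonneg _))
        (sliceNorm_nonneg X)
    rw [BoundedContinuousFunction.coe_sum, Finset.sum_apply, Finset.sum_mul, Finset.sum_mul]
    refine (norm_sum_le _ _).trans (Finset.sum_le_sum fun i _ => ?_)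
    rw [sliceSeq_apply, mul_assoc]
    refine (hC i _).trans (mul_le_mul_of_nonneg_left ?_ (hC0 i))
    rw [mul_comm ‖P‖]
    refine (norm_mul_le _ _).trans (mul_le_mul ?_ (P.norm_coe_le_norm n) (norm_nonneg _)
      (sliceNorm_nonneg X))
    exact Finset.single_le_sum (f := fun i => ‖slice A ((finBasis ℂ K).coord i) X‖)
      (fun _ _ => norm_nonneg _) (Finset.mem_univ i)

end Coaction
end

/-! ### Perturbing almost unitaries to unitaries -/

noncomputable section

namespace CStarAlgebra

variable {A : Type*} [CStarAlgebra A]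

/-- An almost unitary element of a unital C*-algebra is close to a unitary. -/
lemma exists_unitary_norm_sub_le {u : A} {d : ℝ} (hd : d < 1) (h1 : ‖star u * u - 1‖ ≤ d)
    (h2 : ‖u * star u - 1‖ ≤ d) : ∃ w ∈ unitary A, ‖w - u‖ ≤ d := by
  set h := star u * u with hh
  have hsa : IsSelfAdjoint h := IsSelfAdjoint.star_mul_self u
  have hunit : ∀ x : A, ‖x - 1‖ ≤ d → IsUnit x := fun x hx => by
    have := (Units.oneSub (1 - x) (by rw [norm_sub_rev]; exact hx.trans_lt hd)).isUnit
    simpa using this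
  have hd0 : 0 ≤ d := (norm_nonneg _).trans h1
  have hsp : ∀ t ∈ spectrum ℝ h, |t - 1| ≤ d := fun t ht => by
    have e : cfc (fun t : ℝ => t - 1) h = h - 1 := by
      rw [cfc_sub (fun t : ℝ => t) (fun _ => 1) h, cfc_id' ℝ h, cfc_const_one ℝ h]
    have := norm_apply_le_norm_cfc (fun t : ℝ => t - 1) h ht
    rw [e] at this
    exact this.trans h1
  have hpos : ∀ t ∈ spectrum ℝ h, 0 < t := fun t ht => by
    have := abs_le.1 (hsp t ht)
    linarith
  set s := cfc (fun t : ℝ => √t) h with hs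
  -- The unitary is the polar part u h^(-1/2) of u, where h = u*u has spectrum within d < 1 of 1.
  set g := cfc (fun t : ℝ => (√t)⁻¹) h with hg
  have hcg : ContinuousOn (fun t : ℝ => (√t)⁻¹) (spectrum ℝ h) :=
    Real.continuous_sqrt.continuousOn.inv₀ fun t ht => (Real.sqrt_pos.2 (hpos t ht)).ne'
  have hgs : g * s = 1 := by
    rw [hs, hg, ← cfc_mul _ _ h hcg, ← cfc_const_one ℝ h]
    exact cfc_congr fun t ht => inv_mul_cancel₀ (Real.sqrt_pos.2 (hpos t ht)).ne'
  have hsg : s * g = 1 := by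
    rw [hs, hg, ← cfc_mul _ _ h Real.continuous_sqrt.continuousOn hcg, ← cfc_const_one ℝ h]
    exact cfc_congr fun t ht => mul_inv_cancel₀ (Real.sqrt_pos.2 (hpos t ht)).ne'
  have hss : s * s = h := by
    rw [hs, ← cfc_mul _ _ h]
    conv_rhs => rw [← cfc_id' ℝ h]
    exact cfc_congr fun t ht => Real.mul_self_sqrt (hpos t ht).le
  have hgstar : star g = g := (cfc_predicate (R := ℝ) (p := IsSelfAdjoint) _ h)
  have hw1 : star (u * g) * (u * g) = 1 := by
    rw [star_mul, hgstar, mul_assoc, ← mul_assoc (star u), ← hh, ← hss, mul_assoc s, hsg, mul_one,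
      hgs]
  -- Closeness of u*u to 1 only makes u g an isometry. A right inverse comes from invertibility of u
  -- u*.
  have hw : u * g ∈ unitary A := by
    obtain ⟨b, hb⟩ := (hunit _ h2).exists_right_inv
    have hw2 : u * g * (s * star u * b) = 1 := by
      rw [← hb, mul_assoc s, mul_assoc u g, ← mul_assoc g, hgs, one_mul, mul_assoc]
    exact Unitary.mem_iff.2 ⟨hw1, by rw [left_inv_eq_right_inv hw1 hw2, hw2]⟩
  refine ⟨u * g, hw, ?_⟩
  have e : u * g - u = u * g * (1 - s) := by
    rw [mul_sub, mul_one, mul_assoc, hgs, mul_one]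
  rw [e, CStarRing.norm_mem_unitary_mul _ hw]
  have e2 : 1 - s = cfc (fun t : ℝ => 1 - √t) h := by
    rw [cfc_sub (fun _ : ℝ => (1 : ℝ)) (fun t => √t) h, cfc_const_one ℝ h]
  rw [e2]
  refine norm_cfc_le hd0 fun t ht => ?_
  -- Since 1 + √t ≥ 1, this gives |1 - √t| ≤ |t - 1|, so the polar correction costs no more than d.
  have h3 : |1 - √t| * (1 + √t) = |t - 1| := by
    have h4 : |1 + √t| = 1 + √t := abs_of_pos (by positivity)
    rw [← h4, ← abs_mul, abs_sub_comm t]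
    congr 1
    linear_combination -Real.mul_self_sqrt (hpos t ht).le
  rw [Real.norm_eq_abs]
  refine le_trans ?_ (hsp t ht)
  rw [← h3]
  nlinarith [abs_nonneg (1 - √t), Real.sqrt_nonneg t]

end CStarAlgebra
end

/-! ### Pointwise limits of inner automorphisms -/

noncomputable section

namespace CStarAlgebra

open Filter Topology

variable {A : Type*} [CStarAlgebra A]

lemma norm_unitary_conj (x : unitary A) (a : A) : ‖(x : A) * a * star (x : A)‖ = ‖a‖ := by
  rw [CStarRing.norm_mul_mem_unitary _ (Unitary.star_mem x.2), CStarRing.norm_mem_unitary_mul _ x.2]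

lemma norm_unitary_conj_sub (x : unitary A) (a b : A) :
    ‖(x : A) * a * star (x : A) - x * b * star (x : A)‖ = ‖a - b‖ := by
  rw [← norm_unitary_conj x (a - b), mul_sub, sub_mul]

lemma unitary_conj_star_conj (x : unitary A) (a : A) :
    (x : A) * (star (x : A) * a * x) * star (x : A) = a := by
  have := Unitary.mul_star_self_of_mem x.2
  calc (x : A) * (star (x : A) * a * x) * star (x : A)
      = (x * star (x : A)) * a * (x * star (x : A)) := by simp only [mul_assoc]
    _ = a := by rw [this, one_mul, mul_one]

lemma unitary_star_conj_conj (x : unitary A) (a : A) :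
    star (x : A) * ((x : A) * a * star (x : A)) * x = a := by
  simpa using unitary_conj_star_conj (star x) a

/-- The geometric bound for d_i starts only at n = i, so the sequence is shifted by i. Density and
isometry of conjugation extend the Cauchy property to every a. -/
lemma cauchySeq_conj {x : ℕ → unitary A} {d : ℕ → A} (hd : DenseRange d) {B : ℝ}
    (h : ∀ i n, i ≤ n → ‖(x (n + 1) : A) * d i * star (x (n + 1) : A) -
      x n * d i * star (x n : A)‖ ≤ B * (1 / 2) ^ n) (a : A) :
    CauchySeq fun n => (x n : A) * a * star (x n : A) := by
  have h1 : ∀ i, CauchySeq fun n => (x n : A) * d i * star (x n : A) := fun i => by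
    refine (cauchySeq_shift i).1 (cauchySeq_of_le_geometric (1 / 2) (B * (1 / 2) ^ i)
      (by norm_num) fun n => ?_)
    rw [dist_eq_norm, norm_sub_rev, mul_assoc B, ← pow_add, add_comm i n, add_right_comm n 1 i]
    exact h i (n + i) (Nat.le_add_left _ _)
  refine Metric.cauchySeq_iff'.2 fun ε hε => ?_
  obtain ⟨i, hi⟩ := hd.exists_dist_lt a (show 0 < ε / 3 by positivity)
  obtain ⟨N, hN⟩ := Metric.cauchySeq_iff'.1 (h1 i) (ε / 3) (by positivity)
  refine ⟨N, fun n hn => ?_⟩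
  have h2 := hN n hn
  have h3 : ∀ m, dist ((x m : A) * a * star (x m : A)) (x m * d i * star (x m : A)) < ε / 3 :=
    fun m => by rwa [dist_eq_norm, norm_unitary_conj_sub, ← dist_eq_norm]
  have h4 := h3 N
  rw [dist_comm] at h4
  linarith [h3 n, dist_triangle4 ((x n : A) * a * star (x n : A)) (x n * d i * star (x n : A))
    (x N * d i * star (x N : A)) (x N * a * star (x N : A))]

lemma exists_limit_conj {x : ℕ → unitary A}
    (h : ∀ a, CauchySeq fun n => (x n : A) * a * star (x n : A)) :
    ∃ φ : A →⋆ₐ[ℂ] A, ∀ a, Tendsto (fun n => (x n : A) * a * star (x n : A)) atTop (𝓝 (φ a)) := by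
  choose f hf using fun a => cauchySeq_tendsto_of_complete (h a)
  refine ⟨{ toFun := f, map_one' := ?_, map_mul' := fun a b => ?_, map_zero' := ?_,
            map_add' := fun a b => ?_, commutes' := fun c => ?_, map_star' := fun a => ?_ }, hf⟩
  · refine tendsto_nhds_unique (hf 1) (tendsto_const_nhds.congr fun n => ?_)
    simp
  · refine tendsto_nhds_unique (hf (a * b)) (((hf a).mul (hf b)).congr fun n => ?_)
    have := Unitary.coe_star_mul_self (x n)
    calc _ = (x n : A) * a * (star (x n : A) * x n) * b * star (x n : A) := by
          simp only [mul_assoc]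
      _ = _ := by rw [this, mul_one, mul_assoc (x n : A)]
  · refine tendsto_nhds_unique (hf 0) (tendsto_const_nhds.congr fun n => ?_)
    simp
  · refine tendsto_nhds_unique (hf (a + b)) (((hf a).add (hf b)).congr fun n => ?_)
    rw [mul_add, add_mul]
  · refine tendsto_nhds_unique (hf _) (tendsto_const_nhds.congr fun n => ?_)
    rw [← Algebra.commutes, mul_assoc, Unitary.mul_star_self_of_mem (x n).2, mul_one]
  · refine tendsto_nhds_unique (hf (star a)) (((hf a).star).congr fun n => ?_)
    simp [mul_assoc]

lemma tendsto_conj {x : ℕ → unitary A} {φ : A → A}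
    (h : ∀ a, Tendsto (fun n => (x n : A) * a * star (x n : A)) atTop (𝓝 (φ a)))
    {b : ℕ → A} {c : A} (hb : Tendsto b atTop (𝓝 c)) :
    Tendsto (fun n => (x n : A) * b n * star (x n : A)) atTop (𝓝 (φ c)) := by
  have h1 : Tendsto (fun n => (x n : A) * b n * star (x n : A) - x n * c * star (x n : A))
      atTop (𝓝 0) := by
    rw [tendsto_zero_iff_norm_tendsto_zero]
    simp only [norm_unitary_conj_sub]
    exact tendsto_iff_norm_sub_tendsto_zero.1 hb
  simpa using h1.add (h c)

/-- Convergence of Ad(x_n) alone yields only an endomorphism. The second estimate makes Ad(x_n*)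
converge as well, and its limit is the inverse. -/
lemma exists_limit_conj_equiv {x : ℕ → unitary A} {d : ℕ → A} (hd : DenseRange d) {B : ℝ}
    (h : ∀ i n, i ≤ n → ‖(x (n + 1) : A) * d i * star (x (n + 1) : A) -
      x n * d i * star (x n : A)‖ ≤ B * (1 / 2) ^ n)
    (h' : ∀ i n, i ≤ n → ‖star (x (n + 1) : A) * d i * x (n + 1) -
      star (x n : A) * d i * x n‖ ≤ B * (1 / 2) ^ n) :
    ∃ θ : A ≃⋆ₐ[ℂ] A,
      (∀ a, Tendsto (fun n => (x n : A) * a * star (x n : A)) atTop (𝓝 (θ a))) ∧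
      ∀ a, Tendsto (fun n => star (x n : A) * a * x n) atTop (𝓝 (θ.symm a)) := by
  obtain ⟨φ, hφ⟩ := exists_limit_conj (cauchySeq_conj hd h)
  obtain ⟨ψ, hψ⟩ := exists_limit_conj (x := fun n => star (x n))
    (cauchySeq_conj hd (by simpa using h'))
  have h1 : ∀ a, φ (ψ a) = a := fun a => by
    refine tendsto_nhds_unique (tendsto_conj hφ (hψ a)) (tendsto_const_nhds.congr fun n => ?_)
    simpa using (unitary_conj_star_conj (x n) a).symm
  have h2 : ∀ a, ψ (φ a) = a := fun a => by
    refine tendsto_nhds_unique (tendsto_conj hψ (hφ a)) (tendsto_const_nhds.congr fun n => ?_)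
    simpa using (unitary_star_conj_conj (x n) a).symm
  refine ⟨StarAlgEquiv.ofStarAlgHom φ ψ (StarAlgHom.ext h2) (StarAlgHom.ext h1), hφ, ?_⟩
  simpa using hψ

end CStarAlgebra
end

/-! ### Two-sided approximate intertwining -/

noncomputable section

namespace CStarAlgebra

open Filter Topology

variable {A : Type*} [CStarAlgebra A] {I : Type*} [Fintype I]

/-- The distance at `a` of the families `Ad(x) ∘ r ∘ Ad(x⋆)` and `Ad(y) ∘ s ∘ Ad(y⋆)`. -/
def conjDist (r s : I → A → A) (x y : A) (a : A) : ℝ :=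
  ∑ i, ‖x * r i (star x * a * x) * star x - y * s i (star y * a * y) * star y‖

lemma conjDist_comm (r s : I → A → A) (x y : A) (a : A) :
    conjDist r s x y a = conjDist s r y x a :=
  Finset.sum_congr rfl fun _ _ => norm_sub_rev _ _

/-- Any unitary conjugate of `r` can be conjugated close to any unitary conjugate of `s`, by a
unitary that almost commutes with the elements on which the two conjugates are close. -/
def HasIntertwiners (r s : I → A → A) (C : ℝ) : Prop :=
  ∀ (x y : unitary A) (F : Finset A) (η : ℝ), 0 < η → ∃ x' : unitary A, ∀ a ∈ F,
    conjDist r s x' y a ≤ η ∧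
    ‖(x' : A) * (star (x : A) * a * x) * star (x' : A) - a‖ ≤ C * conjDist r s x y a + η

/-- The state of the two-sided intertwining argument after `n` steps. -/
def IntertwiningState (r s : I → A → A) (d : ℕ → A) (n : ℕ) (z : unitary A × unitary A) : Prop :=
  ∀ i ≤ n, conjDist r s z.1 z.2 (d i) ≤ (1 / 2) ^ n ∧
    conjDist r s z.1 z.2 (z.2 * d i * star (z.2 : A)) ≤ (1 / 2) ^ n

lemma norm_sub_of_almost_commute {x x' : unitary A} {a : A} {η : ℝ}
    (h : ‖(x' : A) * (star (x : A) * a * x) * star (x' : A) - a‖ ≤ η) :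
    ‖star (x' : A) * a * x' - star (x : A) * a * x‖ ≤ η := by
  have h1 := norm_unitary_conj_sub x' (star (x' : A) * a * x') (star (x : A) * a * x)
  rw [unitary_conj_star_conj, norm_sub_rev] at h1
  rwa [← h1]

lemma norm_sub_of_almost_commute' {x x' : unitary A} {a : A} {η : ℝ}
    (h : ‖(x' : A) * (star (x : A) * (x * a * star (x : A)) * x) * star (x' : A) -
      x * a * star (x : A)‖ ≤ η) :
    ‖(x' : A) * a * star (x' : A) - x * a * star (x : A)‖ ≤ η := by
  rwa [unitary_star_conj_conj] at h

/-- First y is corrected to y' against x, then x to x' against y'. Each correction almost commutes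
with the elements on which the two conjugated families were already close, which bounds the change
of both Ad and its inverse on d_i. The tolerance 2^(-n-1) is that of the next state. -/
lemma IntertwiningState.exists_succ {r s : I → A → A} {C : ℝ} (hC : 0 ≤ C)
    (hrs : HasIntertwiners r s C) (hsr : HasIntertwiners s r C) {d : ℕ → A} {n : ℕ}
    {z : unitary A × unitary A} (hz : IntertwiningState r s d n z) :
    ∃ z' : unitary A × unitary A, IntertwiningState r s d (n + 1) z' ∧ ∀ i ≤ n,
      (‖(z'.1 : A) * d i * star (z'.1 : A) - z.1 * d i * star (z.1 : A)‖ ≤ (C + 1) * (1 / 2) ^ n ∧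
      ‖star (z'.1 : A) * d i * z'.1 - star (z.1 : A) * d i * z.1‖ ≤ (C + 1) * (1 / 2) ^ n) ∧
      ‖(z'.2 : A) * d i * star (z'.2 : A) - z.2 * d i * star (z.2 : A)‖ ≤ (C + 1) * (1 / 2) ^ n ∧
      ‖star (z'.2 : A) * d i * z'.2 - star (z.2 : A) * d i * z.2‖ ≤ (C + 1) * (1 / 2) ^ n := by
  classical
  obtain ⟨x, y⟩ := z
  have hη : (0 : ℝ) < (1 / 2) ^ (n + 1) := by positivity
  have hη' : (1 / 2 : ℝ) ^ (n + 1) ≤ (1 / 2) ^ n :=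
    pow_le_pow_of_le_one (by norm_num) (by norm_num) (Nat.le_succ n)
  have hbound : ∀ t : ℝ, t ≤ (1 / 2) ^ n → C * t + (1 / 2) ^ (n + 1) ≤ (C + 1) * (1 / 2) ^ n :=
    fun t ht => by nlinarith
  let R := Finset.range (n + 2)
  obtain ⟨y', hy'⟩ := hsr y x (R.image d ∪ R.image (fun i => y * d i * star (y : A)) ∪
    R.image (fun i => x * d i * star (x : A))) _ hη
  obtain ⟨x', hx'⟩ := hrs x y' (R.image d ∪ R.image (fun i => y' * d i * star (y' : A)) ∪
    R.image (fun i => x * d i * star (x : A))) _ hη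
  have hR : ∀ i ≤ n + 1, i ∈ R := fun i hi => Finset.mem_range.2 (by omega)
  have y1 := fun i (hi : i ≤ n + 1) => hy' (d i) (Finset.mem_union_left _
    (Finset.mem_union_left _ (Finset.mem_image_of_mem d (hR i hi))))
  have y2 := fun i (hi : i ≤ n + 1) => hy' (y * d i * star (y : A)) (Finset.mem_union_left _
    (Finset.mem_union_right _ (Finset.mem_image_of_mem (fun i => y * d i * star (y : A)) (hR i hi))))
  have y3 := fun i (hi : i ≤ n + 1) => hy' (x * d i * star (x : A)) (Finset.mem_union_right _
    (Finset.mem_image_of_mem (fun i => x * d i * star (x : A)) (hR i hi)))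
  have x1 := fun i (hi : i ≤ n + 1) => hx' (d i) (Finset.mem_union_left _
    (Finset.mem_union_left _ (Finset.mem_image_of_mem d (hR i hi))))
  have x2 := fun i (hi : i ≤ n + 1) => hx' (y' * d i * star (y' : A)) (Finset.mem_union_left _
    (Finset.mem_union_right _
      (Finset.mem_image_of_mem (fun i => y' * d i * star (y' : A)) (hR i hi))))
  have x3 := fun i (hi : i ≤ n + 1) => hx' (x * d i * star (x : A)) (Finset.mem_union_right _
    (Finset.mem_image_of_mem (fun i => x * d i * star (x : A)) (hR i hi)))
  refine ⟨(x', y'), fun i hi => ⟨(x1 i hi).1, (x2 i hi).1⟩, fun i hi => ?_⟩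
  have hi' : i ≤ n + 1 := hi.trans (Nat.le_succ n)
  refine ⟨⟨?_, ?_⟩, ?_, ?_⟩
  · refine norm_sub_of_almost_commute' ((x3 i hi').2.trans (hbound _ ?_))
    rw [conjDist_comm]
    exact (y3 i hi').1.trans hη'
  · refine norm_sub_of_almost_commute ((x1 i hi').2.trans (hbound _ ?_))
    rw [conjDist_comm]
    exact (y1 i hi').1.trans hη'
  · refine norm_sub_of_almost_commute' ((y2 i hi').2.trans (hbound _ ?_))
    rw [conjDist_comm]
    exact (hz i hi).2
  · refine norm_sub_of_almost_commute ((y1 i hi').2.trans (hbound _ ?_))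
    rw [conjDist_comm]
    exact (hz i hi).1

/-- A two-sided approximate intertwining argument. -/
theorem exists_isApproxInner_intertwining [TopologicalSpace.SeparableSpace A] {r s : I → A → A}
    (hr : ∀ i, Continuous (r i)) (hs : ∀ i, Continuous (s i)) {C : ℝ} (hC : 0 ≤ C)
    (hrs : HasIntertwiners r s C) (hsr : HasIntertwiners s r C) :
    ∃ θ : A ≃⋆ₐ[ℂ] A, IsApproxInner θ ∧ ∀ i a, s i (θ a) = θ (r i a) := by
  let d := TopologicalSpace.denseSeq A
  have hd : DenseRange d := TopologicalSpace.denseRange_denseSeq A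
  obtain ⟨z0, hz0⟩ : ∃ z, IntertwiningState r s d 0 z := by
    obtain ⟨x, hx⟩ := hrs 1 1 {d 0} 1 one_pos
    -- With y = 1 the two clauses of the state coincide, and the tolerance (1/2)^0 is 1.
    refine ⟨(x, 1), fun i hi => ?_⟩
    obtain rfl : i = 0 := by omega
    have := (hx (d 0) (Finset.mem_singleton_self _)).1
    simpa using this
  choose! next hnext using fun n z => IntertwiningState.exists_succ hC hrs hsr (d := d) (n := n)
    (z := z)
  let z : ℕ → unitary A × unitary A := fun n => Nat.rec z0 next n
  have hz : ∀ n, IntertwiningState r s d n (z n) := fun n => by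
    induction n with
    | zero => exact hz0
    | succ n ih => exact (hnext n (z n) ih).1
  have hs' := fun n => (hnext n (z n) (hz n)).2
  obtain ⟨θ, hθ, hθ'⟩ := exists_limit_conj_equiv (x := fun n => (z n).1) hd
    (fun i n hi => (hs' n i hi).1.1) (fun i n hi => (hs' n i hi).1.2)
  obtain ⟨κ, hκ, hκ'⟩ := exists_limit_conj_equiv (x := fun n => (z n).2) hd
    (fun i n hi => (hs' n i hi).2.1) (fun i n hi => (hs' n i hi).2.2)
  have cont : ∀ φ : A ≃⋆ₐ[ℂ] A, Continuous φ := fun φ => (StarAlgEquiv.isometry φ).continuous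
  -- At each d_k the conjugated families differ by at most (1/2)^n for n ≥ k, so their limits agree
  -- on a dense set. Continuity of all the maps gives equality everywhere.
  have key : ∀ i b, θ (r i (θ.symm b)) = κ (s i (κ.symm b)) := fun i => by
    refine congrFun (hd.equalizer ((cont θ).comp ((hr i).comp (cont θ.symm)))
      ((cont κ).comp ((hs i).comp (cont κ.symm))) (funext fun k => ?_))
    have h1 := tendsto_conj hθ (((hr i).tendsto _).comp (hθ' (d k)))
    have h2 := tendsto_conj hκ (((hs i).tendsto _).comp (hκ' (d k)))
    have h3 := (h1.sub h2).norm
    have h4 : Tendsto (fun n : ℕ => (1 / 2 : ℝ) ^ n) atTop (𝓝 0) :=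
      tendsto_pow_atTop_nhds_zero_of_lt_one (by norm_num) (by norm_num)
    have h5 := le_of_tendsto_of_tendsto h3 h4 ((eventually_ge_atTop k).mono fun n hn =>
      (Finset.single_le_sum (f := fun i => ‖((z n).1 : A) * r i (star ((z n).1 : A) * d k * (z n).1) *
        star ((z n).1 : A) - (z n).2 * s i (star ((z n).2 : A) * d k * (z n).2) *
        star ((z n).2 : A)‖) (fun _ _ => norm_nonneg _) (Finset.mem_univ i)).trans (hz n k hn).1)
    exact sub_eq_zero.1 (norm_le_zero_iff.1 h5)
  -- From θ r θ⁻¹ = κ s κ⁻¹ one gets s = (κ⁻¹θ) r (κ⁻¹θ)⁻¹, and κ⁻¹θ is the pointwise limit of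
  -- Ad(y_n* x_n).
  refine ⟨θ.trans κ.symm, fun F ε hε => ?_, fun i a => ?_⟩
  · have h1 : ∀ a, Tendsto (fun n => star ((z n).2 : A) * ((z n).1 * a * star ((z n).1 : A)) *
        (z n).2) atTop (𝓝 (κ.symm (θ a))) := fun a => by
      have := tendsto_conj (x := fun n => star (z n).2) (φ := κ.symm) (by simpa using hκ') (hθ a)
      simpa using this
    have h2 : ∀ᶠ n in atTop, ∀ a ∈ F, ‖κ.symm (θ a) - star ((z n).2 : A) *
        ((z n).1 * a * star ((z n).1 : A)) * (z n).2‖ < ε := by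
      rw [Filter.eventually_all_finset]
      intro a _
      have := (tendsto_iff_norm_sub_tendsto_zero.1 (h1 a)).eventually_lt_const hε
      simpa only [norm_sub_rev] using this
    obtain ⟨n, hn⟩ := h2.exists
    refine ⟨star ((z n).2 : A) * (z n).1, mul_mem (Unitary.star_mem (z n).2.2) (z n).1.2,
      fun a ha => ?_⟩
    have := hn a ha
    change ‖κ.symm (θ a) - _‖ < ε
    simpa only [star_mul, star_star, mul_assoc] using this
  · have h1 := key i (θ a)
    rw [StarAlgEquiv.symm_apply_apply] at h1
    change s i (κ.symm (θ a)) = κ.symm (θ (r i a))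
    rw [h1, StarAlgEquiv.symm_apply_apply]

end CStarAlgebra
end

/-! ### Reduction of intertwiners to one side, and conjugation estimates -/

noncomputable section

namespace CStarAlgebra

variable {A : Type*} [CStarAlgebra A] {I : Type*} [Fintype I]

lemma conjDist_nonneg (r s : I → A → A) (x y : A) (a : A) : 0 ≤ conjDist r s x y a :=
  Finset.sum_nonneg fun _ _ => norm_nonneg _

lemma conjDist_mul_left (r s : I → A → A) (y : unitary A) (t z : A) (a : A) :
    conjDist r s (y * t) (y * z) a = conjDist r s t z (star (y : A) * a * y) := by
  refine Finset.sum_congr rfl fun i _ => ?_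
  conv_rhs => rw [← norm_unitary_conj_sub y]
  simp only [star_mul, mul_assoc]

lemma HasIntertwiners.mono {r s : I → A → A} {C C' : ℝ} (h : HasIntertwiners r s C) (hC : C ≤ C') :
    HasIntertwiners r s C' := fun x y F η hη => by
  obtain ⟨x', hx'⟩ := h x y F η hη
  refine ⟨x', fun a ha => ⟨(hx' a ha).1, (hx' a ha).2.trans ?_⟩⟩
  gcongr
  exact conjDist_nonneg r s x y a

/-- Conjugating everything by y* replaces (x, y) by (y*x, 1) and a by y*ay. If t is an intertwiner
for the transported data, y t is one for the original. -/
lemma HasIntertwiners.of_one {r s : I → A → A} {C : ℝ}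
    (h : ∀ (z : unitary A) (F : Finset A) (η : ℝ), 0 < η → ∃ t : unitary A, ∀ a ∈ F,
      conjDist r s t 1 a ≤ η ∧
      ‖(t : A) * (star (z : A) * a * z) * star (t : A) - a‖ ≤ C * conjDist r s z 1 a + η) :
    HasIntertwiners r s C := fun x y F η hη => by
  classical
  obtain ⟨t, ht⟩ := h (star y * x) (F.image fun a => star (y : A) * a * y) η hη
  have hy := Unitary.mul_star_self_of_mem y.2
  refine ⟨y * t, fun a ha => ?_⟩
  obtain ⟨h1, h2⟩ := ht _ (Finset.mem_image_of_mem _ ha)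
  have e1 := conjDist_mul_left r s y t 1 a
  have e2 := conjDist_mul_left r s y (star (y : A) * x) 1 a
  rw [mul_one] at e1 e2
  rw [← mul_assoc, hy, one_mul] at e2
  have e3 : (t : A) * (star ((star y * x : unitary A) : A) * (star (y : A) * a * y) *
      (star y * x : unitary A)) * star (t : A) = t * (star (x : A) * a * x) * star (t : A) := by
    congr 2
    calc _ = star (x : A) * ((y : A) * star (y : A)) * a * ((y : A) * star (y : A)) * x := by
          simp only [Submonoid.coe_mul, Unitary.coe_star, star_mul, star_star, mul_assoc]
      _ = _ := by rw [hy, mul_one, mul_one]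
  refine ⟨by rw [← e1] at h1; exact h1, ?_⟩
  rw [e3, ← norm_unitary_conj_sub y, unitary_conj_star_conj] at h2
  have e4 : conjDist r s ((star y * x : unitary A) : A) 1 (star (y : A) * a * y) =
      conjDist r s x y a := e2.symm
  rw [e4] at h2
  simpa [mul_assoc] using h2

lemma norm_conj_sub_conj_le {w f : A} {d : ℝ} (hw : ‖w‖ ≤ 1) (hf : ‖f‖ ≤ 2) (h : ‖w - f‖ ≤ d)
    (a : A) : ‖w * a * star w - f * a * star f‖ ≤ 3 * d * ‖a‖ := by
  have e : w * a * star w - f * a * star f = (w - f) * a * star w + f * a * star (w - f) := by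
    rw [star_sub, sub_mul, sub_mul, mul_sub]; abel
  have h1 : ‖(w - f) * a * star w‖ ≤ d * ‖a‖ * 1 := by
    refine (norm_mul_le _ _).trans (mul_le_mul ((norm_mul_le _ _).trans ?_) (by rwa [norm_star])
      (norm_nonneg _) (mul_nonneg ((norm_nonneg _).trans h) (norm_nonneg _)))
    gcongr
  have h2 : ‖f * a * star (w - f)‖ ≤ 2 * ‖a‖ * d := by
    refine (norm_mul_le _ _).trans (mul_le_mul ((norm_mul_le _ _).trans ?_) (by rwa [norm_star])
      (norm_nonneg _) (by positivity))
    gcongr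
  rw [e]
  refine (norm_add_le _ _).trans ((add_le_add h1 h2).trans_eq (by ring))

end CStarAlgebra

/-! ### Components of coactions, and sequences in A ⊗ K -/

namespace Coaction

open Coalgebra HopfAlgebra CStarHopf Module CStarAlgebra
open scoped BoundedContinuousFunction
open Filter Topology

variable {K : Type*} [FinDimCStarHopfAlgebra K] {A : Type*} [CStarAlgebra A]

/-- The embedding of `A` into `ℓ^∞(ℕ, A)` by constant sequences. -/
def constSeq (A : Type*) [CStarAlgebra A] : A →⋆ₐ[ℂ] (ℕ →ᵇ A) where
  toFun a := BoundedContinuousFunction.const ℕ a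
  map_one' := rfl
  map_mul' _ _ := rfl
  map_zero' := rfl
  map_add' _ _ := rfl
  commutes' _ := rfl
  map_star' _ := rfl

lemma mapLeft_ev_constSeq (n : ℕ) (X : A ⊗[ℂ] K) :
    mapLeft (evₐ A n) K (mapLeft (constSeq A) K X) = X := by
  induction X with
  | zero => simp
  | add X Y hX hY => simp only [map_add, hX, hY]
  | tmul a x => rfl

lemma mapLeft_mk_constSeq (X : A ⊗[ℂ] K) :
    mapLeft (SeqAlg.mk A) K (mapLeft (constSeq A) K X) = mapLeft (SeqAlg.const A) K X := by
  induction X with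
  | zero => simp
  | add X Y hX hY => simp only [map_add, hX, hY]
  | tmul a x => rfl

lemma tendsto_sliceNorm_of_mapLeft_mk {Z : (ℕ →ᵇ A) ⊗[ℂ] K} (h : mapLeft (SeqAlg.mk A) K Z = 0) :
    Tendsto (fun n => sliceNorm (mapLeft (evₐ A n) K Z)) atTop (𝓝 0) := by
  rw [← Finset.sum_const_zero (s := (Finset.univ : Finset (Fin (finrank ℂ K))))]
  refine tendsto_finsetSum _ fun i _ => ?_
  have h1 := congr(slice (SeqAlg A) ((finBasis ℂ K).coord i) $h)
  rw [mapLeft_eq, slice_rTensor, map_zero] at h1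
  have h2 : slice (ℕ →ᵇ A) ((finBasis ℂ K).coord i) Z ∈ nullSeq A := Ideal.Quotient.eq_zero_iff_mem.1 h1
  simpa only [slice_apply_seq] using tendsto_zero_iff_norm_tendsto_zero.1 h2

/-- Approximate unitary equivalence in terms of sequences in `A ⊗ K`. -/
lemma ApproxUnitarilyEquivalent.exists_seq {ρ σ : Coaction K A}
    (h : ρ.ApproxUnitarilyEquivalent σ) : ∃ v : ℕ → A ⊗[ℂ] K,
      Tendsto (fun n => sliceNorm (v n * star (v n) - 1)) atTop (𝓝 0) ∧
      Tendsto (fun n => sliceNorm (star (v n) * v n - 1)) atTop (𝓝 0) ∧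
      (∀ a, Tendsto (fun n => sliceNorm (v n * ρ a * star (v n) - σ a)) atTop (𝓝 0)) ∧
      ∀ a, Tendsto (fun n => sliceNorm (star (v n) * σ a * v n - ρ a)) atTop (𝓝 0) := by
  obtain ⟨v, hv, hρσ⟩ := h
  have h1 : star v * v = 1 := Unitary.star_mul_self_of_mem hv
  have h2 : v * star v = 1 := Unitary.mul_star_self_of_mem hv
  -- Tensoring preserves surjectivity, so v lifts to ℓ^∞(ℕ, A) ⊗ K. Evaluation at n is a
  -- *-homomorphism, so every identity for v becomes an asymptotic identity for the terms.
  obtain ⟨V, rfl⟩ : ∃ V, mapLeft (SeqAlg.mk A) K V = v :=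
    LinearMap.rTensor_surjective K (g := (SeqAlg.mk A).toAlgHom.toLinearMap)
      SeqAlg.mkₐ_surjective v
  refine ⟨fun n => mapLeft (evₐ A n) K V, ?_, ?_, fun a => ?_, fun a => ?_⟩
  · have := tendsto_sliceNorm_of_mapLeft_mk (Z := V * star V - 1)
      (by rw [map_sub, map_mul, map_star, h2, map_one, sub_self])
    simpa only [map_sub, map_mul, map_star, map_one] using this
  · have := tendsto_sliceNorm_of_mapLeft_mk (Z := star V * V - 1)
      (by rw [map_sub, map_mul, map_star, h1, map_one, sub_self])
    simpa only [map_sub, map_mul, map_star, map_one] using this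
  · have := tendsto_sliceNorm_of_mapLeft_mk
      (Z := V * mapLeft (constSeq A) K (ρ a) * star V - mapLeft (constSeq A) K (σ a))
      (by rw [map_sub, map_mul, map_mul, map_star, mapLeft_mk_constSeq, mapLeft_mk_constSeq, hρσ,
        sub_self])
    simpa only [map_sub, map_mul, map_star, mapLeft_ev_constSeq] using this
  · have := tendsto_sliceNorm_of_mapLeft_mk
      (Z := star V * mapLeft (constSeq A) K (σ a) * V - mapLeft (constSeq A) K (ρ a))
      (by
        rw [map_sub, map_mul, map_mul, map_star, mapLeft_mk_constSeq, mapLeft_mk_constSeq, hρσ,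
          mul_assoc, mul_assoc _ (star _), h1, mul_one, ← mul_assoc, h1, one_mul, sub_self])
    simpa only [map_sub, map_mul, map_star, mapLeft_ev_constSeq] using this

/-- The components of a coaction in a basis of `K`. -/
def component (ρ : Coaction K A) (i : Fin (finrank ℂ K)) (a : A) : A :=
  slice A ((finBasis ℂ K).coord i) (ρ a)

lemma slice_conj {D : Type*} [Ring D] [Algebra ℂ D] (f : Dual ℂ K) (x y : D) (X : D ⊗[ℂ] K) :
    slice D f ((x ⊗ₜ 1) * X * (y ⊗ₜ 1)) = x * slice D f X * y := by
  rw [slice_mul_tmul, mulRight_one_comp, slice_tmul_mul, mulLeft_one_comp]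

lemma sliceNorm_conj (z : unitary A) (X : A ⊗[ℂ] K) :
    sliceNorm (((z : A) ⊗ₜ 1) * X * (star (z : A) ⊗ₜ 1)) = sliceNorm X := by
  simp only [sliceNorm, slice_conj, norm_unitary_conj]

lemma conjDist_component_one (ρ σ : Coaction K A) (z a : A) :
    conjDist ρ.component σ.component z 1 a =
      sliceNorm ((z ⊗ₜ 1) * ρ (star z * a * z) * (star z ⊗ₜ 1) - σ a) := by
  refine Finset.sum_congr rfl fun i _ => ?_
  rw [map_sub, slice_conj]
  simp [component]

lemma exists_component_bound (ρ : Coaction K A) :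
    ∃ R : ℝ, 0 ≤ R ∧ ∀ i a, ‖ρ.component i a‖ ≤ R * ‖a‖ := by
  choose C hC using fun i => exists_bound ρ.toStarAlgHom ((finBasis ℂ K).coord i)
  refine ⟨∑ i, |C i|, Finset.sum_nonneg fun _ _ => abs_nonneg _, fun i a => (hC i a).trans ?_⟩
  gcongr
  exact (le_abs_self _).trans
    (Finset.single_le_sum (f := fun i => |C i|) (fun _ _ => abs_nonneg _) (Finset.mem_univ i))

lemma eventually_norm_le {f g : ℕ →ᵇ A} (h : SeqAlg.mk A f = SeqAlg.mk A g) {ε : ℝ} (hε : 0 < ε) :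
    ∀ᶠ n in atTop, ‖f n‖ ≤ ‖g n‖ + ε := by
  have h1 : f - g ∈ nullSeq A := SeqAlg.mkₐ_eq_iff.1 h
  filter_upwards [(tendsto_zero_iff_norm_tendsto_zero.1 h1).eventually_lt_const hε] with n hn
  have h2 : ‖f n - g n‖ < ε := hn
  linarith [norm_le_norm_add_norm_sub' (f n) (g n)]

lemma continuous_component (ρ : Coaction K A) (i : Fin (finrank ℂ K)) :
    Continuous (ρ.component i) := by
  obtain ⟨R, -, hR⟩ := ρ.exists_component_bound
  exact ((slice A ((finBasis ℂ K).coord i) ∘ₗ ρ.lin).mkContinuous R (hR i)).continuous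

end Coaction
end

/-! ### Almost unitaries intertwining the two coactions -/

noncomputable section

namespace Coaction

open Coalgebra HopfAlgebra CStarHopf Module CStarAlgebra
open scoped BoundedContinuousFunction
open Filter Topology

variable {K : Type*} [FinDimCStarHopfAlgebra K] {A : Type*} [CStarAlgebra A]

lemma lTensor_conj {D : Type*} [Ring D] [Algebra ℂ D] (T : K →ₗ[ℂ] K) (x y : D) (X : D ⊗[ℂ] K) :
    T.lTensor D ((x ⊗ₜ 1) * X * (y ⊗ₜ 1)) = (x ⊗ₜ 1) * T.lTensor D X * (y ⊗ₜ 1) := by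
  induction X with
  | zero => simp
  | add X Y hX hY => simp only [mul_add, add_mul, map_add, hX, hY]
  | tmul a k => simp

lemma sliceSeq_bound {ρ : Coaction K A} {R : ℝ} (hR : ∀ i a, ‖ρ.component i a‖ ≤ R * ‖a‖)
    (i : Fin (finrank ℂ K)) (f : ℕ →ᵇ A) (n : ℕ) :
    ‖ρ.sliceSeq ((finBasis ℂ K).coord i) f n‖ ≤ R * ‖f n‖ := hR i (f n)

/-- If `v ∈ A ⊗ K` is almost unitary and almost implements the equivalence of `ρ` and `σ`, then the
image of `v⋆ (z ⊗ 1)` under the splitting of a Rohlin coaction is represented by a sequence of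
almost unitaries that intertwine `ρ` and `σ`. -/
lemma exists_almost_unitary {ρ σ : Coaction K A} {Φ : A ⊗[ℂ] K →⋆ₐ[ℂ] SeqAlg A} {C R : ℝ}
    (hC : 0 ≤ C) (hR : 0 ≤ R) (hρR : ∀ i a, ‖ρ.component i a‖ ≤ R * ‖a‖)
    (hlift : ∀ X, ∃ f : ℕ →ᵇ A, SeqAlg.mk A f = Φ X ∧ ‖f‖ ≤ C * sliceNorm X)
    (hΦρ : ∀ a, Φ (ρ a) = SeqAlg.const A a)
    (hΦ : ∀ X g, slice (SeqAlg A) g (ρ.infty (Φ X)) = Φ ((convRight g).lTensor A X))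
    (z : unitary A) (F : Finset A) {ε : ℝ} (hε : 0 < ε) {v : A ⊗[ℂ] K}
    (h1 : sliceNorm (v * star v - 1) ≤ ε) (h2 : sliceNorm (star v * v - 1) ≤ ε)
    (h3 : ∀ a ∈ F, sliceNorm (v * ρ a * star v - σ a) ≤ ε)
    (h4 : ∀ a ∈ F, sliceNorm (star v * σ a * v - ρ a) ≤ ε)
    (h5 : ∀ a ∈ F, ∀ i, sliceNorm (star v * σ (σ.component i a) * v - ρ (σ.component i a)) ≤ ε) :
    ∃ u : A, ‖star u * u - 1‖ ≤ (C + 1) * ε ∧ ‖u * star u - 1‖ ≤ (C + 1) * ε ∧ ∀ a ∈ F,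
      ‖u * (star (z : A) * a * z) * star u - a‖ ≤
        ‖u‖ * (C * conjDist ρ.component σ.component z 1 a) * ‖u‖ + (C + 1) * ε ∧
      ∀ i, ‖u * ρ.component i (star u * a * u) * star u - σ.component i a‖ ≤
        ‖u‖ * (R * (C * ε)) * ‖u‖ + (C + 1) * ε := by
  have hz1 := Unitary.star_mul_self_of_mem z.2
  have hz2 := Unitary.mul_star_self_of_mem z.2
  have ez1 : (star (z : A) ⊗ₜ[ℂ] (1 : K)) * ((z : A) ⊗ₜ[ℂ] (1 : K)) = 1 := by
    rw [Algebra.TensorProduct.tmul_mul_tmul, hz1, mul_one, Algebra.TensorProduct.one_def]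
  have ez2 : ((z : A) ⊗ₜ[ℂ] (1 : K)) * (star (z : A) ⊗ₜ[ℂ] (1 : K)) = 1 := by
    rw [Algebra.TensorProduct.tmul_mul_tmul, hz2, mul_one, Algebra.TensorProduct.one_def]
  have ez3 : star ((z : A) ⊗ₜ[ℂ] (1 : K)) = star (z : A) ⊗ₜ[ℂ] (1 : K) := by
    rw [TensorProduct.star_tmul, star_one]
  set Z : A ⊗[ℂ] K := (z : A) ⊗ₜ[ℂ] (1 : K) with hZ
  set Z' : A ⊗[ℂ] K := star (z : A) ⊗ₜ[ℂ] (1 : K) with hZ'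
  have norm_Z : ∀ X : A ⊗[ℂ] K, sliceNorm (Z' * X * Z) = sliceNorm X := fun X => by
    have := sliceNorm_conj (star z) X
    simpa using this
  choose L hL1 hL2 using hlift
  have hL3 : ∀ X n, ‖L X n‖ ≤ C * sliceNorm X := fun X n =>
    ((L X).norm_coe_le_norm n).trans (hL2 X)
  have hL4 : ∀ X n, sliceNorm X ≤ ε → ‖L X n‖ ≤ C * ε := fun X n h => (hL3 X n).trans (by gcongr)
  -- The required u is a late term of f. Any estimate in A^∞ passes to late terms at a cost of ε
  -- through `eventually_norm_le`, which explains the constant C + 1.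
  set f := L (star v * Z) with hf
  have hfΦ : SeqAlg.mk A f = Φ (star v * Z) := hL1 _
  have hfΦ' : SeqAlg.mk A (star f) = Φ (Z' * v) := by
    rw [map_star, hfΦ, ← map_star Φ, star_mul, star_star, ez3]
  have hc : ∀ a, SeqAlg.mk A (constSeq A a) = Φ (ρ a) := fun a => (hΦρ a).symm
  have cancel1 : ∀ X Y : A ⊗[ℂ] K, X * Z * (Z' * Y) = X * Y := fun X Y => by
    rw [mul_assoc, ← mul_assoc Z, ez2, one_mul]
  have conjZ : ∀ Y : A ⊗[ℂ] K, star v * Z * (Z' * Y * Z) * (Z' * v) = star v * Y * v := fun Y => by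
    rw [mul_assoc Z' Y Z, cancel1, ← mul_assoc (star v) Y Z, cancel1]
  have A1 : ∀ᶠ n in atTop, ‖star (f n) * f n - 1‖ ≤ (C + 1) * ε := by
    have e : SeqAlg.mk A (star f * f - 1) = SeqAlg.mk A (L (Z' * (v * star v - 1) * Z)) := by
      rw [hL1, map_sub, map_mul, hfΦ, hfΦ', ← map_mul Φ, map_one, ← map_one Φ, ← map_sub Φ]
      congr 1
      rw [mul_sub, sub_mul, mul_one, ez1]
      simp only [mul_assoc]
    filter_upwards [eventually_norm_le e hε] with n hn
    have h6 := hL4 _ n ((norm_Z (v * star v - 1)).trans_le h1)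
    have h7 : ‖star (f n) * f n - 1‖ ≤ _ := hn
    linarith
  have A2 : ∀ᶠ n in atTop, ‖f n * star (f n) - 1‖ ≤ (C + 1) * ε := by
    have e : SeqAlg.mk A (f * star f - 1) = SeqAlg.mk A (L (star v * v - 1)) := by
      rw [hL1, map_sub, map_mul, hfΦ, hfΦ', ← map_mul Φ, map_one, ← map_one Φ, ← map_sub Φ, cancel1]
    filter_upwards [eventually_norm_le e hε] with n hn
    have h6 := hL4 _ n h2
    have h7 : ‖f n * star (f n) - 1‖ ≤ _ := hn
    linarith
  have A3 : ∀ a ∈ F, ∀ᶠ n in atTop, ‖f n * (star (z : A) * a * z) * star (f n) - a‖ ≤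
        ‖f n‖ * (C * conjDist ρ.component σ.component z 1 a) * ‖f n‖ + (C + 1) * ε := by
    intro a ha
    -- The size of Y is exactly the `conjDist` at a. Replacing Zρ(z*az)Z' by σ(a) leaves Φ(v*σ(a)v),
    -- which is close to Φ(ρ(a)) = a.
    set Y := Z * ρ (star (z : A) * a * z) * Z' - σ a with hY
    have e : SeqAlg.mk A (f * constSeq A (star (z : A) * a * z) * star f - constSeq A a) =
        SeqAlg.mk A (f * L (Z' * Y * Z) * star f + L (star v * σ a * v - ρ a)) := by
      simp only [map_sub, map_add, map_mul (SeqAlg.mk A), hL1, hfΦ, hfΦ', hc]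
      simp only [← map_mul Φ, ← map_sub Φ, ← map_add Φ]
      congr 1
      rw [conjZ, hY]
      simp only [mul_sub, sub_mul, mul_assoc]
      abel
    filter_upwards [eventually_norm_le e hε] with n hn
    have h6 := hL4 _ n (h4 a ha)
    have h7 := hL3 (Z' * Y * Z) n
    rw [norm_Z, hY, hZ, hZ', ← conjDist_component_one] at h7
    have h8 : ‖f n * (star (z : A) * a * z) * star (f n) - a‖ ≤
      ‖f n * L (Z' * Y * Z) n * star (f n) + L (star v * σ a * v - ρ a) n‖ + ε := hn
    have h9 : ‖f n * L (Z' * Y * Z) n * star (f n)‖ ≤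
        ‖f n‖ * (C * conjDist ρ.component σ.component z 1 a) * ‖f n‖ := by
      refine (norm_mul_le _ _).trans ?_
      rw [norm_star]
      gcongr
      exact (norm_mul_le _ _).trans (by gcongr)
    linarith [norm_add_le (f n * L (Z' * Y * Z) n * star (f n)) (L (star v * σ a * v - ρ a) n)]
  have A4 : ∀ a ∈ F, ∀ i, ∀ᶠ n in atTop,
      ‖f n * ρ.component i (star (f n) * a * f n) * star (f n) - σ.component i a‖ ≤
        ‖f n‖ * (R * (C * ε)) * ‖f n‖ + (C + 1) * ε := by
    intro a ha i
    set c := (finBasis ℂ K).coord i with hcdef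
    set b := σ.component i a with hb
    set Y := v * ρ a * star v - σ a with hY
    -- Up to the error Y, f* a f represents Φ(Z'σ(a)Z). Equivariance and coassociativity of σ turn
    -- its c-component into Φ(Z'σ(b)Z) with b = σ_i(a), and conjugation by f turns that into
    -- Φ(v*σ(b)v), close to Φ(ρ(b)) = b.
    have e : SeqAlg.mk A (f * ρ.sliceSeq c (star f * constSeq A a * f) * star f - constSeq A b) =
        SeqAlg.mk A (f * ρ.sliceSeq c (L (Z' * Y * Z)) * star f + L (star v * σ b * v - ρ b)) := by
      simp only [map_sub, map_add, map_mul (SeqAlg.mk A), hL1, hfΦ, hfΦ', hc, ← slice_infty_mk]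
      simp only [← map_mul Φ, hΦ]
      simp only [← map_sub Φ, ← map_add Φ]
      congr 1
      have e1 : Z' * v * ρ a * (star v * Z) = Z' * Y * Z + Z' * σ a * Z := by
        rw [hY, mul_sub, sub_mul, sub_add_cancel]; simp only [mul_assoc]
      have e2 : (convRight c).lTensor A (Z' * σ a * Z) = Z' * σ b * Z := by
        rw [hZ, hZ', lTensor_conj, ← apply_slice σ]; rfl
      rw [e1, map_add, e2]
      simp only [mul_add, add_mul, conjZ, add_sub_assoc]
    filter_upwards [eventually_norm_le e hε] with n hn
    have h6 := hL4 _ n (h5 a ha i)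
    have h7 := (sliceSeq_bound hρR i (L (Z' * Y * Z)) n).trans
      (mul_le_mul_of_nonneg_left (hL4 _ n ((norm_Z Y).trans_le (h3 a ha))) hR)
    have h8 : ‖f n * ρ.component i (star (f n) * a * f n) * star (f n) - b‖ ≤
      ‖f n * ρ.sliceSeq c (L (Z' * Y * Z)) n * star (f n) + L (star v * σ b * v - ρ b) n‖ + ε := hn
    have h9 : ‖f n * ρ.sliceSeq c (L (Z' * Y * Z)) n * star (f n)‖ ≤
        ‖f n‖ * (R * (C * ε)) * ‖f n‖ := by
      refine (norm_mul_le _ _).trans ?_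
      rw [norm_star]
      gcongr
      exact (norm_mul_le _ _).trans (by gcongr)
    linarith [norm_add_le (f n * ρ.sliceSeq c (L (Z' * Y * Z)) n * star (f n))
      (L (star v * σ b * v - ρ b) n)]
  have A3' := (Filter.eventually_all_finset F).2 A3
  have A4' := (Filter.eventually_all_finset F).2 fun a ha => Filter.eventually_all.2 (A4 a ha)
  obtain ⟨n, ⟨⟨hn1, hn2⟩, hn3⟩, hn4⟩ := (((A1.and A2).and A3').and A4').exists
  exact ⟨f n, hn1, hn2, fun a ha => ⟨hn3 a ha, hn4 a ha⟩⟩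

end Coaction
end

/-! ### From almost unitaries to intertwining unitaries -/

noncomputable section

namespace CStarAlgebra

variable {A : Type*} [CStarAlgebra A]

lemma norm_coe_unitary_le_one (w : unitary A) : ‖(w : A)‖ ≤ 1 := by
  rcases subsingleton_or_nontrivial A with h | h
  · rw [Subsingleton.elim (w : A) 0, norm_zero]
    exact zero_le_one
  · exact (CStarRing.norm_coe_unitary w).le

/-- Changing the outer conjugation costs 3d. Changing the inner one also costs 3d, multiplied by
‖u‖² ≤ 4 from the outer factors; hence 15 = 3 + 12. -/
lemma norm_conj_map_conj_sub_le {r : A → A} (hr : ∀ a b, r (a - b) = r a - r b) {R : ℝ}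
    (hR0 : 0 ≤ R) (hR : ∀ a, ‖r a‖ ≤ R * ‖a‖) {w : unitary A} {u : A} {d : ℝ} (hu : ‖u‖ ≤ 2)
    (h : ‖(w : A) - u‖ ≤ d) (a : A) :
    ‖(w : A) * r (star (w : A) * a * w) * star (w : A) - u * r (star u * a * u) * star u‖ ≤
      15 * d * R * ‖a‖ := by
  have hd : 0 ≤ d := (norm_nonneg _).trans h
  have h1 := norm_conj_sub_conj_le (norm_coe_unitary_le_one w) hu h (r (star (w : A) * a * w))
  have h2 : ‖star (w : A) * a * w - star u * a * u‖ ≤ 3 * d * ‖a‖ := by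
    have := norm_conj_sub_conj_le (w := star (w : A)) (f := star u) (d := d)
      (by rw [norm_star]; exact norm_coe_unitary_le_one w) (by rwa [norm_star])
      (by rwa [← star_sub, norm_star]) a
    simpa only [star_star] using this
  have h3 : ‖r (star (w : A) * a * w)‖ ≤ R * ‖a‖ := by
    have := norm_unitary_conj (star w) a
    rw [Unitary.coe_star, star_star] at this
    exact (hR _).trans_eq (by rw [this])
  have h4 : ‖u * (r (star (w : A) * a * w) - r (star u * a * u)) * star u‖ ≤
      2 * (R * (3 * d * ‖a‖)) * 2 := by
    refine (norm_mul_le _ _).trans (mul_le_mul ((norm_mul_le _ _).trans ?_) (by rwa [norm_star])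
      (norm_nonneg _) (by positivity))
    rw [← hr]
    gcongr
    exact (hR _).trans (by gcongr)
  have h5 : 3 * d * ‖r (star (w : A) * a * w)‖ ≤ 3 * d * (R * ‖a‖) := by gcongr
  have e : (w : A) * r (star (w : A) * a * w) * star (w : A) - u * r (star u * a * u) * star u =
      ((w : A) * r (star (w : A) * a * w) * star (w : A) -
        u * r (star (w : A) * a * w) * star u) +
      u * (r (star (w : A) * a * w) - r (star u * a * u)) * star u := by
    rw [mul_sub, sub_mul, sub_add_sub_cancel]
  rw [e]
  refine (norm_add_le _ _).trans ?_
  linarith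

end CStarAlgebra

namespace Coaction

open Coalgebra HopfAlgebra CStarHopf Module CStarAlgebra
open Filter Topology

variable {K : Type*} [FinDimCStarHopfAlgebra K] {A : Type*} [CStarAlgebra A] {ρ σ : Coaction K A}

lemma ApproxUnitarilyEquivalent.symm (h : ρ.ApproxUnitarilyEquivalent σ) :
    σ.ApproxUnitarilyEquivalent ρ := by
  obtain ⟨v, hv, h⟩ := h
  refine ⟨star v, Unitary.star_mem hv, fun a => ?_⟩
  have h1 : star v * v = 1 := Unitary.star_mul_self_of_mem hv
  rw [h, star_star, mul_assoc, mul_assoc _ (star v), h1, mul_one, ← mul_assoc, h1, one_mul]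

lemma component_sub (ρ : Coaction K A) (i : Fin (finrank ℂ K)) (a b : A) :
    ρ.component i (a - b) = ρ.component i a - ρ.component i b := by
  have h : ρ (a - b) = ρ a - ρ b := map_sub ρ.toStarAlgHom a b
  rw [component, h, map_sub]; rfl

/-- Conjugates of approximately unitarily equivalent coactions, the first of which has the Rohlin
property, can be intertwined approximately. -/
theorem IsRohlin.hasIntertwiners (hρ : ρ.IsRohlin) (h : ρ.ApproxUnitarilyEquivalent σ) :
    ∃ C, 0 ≤ C ∧ HasIntertwiners ρ.component σ.component C := by
  obtain ⟨Φ, C, hC, hlift, hΦρ, hΦ⟩ := hρ.exists_splitting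
  obtain ⟨R, hR, hρR⟩ := ρ.exists_component_bound
  obtain ⟨v, hv1, hv2, hv3, hv4⟩ := h.exists_seq
  -- The bound ‖u‖ ≤ 2 contributes the factor 4. This constant does not depend on z, F or η, as the
  -- summability of the corrections requires.
  refine ⟨4 * C, by positivity, HasIntertwiners.of_one fun z F η hη => ?_⟩
  set N : ℝ := (finrank ℂ K : ℝ)
  have hN : 0 ≤ N := Nat.cast_nonneg _
  set S := ∑ a ∈ F, ‖a‖
  have hS : ∀ a ∈ F, ‖a‖ ≤ S := fun a ha =>
    Finset.single_le_sum (f := fun a => ‖a‖) (fun _ _ => norm_nonneg _) ha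
  have hS0 : 0 ≤ S := Finset.sum_nonneg fun _ _ => norm_nonneg _
  -- M₁ ε bounds the sum over the N components of the coaction error, and M₂ ε bounds the additive
  -- error in almost commutation. In each, the term with S is the price of replacing u by the
  -- unitary w.
  set M₁ := N * (15 * (C + 1) * R * S + 4 * (R * C) + (C + 1))
  set M₂ := 3 * (C + 1) * S + (C + 1)
  have hM₁ : 0 ≤ M₁ := by positivity
  have hM₂ : 0 ≤ M₂ := by positivity
  -- The minimum with 1 ensures that d = (C + 1)ε < 1, so that u can be perturbed to a unitary.
  set ε := min η 1 / (M₁ + M₂ + 1)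
  have hε : 0 < ε := by positivity
  have hεM : (M₁ + M₂ + 1) * ε = min η 1 := by simp only [ε]; field_simp
  have hε₁ : M₁ * ε ≤ η := by nlinarith [min_le_left η 1, mul_nonneg hM₂ hε.le]
  have hε₂ : M₂ * ε ≤ η := by nlinarith [min_le_left η 1, mul_nonneg hM₁ hε.le]
  set d := (C + 1) * ε with hd
  have hd0 : 0 ≤ d := by positivity
  have hd1 : d < 1 := by
    have : 0 ≤ 3 * (C + 1) * S * ε := by positivity
    have : M₂ * ε = 3 * (C + 1) * S * ε + d := by ring
    nlinarith [min_le_right η 1, mul_nonneg hM₁ hε.le]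
  have ev3 := (Filter.eventually_all_finset F).2 fun a _ => (hv3 a).eventually_le_const hε
  have ev4 := (Filter.eventually_all_finset F).2 fun a _ => (hv4 a).eventually_le_const hε
  -- The vectors σ_i(a) are fixed before n is chosen, so only finitely many convergence conditions
  -- are imposed.
  have ev5 := (Filter.eventually_all_finset F).2 fun a _ => Filter.eventually_all.2 fun i =>
    (hv4 (σ.component i a)).eventually_le_const hε
  obtain ⟨n, ⟨⟨⟨h1, h2⟩, h3⟩, h4⟩, h5⟩ := (((((hv1.eventually_le_const hε).and
    (hv2.eventually_le_const hε)).and ev3).and ev4).and ev5).exists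
  obtain ⟨u, hu1, hu2, hu⟩ :=
    exists_almost_unitary hC hR hρR hlift hΦρ hΦ z F hε h1 h2 h3 h4 h5
  obtain ⟨w, hw, hwu⟩ := exists_unitary_norm_sub_le hd1 hu1 hu2
  lift w to unitary A using hw
  have hw1 := norm_coe_unitary_le_one w
  have hu2 : ‖u‖ ≤ 2 := by linarith [norm_le_norm_add_norm_sub' u (w : A), norm_sub_rev u (w : A)]
  have hconj : ∀ c : ℝ, 0 ≤ c → ‖u‖ * c * ‖u‖ ≤ 4 * c := fun c hc => by
    have : ‖u‖ * c * ‖u‖ ≤ 2 * c * 2 := by gcongr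
    linarith
  refine ⟨w, fun a ha => ⟨?_, ?_⟩⟩
  · have hi : ∀ i, ‖(w : A) * ρ.component i (star (w : A) * a * w) * star (w : A) -
        1 * σ.component i (star 1 * a * 1) * star 1‖ ≤
        (15 * (C + 1) * R * S + 4 * (R * C) + (C + 1)) * ε := fun i => by
      rw [star_one, one_mul, one_mul, mul_one, mul_one]
      have h6 := norm_conj_map_conj_sub_le (ρ.component_sub i) hR (hρR i) hu2 hwu a
      have h7 := (hu a ha).2 i
      have h8 := hconj (R * (C * ε)) (by positivity)
      have h9 : 15 * d * R * ‖a‖ ≤ 15 * d * R * S := by gcongr; exact hS a ha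
      have h10 := norm_sub_le_norm_sub_add_norm_sub
        ((w : A) * ρ.component i (star (w : A) * a * w) * star (w : A))
        (u * ρ.component i (star u * a * u) * star u) (σ.component i a)
      have e : (15 * (C + 1) * R * S + 4 * (R * C) + (C + 1)) * ε =
        15 * d * R * S + 4 * (R * (C * ε)) + d := by rw [hd]; ring
      linarith
    refine (Finset.sum_le_card_nsmul _ _ _ fun i _ => hi i).trans ?_
    rw [Finset.card_univ, Fintype.card_fin, nsmul_eq_mul, ← mul_assoc]
    exact hε₁
  · have h6 := norm_conj_sub_conj_le hw1 hu2 hwu (star (z : A) * a * z)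
    have h7 := (hu a ha).1
    have h8 := hconj (C * conjDist ρ.component σ.component z 1 a)
      (mul_nonneg hC (conjDist_nonneg _ _ _ _ _))
    have h9 : ‖star (z : A) * a * z‖ = ‖a‖ := by
      simpa only [Unitary.coe_star, star_star] using norm_unitary_conj (star z) a
    have h10 : 3 * d * ‖a‖ ≤ 3 * d * S := by gcongr; exact hS a ha
    have h11 := norm_sub_le_norm_sub_add_norm_sub
      ((w : A) * (star (z : A) * a * z) * star (w : A))
      (u * (star (z : A) * a * z) * star u) a
    have e : M₂ * ε = 3 * d * S + d := by rw [hd]; ring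
    rw [h9] at h6
    linarith

end Coaction
end

/-! ### Conclusion -/

theorem mainTheorem1 {K : Type*} [FinDimCStarHopfAlgebra K] {A : Type*} [CStarAlgebra A]
    [TopologicalSpace.SeparableSpace A] (ρ σ : Coaction K A)
    (hρ : ρ.IsRohlin) (hσ : σ.IsRohlin) (h : ρ.ApproxUnitarilyEquivalent σ) :
    ∃ θ : A ≃⋆ₐ[ℂ] A, IsApproxInner θ ∧
      ∀ a : A, σ a = mapLeft (θ : A →⋆ₐ[ℂ] A) K (ρ (θ.symm a)) := by
  obtain ⟨C₁, hC₁, h₁⟩ := hρ.hasIntertwiners h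
  obtain ⟨C₂, -, h₂⟩ := hσ.hasIntertwiners h.symm
  -- The Rohlin property of ρ corrects the ρ side and that of σ the σ side. Components in a basis of
  -- K determine the coactions, so intertwining them is the required identity.
  obtain ⟨θ, hθ, hint⟩ := CStarAlgebra.exists_isApproxInner_intertwining
    ρ.continuous_component σ.continuous_component (hC₁.trans (le_max_left C₁ C₂))
    (h₁.mono (le_max_left C₁ C₂)) (h₂.mono (le_max_right C₁ C₂))
  refine ⟨θ, hθ, fun a => ?_⟩
  rw [← CStarHopf.sum_slice_tmul (σ a),
    ← CStarHopf.sum_slice_tmul (mapLeft (θ : A →⋆ₐ[ℂ] A) K (ρ (θ.symm a)))]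
  refine Finset.sum_congr rfl fun i _ => ?_
  have := hint i (θ.symm a)
  rw [StarAlgEquiv.apply_symm_apply] at this
  rw [mapLeft_eq, Coaction.slice_rTensor]
  exact congrArg (· ⊗ₜ[ℂ] _) this
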